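/- Let $A$ be a commutative ring, $G$ a group and $\mathscr{X}$ a class of groups. For a ring $R$, let $\mathrm{spli}(R)$ (resp. $\mathrm{sfli}(R)$) be the supremum of the projective (resp. flat) dimensions of the injective $R$-modules. An $R$-module is Gorenstein projective if it is isomorphic to a cycle module (kernel of a differential) of an acyclic complex of projective modules that stays exact under $\mathrm{Hom}_R(-,Q)$ for every projective $Q$; Gorenstein injective if it is isomorphic to a cycle module of an acyclic complex of injective modules that stays exact under $\mathrm{Hom}_R(I,-)$ for every injective $I$; and Gorenstein flat if it is isomorphic to a cycle module of an acyclic complex of flat modules that stays exact under tensoring over $R$ with every injective $R$-module of the opposite side. The Gorenstein projective dimension $\mathrm{Gpd}_R(M)$ (resp. the Gorenstein flat dimension $\mathrm{Gfd}_R(M)$) is the minimal length of a resolution of $M$ by Gorenstein projective (resp. Gorenstein flat) modules, and the Gorenstein injective dimension $\mathrm{Gid}_R(M)$ is the minimal length of a coresolution of $M$ by Gorenstein injective modules; each is $\infty$ if no finite such (co)resolution exists. A group $H$ is in $\mathscr{X}_{\mathrm{Char}}$ (admits a characteristic module over $A$) if there are an $AH$-module $M$ that is free over $A$ and of finite projective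 dimension over $AH$, and an $AH$-linear monomorphism $A\to M$ from the trivial module that splits over $A$. A group $H$ is in $\mathscr{X}_{\mathrm{WChar}}$ (admits a weak characteristic module over $A$) if there are an $AH$-module $N$ that is flat over $A$ and of finite flat dimension over $AH$, and an $AH$-linear monomorphism $A\to N$ from the trivial module that is pure over $A$. For $d\in\{\mathrm{Gpd},\mathrm{Gid},\mathrm{Gfd}\}$, let $\kappa_d(AG;\mathscr{X})$ be the supremum of $d_{AG}(M)$ over all $AG$-modules $M$ such that $d_{AH}(M)<\infty$ for every subgroup $H\leqslant G$ with $H\in\mathscr{X}$. The group $G$ is of type $\Phi(d,\mathscr{X})$ over $A$ if for every $AG$-module $M$ one has $d_{AG}(M)<\infty$ if and only if $d_{AH}(M)<\infty$ for every subgroup $H\leqslant G$ with $H\in\mathscr{X}$. Suppose first that $\mathrm{spli}(A)<\infty$ and $\mathscr{X}\subseteq\mathscr{X}_{\mathrm{Char}}$. Then: (i) $\kappa_{\mathrm{Gpd}}(AG;\mathscr{X})<\infty$ if and only if $G$ is of type $\Phi(\mathrm{Gpd},\mathscr{X})$ over $A$. (ii) $\kappa_{\mathrm{Gid}}(AG;\mathscr{X})<\infty$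 if and only if $G$ is of type $\Phi(\mathrm{Gid},\mathscr{X})$ over $A$. Suppose instead that $\mathrm{sfli}(A)<\infty$ and $\mathscr{X}\subseteq\mathscr{X}_{\mathrm{WChar}}$. Then: (iii) $\kappa_{\mathrm{Gfd}}(AG;\mathscr{X})<\infty$ if and only if $G$ is of type $\Phi(\mathrm{Gfd},\mathscr{X})$ over $A$. -/

import Mathlib

open CategoryTheory
open scoped TensorProduct

universe u

noncomputable section

namespace PhiGorenstein

/-! ### Tensor products over a noncommutative ring, flat modules

Modules are left modules; a right `R`-module is a module over `Rᵐᵒᵖ`. -/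

/-- The subgroup of `N ⊗[ℤ] M` generated by the elements `n r ⊗ m - n ⊗ r m`. -/
def balancedRel (R : Type u) [Ring R] (N : Type u) [AddCommGroup N] [Module Rᵐᵒᵖ N]
    (M : Type u) [AddCommGroup M] [Module R M] : AddSubgroup (N ⊗[ℤ] M) :=
  AddSubgroup.closure
    {t | ∃ (n : N) (r : R) (m : M), t = (MulOpposite.op r • n) ⊗ₜ[ℤ] m - n ⊗ₜ[ℤ] (r • m)}

/-- The abelian group `N ⊗_R M`, for a right module `N` and a left module `M` over a ring `R`. -/
abbrev BalancedTensor (R : Type u) [Ring R] (N : Type u) [AddCommGroup N] [Module Rᵐᵒᵖ N]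
    (M : Type u) [AddCommGroup M] [Module R M] : Type u :=
  (N ⊗[ℤ] M) ⧸ balancedRel R N M

/-- The additive map `f ⊗ g : N ⊗_R M → N' ⊗_R M'`. -/
def BalancedTensor.map {R : Type u} [Ring R]
    {N N' : Type u} [AddCommGroup N] [Module Rᵐᵒᵖ N] [AddCommGroup N'] [Module Rᵐᵒᵖ N']
    {M M' : Type u} [AddCommGroup M] [Module R M] [AddCommGroup M'] [Module R M']
    (f : N →ₗ[Rᵐᵒᵖ] N') (g : M →ₗ[R] M') :
    BalancedTensor R N M →+ BalancedTensor R N' M' :=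
  QuotientAddGroup.map (balancedRel R N M) (balancedRel R N' M')
    (TensorProduct.map f.toAddMonoidHom.toIntLinearMap
      g.toAddMonoidHom.toIntLinearMap).toAddMonoidHom <| by
    unfold balancedRel
    rw [AddSubgroup.closure_le]
    rintro _ ⟨n, r, m, rfl⟩
    refine AddSubgroup.subset_closure ⟨f n, r, g m, ?_⟩
    simp

/-- A left `R`-module `M` is flat if `- ⊗_R M` preserves monomorphisms of right modules. -/
def IsFlat (R : Type u) [Ring R] (M : ModuleCat.{u} R) : Prop :=
  ∀ (N N' : ModuleCat.{u} Rᵐᵒᵖ) (f : N →ₗ[Rᵐᵒᵖ] N'), Function.Injective f →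
    Function.Injective (BalancedTensor.map f (LinearMap.id : M →ₗ[R] M))

/-! ### Resolutions and coresolutions by modules from a class -/

/-- `HasResolution C n M`: there is an exact sequence `0 → C_n → ⋯ → C_0 → M → 0` with all `C_i`
in the class `C` (obtained by splicing short exact sequences `0 → K → C_i → M' → 0`). -/
inductive HasResolution {R : Type u} [Ring R] (C : ModuleCat.{u} R → Prop) :
    ℕ → ModuleCat.{u} R → Prop
  | zero (M P : ModuleCat.{u} R) (hP : C P) (e : P ≅ M) : HasResolution C 0 M
  | succ (n : ℕ) (K P M : ModuleCat.{u} R) (hP : C P) (hK : HasResolution C n K)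
      (i : K →ₗ[R] P) (p : P →ₗ[R] M) (hi : Function.Injective i) (hip : Function.Exact i p)
      (hp : Function.Surjective p) : HasResolution C (n + 1) M

/-- `HasCoresolution C n M`: there is an exact sequence `0 → M → C_0 → ⋯ → C_n → 0` with all `C_i`
in the class `C`. -/
inductive HasCoresolution {R : Type u} [Ring R] (C : ModuleCat.{u} R → Prop) :
    ℕ → ModuleCat.{u} R → Prop
  | zero (M E : ModuleCat.{u} R) (hE : C E) (e : M ≅ E) : HasCoresolution C 0 M
  | succ (n : ℕ) (M E L : ModuleCat.{u} R) (hE : C E) (hL : HasCoresolution C n L)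
      (i : M →ₗ[R] E) (p : E →ₗ[R] L) (hi : Function.Injective i) (hip : Function.Exact i p)
      (hp : Function.Surjective p) : HasCoresolution C (n + 1) M

/-- The minimum length of a resolution of `M` by modules in `C` (`⊤` if there is none). -/
def resolutionDim {R : Type u} [Ring R] (C : ModuleCat.{u} R → Prop) (M : ModuleCat.{u} R) : ℕ∞ :=
  ⨅ (n : ℕ) (_ : HasResolution C n M), (n : ℕ∞)

/-- The minimum length of a coresolution of `M` by modules in `C` (`⊤` if there is none). -/
def coresolutionDim {R : Type u} [Ring R] (C : ModuleCat.{u} R → Prop) (M : ModuleCat.{u} R) :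
    ℕ∞ :=
  ⨅ (n : ℕ) (_ : HasCoresolution C n M), (n : ℕ∞)

/-- The flat dimension. -/
def flatDim (R : Type u) [Ring R] (M : ModuleCat.{u} R) : ℕ∞ :=
  resolutionDim (IsFlat R) M

/-- The supremum of the projective dimensions of the injective `R`-modules. -/
def spli (R : Type u) [Ring R] : WithBot ℕ∞ :=
  ⨆ (I : ModuleCat.{u} R) (_ : Injective I), projectiveDimension I

/-- The supremum of the flat dimensions of the injective `R`-modules. -/
def sfli (R : Type u) [Ring R] : ℕ∞ :=
  ⨆ (I : ModuleCat.{u} R) (_ : Injective I), flatDim R I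

/-! ### Gorenstein modules and Gorenstein dimensions -/

/-- `M` is Gorenstein projective: it is a cycle module of an acyclic complex of projectives that
stays exact under `Hom_R(-, Q)` for every projective `Q`. -/
def IsGorensteinProjective (R : Type u) [Ring R] (M : ModuleCat.{u} R) : Prop :=
  ∃ K : CochainComplex (ModuleCat.{u} R) ℤ,
    (∀ n, Projective (K.X n)) ∧ K.Acyclic ∧
    (∀ Q : ModuleCat.{u} R, Projective Q → ∀ n : ℤ,
      Function.Exact (fun g : K.X (n + 1) ⟶ Q => K.d n (n + 1) ≫ g)
        (fun f : K.X n ⟶ Q => K.d (n - 1) n ≫ f)) ∧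
    Nonempty (M ≃ₗ[R] LinearMap.ker (K.d 0 1).hom)

/-- `M` is Gorenstein injective: it is a cycle module of an acyclic complex of injectives that
stays exact under `Hom_R(I, -)` for every injective `I`. -/
def IsGorensteinInjective (R : Type u) [Ring R] (M : ModuleCat.{u} R) : Prop :=
  ∃ K : CochainComplex (ModuleCat.{u} R) ℤ,
    (∀ n, Injective (K.X n)) ∧ K.Acyclic ∧
    (∀ I : ModuleCat.{u} R, Injective I → ∀ n : ℤ,
      Function.Exact (fun g : I ⟶ K.X (n - 1) => g ≫ K.d (n - 1) n)
        (fun f : I ⟶ K.X n => f ≫ K.d n (n + 1))) ∧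
    Nonempty (M ≃ₗ[R] LinearMap.ker (K.d 0 1).hom)

/-- `M` is Gorenstein flat: it is a cycle module of an acyclic complex of flat modules that
stays exact under `I ⊗_R -` for every injective right module `I`. -/
def IsGorensteinFlat (R : Type u) [Ring R] (M : ModuleCat.{u} R) : Prop :=
  ∃ K : CochainComplex (ModuleCat.{u} R) ℤ,
    (∀ n, IsFlat R (K.X n)) ∧ K.Acyclic ∧
    (∀ I : ModuleCat.{u} Rᵐᵒᵖ, Injective I → ∀ n : ℤ,
      Function.Exact
        (BalancedTensor.map (LinearMap.id : I →ₗ[Rᵐᵒᵖ] I) (K.d (n - 1) n).hom)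
        (BalancedTensor.map (LinearMap.id : I →ₗ[Rᵐᵒᵖ] I) (K.d n (n + 1)).hom)) ∧
    Nonempty (M ≃ₗ[R] LinearMap.ker (K.d 0 1).hom)

/-- Gorenstein projective dimension. -/
def Gpd (R : Type u) [Ring R] (M : ModuleCat.{u} R) : ℕ∞ :=
  resolutionDim (IsGorensteinProjective R) M

/-- Gorenstein injective dimension. -/
def Gid (R : Type u) [Ring R] (M : ModuleCat.{u} R) : ℕ∞ :=
  coresolutionDim (IsGorensteinInjective R) M

/-- Gorenstein flat dimension. -/
def Gfd (R : Type u) [Ring R] (M : ModuleCat.{u} R) : ℕ∞ :=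
  resolutionDim (IsGorensteinFlat R) M

/-! ### Modules over group algebras -/

/-- Restriction of an `AG`-module to `AH`, for a subgroup `H` of `G`. -/
abbrev resSubgroup (A : Type u) [CommRing A] {G : Type u} [Group G] (H : Subgroup G)
    (M : ModuleCat.{u} (MonoidAlgebra A G)) : ModuleCat.{u} (MonoidAlgebra A H) :=
  (ModuleCat.restrictScalars (MonoidAlgebra.mapDomainRingHom A H.subtype)).obj M

/-- The forgetful functor from `AG`-modules to `A`-modules. -/
abbrev toBase (A : Type u) [CommRing A] (G : Type u) [Group G] :
    ModuleCat.{u} (MonoidAlgebra A G) ⥤ ModuleCat.{u} A :=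
  ModuleCat.restrictScalars (algebraMap A (MonoidAlgebra A G))

/-- `A` as an `AG`-module with trivial action of `G` (restriction along the augmentation). -/
abbrev trivialModule (A : Type u) [CommRing A] (G : Type u) [Group G] :
    ModuleCat.{u} (MonoidAlgebra A G) :=
  (ModuleCat.restrictScalars (MonoidAlgebra.lift A A G (1 : G →* A)).toRingHom).obj
    (ModuleCat.of A A)

/-- A monomorphism `f` of `A`-modules is pure if `L ⊗_A f` is injective for all `A`-modules `L`. -/
def IsPureMono {A : Type u} [CommRing A] {M N : ModuleCat.{u} A} (f : M ⟶ N) : Prop :=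
  ∀ L : ModuleCat.{u} A, Function.Injective (LinearMap.lTensor L f.hom)

/-- `G` admits a characteristic module over `A`: an `A`-free `AG`-module of finite projective
dimension with an `A`-split `AG`-monomorphism from the trivial module `A`. -/
def HasCharacteristicModule (A : Type u) [CommRing A] (G : Type u) [Group G] : Prop :=
  ∃ (M : ModuleCat.{u} (MonoidAlgebra A G)) (ι : trivialModule A G ⟶ M),
    Module.Free A ((toBase A G).obj M) ∧ projectiveDimension M < ⊤ ∧
      Mono ι ∧ IsSplitMono ((toBase A G).map ι)

/-- `G` admits a weak characteristic module over `A`: an `A`-flat `AG`-module of finite flat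
dimension with an `A`-pure `AG`-monomorphism from the trivial module `A`. -/
def HasWeakCharacteristicModule (A : Type u) [CommRing A] (G : Type u) [Group G] : Prop :=
  ∃ (N : ModuleCat.{u} (MonoidAlgebra A G)) (ι : trivialModule A G ⟶ N),
    Module.Flat A ((toBase A G).obj N) ∧ flatDim (MonoidAlgebra A G) N < ⊤ ∧
      Mono ι ∧ IsPureMono ((toBase A G).map ι)

/-- The class of groups admitting a characteristic module over `A`. -/
def classChar (A : Type u) [CommRing A] : Set GrpCat.{u} :=
  {G | HasCharacteristicModule A G}

/-- The class of groups admitting a weak characteristic module over `A`. -/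
def classWChar (A : Type u) [CommRing A] : Set GrpCat.{u} :=
  {G | HasWeakCharacteristicModule A G}

/-- The invariant `κ_dim(AG; 𝒳)`: the supremum of `dim_{AG} M` over the `AG`-modules `M` with
`dim_{AH} M` finite for every subgroup `H` of `G` that lies in `𝒳`. -/
def kappa (dim : (R : Type u) → [Ring R] → ModuleCat.{u} R → ℕ∞)
    (A : Type u) [CommRing A] (G : Type u) [Group G] (𝒳 : Set GrpCat.{u}) : ℕ∞ :=
  ⨆ (M : ModuleCat.{u} (MonoidAlgebra A G))
    (_ : ∀ H : Subgroup G, GrpCat.of H ∈ 𝒳 → dim (MonoidAlgebra A H) (resSubgroup A H M) < ⊤),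
    dim (MonoidAlgebra A G) M

/-- `G` is of type `Φ(dim, 𝒳)` over `A`. -/
def IsOfTypePhi (dim : (R : Type u) → [Ring R] → ModuleCat.{u} R → ℕ∞)
    (A : Type u) [CommRing A] (G : Type u) [Group G] (𝒳 : Set GrpCat.{u}) : Prop :=
  ∀ M : ModuleCat.{u} (MonoidAlgebra A G),
    dim (MonoidAlgebra A G) M < ⊤ ↔
      ∀ H : Subgroup G, GrpCat.of H ∈ 𝒳 → dim (MonoidAlgebra A H) (resSubgroup A H M) < ⊤

end PhiGorenstein

end

open PhiGorenstein

/-!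
If `H` lies in `𝒳`, then *every* `AH`-module has finite Gorenstein dimension, so the condition on
the restrictions of a module to the subgroups in `𝒳` is empty. Hence `κ` is the supremum of the
Gorenstein dimensions of all `AG`-modules, and `G` is of type `Φ` if and only if all of these
dimensions are finite; it remains to see that in this case they are bounded (`kappa_lt_top_iff`).

**Modules over `AH`.** Let `A → M` be a characteristic module and let `I` be an injective
`AH`-module. The diagonal tensor product `I ⊗ M` contains `I`, as a direct summand because `I` is
injective (`exists_retract_diag`). As an `A`-module `I` is injective, so it has projective dimension
at most `spli A` over `A`; dimension shifting along projective resolutions of `I` over `A` and of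
`M` over `AH` shows that the projective dimension of `I ⊗ M` over `AH` is at most `spli A` plus that
of `M` (`dimension_diag`). Hence `spli (AH)` is finite (`HasCharacteristicModule.exists_spliLE`).
The same argument with flat dimensions applies to weak characteristic modules
(`HasWeakCharacteristicModule.exists_sfliLE`).

**A bound for `spli R` or `sfli R` bounds the Gorenstein dimensions.** Group algebras over
commutative rings have the involution `g ↦ g⁻¹`, by which left modules are right modules. Let `R` be
a ring with involution whose injective modules have projective dimension at most `m`. Then an
acyclic complex of projective modules is totally acyclic (`exists_factor_of_exact`,
`ext_splice_projective`). Indeed, it stays exact when tensored with an injective module. Testing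
this on a product of counterexamples shows that cycles supported in a finite set of basis elements
bound chains supported in a finite set that does not depend on the injective module or the cycle.
Since the character module of a projective module `Q` is injective, this uniformity allows
factoring cocycles with values in `Q` through the differential, first on finite sets, then on
countable subcomplexes, and on the whole complex by Zorn's lemma (`AcyclicOn.exists_factor`).
Furthermore, embedding modules into injective modules and applying the horseshoe lemma continues a
projective resolution of any module to the right from its `m`-th syzygy on
(`exists_splice_of_syz`), so that `m`-th syzygies are cycles of acyclic complexes of projective
modules. So all Gorenstein projective dimensions are at most `m` (`Gpd_le`). It follows that
projective modules have injective dimension at most `m`, and the splicing argument in the opposite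
category bounds the Gorenstein injective dimensions (`Gid_le`). If only `sfli R` is bounded, the
splicing argument with flat modules bounds the Gorenstein flat dimensions (`Gfd_le`); there,
flatness is the injectivity of the character module, and exactness under tensoring is a vanishing
of `Ext` into character modules (`isFlat_iff`, `isGorensteinFlat_iff`).

**From finiteness to a bound.** If all Gorenstein projective dimensions over `R` are finite, then
injective modules have finite projective dimension, as a module of finite Gorenstein projective
dimension embeds into one of finite projective dimension. The product of injective modules of
unbounded projective dimensions would be a counterexample, so `spli R` is finite
(`exists_spliLE_of_Gpd`). In the other two cases, a product of modules on which the `Ext` of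
injective modules is nonzero in growing degrees would have infinite Gorenstein dimension
(`exists_spliLE_of_Gid`, `exists_sfliLE_of_Gfd`). By the bounds above, finiteness of `spli (AG)` or
`sfli (AG)` bounds all the Gorenstein dimensions at once.
-/

noncomputable section

namespace PhiGorenstein

/-! ### Character modules over a ring with involution -/

/-- The character module `Hom_ℤ(M, ℚ/ℤ)` of a left module over a ring `R` with involution, as a
left `R`-module via `(r • χ) m = χ (star r • m)`. The involution is what keeps it on the left. -/
def StarDual (M : Type u) [AddCommGroup M] : Type u := CharacterModule M

namespace StarDual

section

variable {M : Type u} [AddCommGroup M]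

instance : AddCommGroup (StarDual M) := inferInstanceAs (AddCommGroup (M →+ AddCircle (1 : ℚ)))

instance : FunLike (StarDual M) M (AddCircle (1 : ℚ)) :=
  inferInstanceAs (FunLike (M →+ AddCircle (1 : ℚ)) M (AddCircle (1 : ℚ)))

instance : AddMonoidHomClass (StarDual M) M (AddCircle (1 : ℚ)) :=
  inferInstanceAs (AddMonoidHomClass (M →+ AddCircle (1 : ℚ)) M (AddCircle (1 : ℚ)))

@[ext] lemma ext {χ ψ : StarDual M} (h : ∀ m, χ m = ψ m) : χ = ψ := DFunLike.ext _ _ h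

/-- A character, seen as an element of the dual module. -/
def ofHom (f : M →+ AddCircle (1 : ℚ)) : StarDual M := f

@[simp] lemma ofHom_apply (f : M →+ AddCircle (1 : ℚ)) (m : M) : ofHom f m = f m := rfl

@[simp] lemma add_apply (χ ψ : StarDual M) (m : M) : (χ + ψ) m = χ m + ψ m := rfl

@[simp] lemma zero_apply (m : M) : (0 : StarDual M) m = 0 := rfl

lemma finset_sum_apply {ι : Type*} (s : Finset ι) (χ : ι → StarDual M) (m : M) :
    (∑ i ∈ s, χ i) m = ∑ i ∈ s, χ i m := by
  classical
  induction s using Finset.induction_on with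
  | empty => simp
  | insert a s ha ih => simp [Finset.sum_insert ha, ih]

lemma exists_apply_ne_zero {m : M} (hm : m ≠ 0) : ∃ χ : StarDual M, χ m ≠ 0 :=
  CharacterModule.exists_character_apply_ne_zero_of_ne_zero hm

lemma eq_zero_of_forall_apply {m : M} (h : ∀ χ : StarDual M, χ m = 0) : m = 0 := by
  by_contra hm
  obtain ⟨χ, hχ⟩ := exists_apply_ne_zero hm
  exact hχ (h χ)

/-- Characters separate points from subgroups. -/
lemma exists_character_of_notMem (W : AddSubgroup M) {m : M} (hm : m ∉ W) :
    ∃ χ : StarDual M, (∀ w ∈ W, χ w = 0) ∧ χ m ≠ 0 := by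
  obtain ⟨χ, hχ⟩ := exists_apply_ne_zero (M := M ⧸ W) (m := (m : M ⧸ W))
    (by rwa [Ne, QuotientAddGroup.eq_zero_iff])
  refine ⟨ofHom ((χ : (M ⧸ W) →+ AddCircle (1 : ℚ)).comp (QuotientAddGroup.mk' W)), fun w hw => ?_,
    hχ⟩
  have h0 : (QuotientAddGroup.mk' W) w = 0 := (QuotientAddGroup.eq_zero_iff w).2 hw
  change χ ((QuotientAddGroup.mk' W) w) = 0
  rw [h0, map_zero]

/-- A character of a subobject extends, since `ℚ/ℤ` is divisible. -/
lemma exists_extension {N : Type u} [AddCommGroup N] (f : M →+ N) (hf : Function.Injective f)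
    (χ : M →+ AddCircle (1 : ℚ)) : ∃ ψ : N →+ AddCircle (1 : ℚ), ∀ m, ψ (f m) = χ m := by
  obtain ⟨ψ, hψ⟩ := (Module.Baer.of_divisible (AddCircle (1 : ℚ))).extension_property_addMonoidHom
    f hf χ
  exact ⟨ψ, fun m => DFunLike.congr_fun hψ m⟩

end

section

variable {R : Type u} [Ring R] [StarRing R]
variable {M : Type u} [AddCommGroup M] [Module R M] {N : Type u} [AddCommGroup N] [Module R N]
variable {L : Type u} [AddCommGroup L] [Module R L]

instance : Module R (StarDual M) where
  smul r χ := ofHom (AddMonoidHom.mk' (fun m => χ (star r • m)) fun m m' => by simp)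
  one_smul χ := ext fun m => show χ (star (1 : R) • m) = χ m by simp
  mul_smul r s χ := ext fun m => show χ (star (r * s) • m) = χ (star s • star r • m) by
    simp [mul_smul]
  smul_zero r := ext fun m => rfl
  smul_add r χ ψ := ext fun m => rfl
  add_smul r s χ := ext fun m => show χ (star (r + s) • m) = χ (star r • m) + χ (star s • m) by
    simp [add_smul]
  zero_smul χ := ext fun m => show χ (star (0 : R) • m) = 0 by simp

@[simp] lemma smul_apply (r : R) (χ : StarDual M) (m : M) : (r • χ) m = χ (star r • m) := rfl

/-- The transpose of a linear map. -/
def map (f : M →ₗ[R] N) : StarDual N →ₗ[R] StarDual M where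
  toFun χ := ofHom (AddMonoidHom.mk' (fun m => χ (f m)) fun m m' => by simp)
  map_add' _ _ := rfl
  map_smul' r χ := ext fun m => show χ (star r • f m) = χ (f (star r • m)) by simp

/-- A linear map `M → N^∨` is a pairing of `M` and `N`, hence a linear map `N → M^∨`. -/
def swap (f : M →ₗ[R] StarDual N) : N →ₗ[R] StarDual M where
  toFun n := ofHom (AddMonoidHom.mk' (fun m => f m n) fun m m' => by simp)
  map_add' n n' := ext fun m => show f m (n + n') = f m n + f m n' by simp
  map_smul' r n := ext fun m => show f m (r • n) = f (star r • m) n by simp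

lemma map_surjective (f : M →ₗ[R] N) (hf : Function.Injective f) :
    Function.Surjective (map f) := fun χ => by
  obtain ⟨ψ, hψ⟩ := exists_extension f.toAddMonoidHom hf χ
  exact ⟨ofHom ψ, ext fun m => hψ m⟩

lemma map_injective (f : M →ₗ[R] N) (hf : Function.Surjective f) :
    Function.Injective (map f) := fun χ ψ h => ext fun n => by
  obtain ⟨m, rfl⟩ := hf n
  exact DFunLike.congr_fun h m

lemma map_exact (f : M →ₗ[R] N) (g : N →ₗ[R] L) (h : Function.Exact f g) :
    Function.Exact (map g) (map f) := fun χ => by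
  constructor
  · intro hχ
    -- `χ` kills the range of `f`, the kernel of `g`, so it factors through the range of `g`.
    let e := QuotientAddGroup.lift g.toAddMonoidHom.ker (χ : N →+ AddCircle (1 : ℚ)) (by
      intro n hn
      obtain ⟨m, rfl⟩ := (h n).1 hn
      exact DFunLike.congr_fun hχ m)
    obtain ⟨ψ, hψ⟩ := exists_extension (QuotientAddGroup.kerLift g.toAddMonoidHom)
      (QuotientAddGroup.kerLift_injective _) e
    exact ⟨ofHom ψ, ext fun n => hψ (n : N ⧸ g.toAddMonoidHom.ker)⟩
  · rintro ⟨ψ, rfl⟩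
    ext m
    change ψ (g (f m)) = 0
    rw [(h (f m)).2 ⟨m, rfl⟩, map_zero]

end

end StarDual

/-! ### Matrices acting on finitely supported families -/

section TensorDiff

variable {R : Type u} [Ring R] [StarRing R] {B : Type u}

/-- An endomorphism `d` of the free left module `F` on `B`, given by the images `d b` of the basis,
induces `id ⊗ d` on `J^σ ⊗_R F = (B →₀ J)`, for every left module `J` turned into a right module
`J^σ` by the involution. -/
def tensorDiff (d : B → B →₀ R) (J : Type u) [AddCommGroup J] [Module R J] :
    (B →₀ J) →+ (B →₀ J) :=
  Finsupp.liftAddHom fun c =>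
    { toFun := fun x => (d c).mapRange (fun r => star r • x) (by simp)
      map_zero' := by ext; simp
      map_add' := fun x y => by ext; simp }

variable (d : B → B →₀ R) {J : Type u} [AddCommGroup J] [Module R J]
  {J' : Type u} [AddCommGroup J'] [Module R J']

@[simp] lemma tensorDiff_single (c : B) (x : J) (a : B) :
    tensorDiff d J (Finsupp.single c x) a = star (d c a) • x := by
  simp [tensorDiff]

lemma tensorDiff_apply (t : B →₀ J) (a : B) :
    tensorDiff d J t a = t.sum fun c x => star (d c a) • x := by
  induction t using Finsupp.induction_linear with
  | zero => simp
  | add t t' h h' =>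
    rw [map_add, Finsupp.add_apply, h, h', Finsupp.sum_add_index'] <;> simp
  | single c x => simp

lemma tensorDiff_apply_of_support_subset {t : B →₀ J} {S : Finset B} (h : t.support ⊆ S) (a : B) :
    tensorDiff d J t a = ∑ c ∈ S, star (d c a) • t c := by
  rw [tensorDiff_apply, Finsupp.sum_of_support_subset _ h _ (by simp)]

lemma tensorDiff_mapRange (f : J →ₗ[R] J') (t : B →₀ J) :
    tensorDiff d J' (t.mapRange f (map_zero f)) = (tensorDiff d J t).mapRange f (map_zero f) := by
  induction t using Finsupp.induction_linear with
  | zero => ext; simp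
  | add t t' h h' =>
    rw [Finsupp.mapRange_add (by simp), map_add, map_add, Finsupp.mapRange_add (by simp), h, h']
  | single c x => ext a; simp

/-- The complex `(B →₀ J, d)` restricts to an acyclic one on the families supported in `V`, for all
injective modules `J`. -/
def AcyclicOn (V : Set B) : Prop :=
  ∀ (J : Type u) [AddCommGroup J] [Module R J], Module.Injective R J → ∀ t : B →₀ J,
    ↑t.support ⊆ V → tensorDiff d J t = 0 → ∃ s : B →₀ J, ↑s.support ⊆ V ∧ tensorDiff d J s = t

variable {d}

/-- Acyclicity for all injective modules is uniform: over a given finite set, the same finite set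
of basis elements suffices to write all cycles as boundaries, for all injective modules. Otherwise
the product of a family of counterexamples would be a counterexample to acyclicity. -/
lemma AcyclicOn.exists_finset {V : Set B} (hV : AcyclicOn d V) (S : Finset B) (hS : ↑S ⊆ V) :
    ∃ T : Finset B, ↑T ⊆ V ∧ ∀ (J : Type u) [AddCommGroup J] [Module R J], Module.Injective R J →
      ∀ t : B →₀ J, t.support ⊆ S → tensorDiff d J t = 0 →
        ∃ s : B →₀ J, s.support ⊆ T ∧ tensorDiff d J s = t := by
  classical
  by_contra! H
  choose J iJ mJ hJ t htS htd hts using fun T : {T : Finset B // ↑T ⊆ V} => H T.1 T.2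
  let t' : B →₀ (∀ T, J T) := Finsupp.onFinset S (fun a T => t T a) (by
    intro a ha
    by_contra haS
    apply ha
    funext T
    by_contra h0
    exact haS (htS T (Finsupp.mem_support_iff.2 h0)))
  have ht' : ∀ T, t'.mapRange (LinearMap.proj (R := R) T) (map_zero _) = t T := fun T => by
    ext a; simp [t']
  have hd : tensorDiff d _ t' = 0 := by
    ext a T
    have := tensorDiff_mapRange d (LinearMap.proj (R := R) (φ := J) T) t'
    rw [ht', htd] at this
    simpa using (DFunLike.congr_fun this a).symm
  have := fun T => hJ T
  obtain ⟨s, hsV, hs⟩ := hV (∀ T, J T) (Module.Injective.pi R J) t' (by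
    refine Set.Subset.trans ?_ hS
    exact_mod_cast Finsupp.support_onFinset_subset) hd
  refine hts ⟨s.support, hsV⟩
    (s.mapRange (LinearMap.proj (R := R) (φ := J) ⟨s.support, hsV⟩) (map_zero _))
    (Finsupp.support_mapRange) ?_
  rw [tensorDiff_mapRange, hs, ht']

variable {Q : Type u} [AddCommGroup Q] [Module R Q]

/-- If `Q^∨` is injective and cycles supported in `S` are boundaries of families supported in `T`,
then a map `F → Q` that vanishes on the boundaries of `T` factors through the differential
on `S`. -/
lemma exists_factor_of_finset (hQ : Module.Injective R (StarDual Q)) {S T : Finset B}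
    (hT : ∀ (J : Type u) [AddCommGroup J] [Module R J], Module.Injective R J →
      ∀ t : B →₀ J, t.support ⊆ S → tensorDiff d J t = 0 →
        ∃ s : B →₀ J, s.support ⊆ T ∧ tensorDiff d J s = t)
    (φ : B → Q) (hφ : ∀ c ∈ T, Finsupp.linearCombination R φ (d c) = 0) :
    ∃ g : B → Q, ∀ a ∈ S, φ a = Finsupp.linearCombination R g (d a) := by
  classical
  let res : (B → Q) →+ (S → Q) := AddMonoidHom.mk'
    (fun g a => Finsupp.linearCombination R g (d a)) fun g g' => by
      funext a
      simp [Finsupp.linearCombination_apply, Finsupp.sum_add]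
  by_cases hm : (fun a : S => φ a) ∈ res.range
  · obtain ⟨g, hg⟩ := hm
    exact ⟨g, fun a ha => (congrFun hg ⟨a, ha⟩).symm⟩
  exfalso
  -- A character of `S → Q` that vanishes on restrictions of boundaries is a cycle over `Q^∨`.
  obtain ⟨χ, hχ, hne⟩ := StarDual.exists_character_of_notMem res.range hm
  let χc : S → StarDual Q := fun a => StarDual.ofHom
    (AddMonoidHom.mk' (fun q => χ (Pi.single a q)) fun q q' => by rw [Pi.single_add, map_add])
  have hχc : ∀ f : S → Q, χ f = ∑ a, χc a (f a) := fun f => by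
    conv_lhs => rw [← Finset.univ_sum_single f, map_sum]
    rfl
  let t : B →₀ StarDual Q := Finsupp.onFinset S
    (fun a => if h : a ∈ S then χc ⟨a, h⟩ else 0) (by intro a ha; by_contra h; simp [h] at ha)
  have htS : t.support ⊆ S := Finsupp.support_onFinset_subset
  have htv : ∀ f : B → Q, ∑ a ∈ S, t a (f a) = χ fun a : S => f a := fun f => by
    rw [hχc, ← Finset.sum_coe_sort S]
    refine Finset.sum_congr rfl fun a _ => ?_
    simp [t]
  have htd : tensorDiff d _ t = 0 := by
    ext c q
    rw [tensorDiff_apply_of_support_subset d htS, StarDual.finset_sum_apply]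
    have h1 := htv (fun a => d a c • q)
    have h2 := hχ (fun a : S => d a c • q) ⟨Pi.single c q, by
      funext a
      simp only [res, AddMonoidHom.mk'_apply, Finsupp.linearCombination_apply]
      rw [Finsupp.sum_eq_single c]
      · simp
      · intro b _ hb; simp [Pi.single_eq_of_ne hb]
      · simp⟩
    rw [h2] at h1
    simpa using h1
  obtain ⟨s, hsT, hs⟩ := hT _ hQ t htS htd
  apply hne
  rw [← htv φ, ← hs]
  have h3 : ∀ a ∈ S, (tensorDiff d _ s) a (φ a) = ∑ c ∈ T, s c (d c a • φ a) := fun a _ => by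
    rw [tensorDiff_apply_of_support_subset d hsT, StarDual.finset_sum_apply]
    simp
  rw [Finset.sum_congr rfl h3, Finset.sum_comm]
  -- Outside `S` the family `t` vanishes, so the sum over `S` is the sum over all of the basis.
  have h4 : ∑ c ∈ T, ∑ a ∈ S, s c (d c a • φ a) =
      ∑ a ∈ S ∪ T.biUnion (fun c => (d c).support), ∑ c ∈ T, s c (d c a • φ a) := by
    rw [Finset.sum_comm]
    refine Finset.sum_subset Finset.subset_union_left fun a _ ha => ?_
    have : tensorDiff d _ s a = 0 := by
      rw [hs]; exact Finsupp.notMem_support_iff.1 fun h => ha (htS h)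
    rw [tensorDiff_apply_of_support_subset d hsT] at this
    have h5 := DFunLike.congr_fun this (φ a)
    rw [StarDual.finset_sum_apply] at h5
    simpa using h5
  rw [h4, Finset.sum_comm]
  refine Finset.sum_eq_zero fun c hc => ?_
  rw [← map_sum]
  have h6 := hφ c hc
  rw [Finsupp.linearCombination_apply, Finsupp.sum_of_support_subset _
    (s := S ∪ T.biUnion (fun c => (d c).support)) _ _ (by simp)] at h6
  · rw [h6, map_zero]
  · exact fun a ha => Finset.mem_union_right _ (Finset.mem_biUnion.2 ⟨c, hc, ha⟩)

end TensorDiff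

/-! ### Extending maps from cycles of acyclic complexes of free modules -/

section Lifting

variable {R : Type u} [Ring R] {B : Type u} {d : B → B →₀ R}
  {Q : Type u} [AddCommGroup Q] [Module R Q]

lemma linearCombination_linearCombination {X : Type u} (h : B → Q) (d : X → B →₀ R) (x : X →₀ R) :
    Finsupp.linearCombination R (fun b => Finsupp.linearCombination R h (d b)) x =
      Finsupp.linearCombination R h (Finsupp.linearCombination R d x) := by
  rw [Finsupp.linearCombination_apply, Finsupp.linearCombination_apply R (v := d),
    Finsupp.sum, Finsupp.sum, map_sum]
  simp

lemma linearCombination_fun_sub {X : Type u} (g h : X → Q) (x : X →₀ R) :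
    Finsupp.linearCombination R (fun b => g b - h b) x =
      Finsupp.linearCombination R g x - Finsupp.linearCombination R h x := by
  simp [Finsupp.linearCombination_apply, smul_sub, Finsupp.sum_sub]

lemma linearCombination_congr_of_support {X : Type u} {g h : X → Q} {x : X →₀ R}
    (H : ∀ a ∈ x.support, g a = h a) :
    Finsupp.linearCombination R g x = Finsupp.linearCombination R h x := by
  rw [Finsupp.linearCombination_apply, Finsupp.linearCombination_apply]
  exact Finset.sum_congr rfl fun a ha => by simp only [H a ha]

lemma linearCombination_subtypeDomain (p : B → Prop) (g : B → Q) (hg : ∀ b, ¬ p b → g b = 0)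
    (x : B →₀ R) :
    Finsupp.linearCombination R (fun b : Subtype p => g b) (x.subtypeDomain p) =
      Finsupp.linearCombination R g x := by
  induction x using Finsupp.induction_linear with
  | zero => simp
  | add x y hx hy => rw [Finsupp.subtypeDomain_add, map_add, map_add, hx, hy]
  | single b r =>
    by_cases hb : p b
    · have : (Finsupp.single b r).subtypeDomain p = Finsupp.single ⟨b, hb⟩ r := by
        ext a
        rw [Finsupp.subtypeDomain_apply]
        by_cases h : a = ⟨b, hb⟩
        · subst h; simp
        · rw [Finsupp.single_eq_of_ne h, Finsupp.single_eq_of_ne fun h' => h (Subtype.ext h')]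
      rw [this]; simp
    · have : (Finsupp.single b r).subtypeDomain p = 0 := by
        ext a
        simp only [Finsupp.subtypeDomain_apply, Finsupp.coe_zero, Pi.zero_apply]
        exact Finsupp.single_eq_of_ne fun h => hb (h ▸ a.2)
      rw [this]; simp [hg b hb]

variable [StarRing R]

lemma tensorDiff_tensorDiff (hd : ∀ b, Finsupp.linearCombination R d (d b) = 0)
    {J : Type u} [AddCommGroup J] [Module R J] (t : B →₀ J) :
    tensorDiff d J (tensorDiff d J t) = 0 := by
  induction t using Finsupp.induction_linear with
  | zero => simp
  | add t t' h h' => simp [h, h']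
  | single c x =>
    ext a
    have hS : (tensorDiff d J (Finsupp.single c x)).support ⊆ (d c).support := fun b hb => by
      rw [Finsupp.mem_support_iff, tensorDiff_single] at hb
      rw [Finsupp.mem_support_iff]
      rintro h0
      simp [h0] at hb
    have h1 := DFunLike.congr_fun (hd c) a
    rw [Finsupp.linearCombination_apply, Finsupp.sum, Finsupp.finsetSum_apply] at h1
    rw [tensorDiff_apply_of_support_subset d hS]
    simp only [tensorDiff_single, smul_smul, ← star_mul, ← Finset.sum_smul, ← star_sum]
    simp only [Finsupp.smul_apply, smul_eq_mul] at h1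
    rw [h1]
    simp

/-- The case of a countable basis. On finite sets of basis elements `φ` factors through the
differential by `exists_factor_of_finset`; the difference of two successive factorizations is again
a cocycle on a finite set, and correcting by a coboundary makes the factorizations converge, as in
the Mittag-Leffler argument. -/
lemma AcyclicOn.exists_factor_of_countable (hd : ∀ b, Finsupp.linearCombination R d (d b) = 0)
    (hQ : Module.Injective R (StarDual Q)) {V : Set B} (hVc : V.Countable) (hV : AcyclicOn d V)
    (hcl : ∀ b ∈ V, ↑(d b).support ⊆ V) (φ : B → Q)
    (hφ : ∀ b ∈ V, Finsupp.linearCombination R φ (d b) = 0) :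
    ∃ ψ : B → Q, ∀ b ∈ V, φ b = Finsupp.linearCombination R ψ (d b) := by
  classical
  rcases V.eq_empty_or_nonempty with rfl | hne
  · exact ⟨0, by simp⟩
  obtain ⟨f, rfl⟩ := hVc.exists_eq_range hne
  choose T hTV hT using fun S : {S : Finset B // ↑S ⊆ Set.range f} => hV.exists_finset S.1 S.2
  let S : ℕ → {S : Finset B // ↑S ⊆ Set.range f} := fun n => Nat.rec ⟨∅, by simp⟩
    (fun k S => ⟨S.1 ∪ T S ∪ {f k}, by
      rw [Finset.coe_union, Finset.coe_union]
      exact Set.union_subset (Set.union_subset S.2 (hTV S)) (by simp)⟩) n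
  have hS : ∀ k, (S (k + 1)).1 = (S k).1 ∪ T (S k) ∪ {f k} := fun k => rfl
  have hmono : Monotone fun k => (S k).1 := monotone_nat_of_le_succ fun k => by
    rw [hS]; exact fun a ha => by simp [ha]
  have hfac : ∀ k, ∀ φ' : B → Q, (∀ c ∈ T (S k), Finsupp.linearCombination R φ' (d c) = 0) →
      ∃ g : B → Q, ∀ a ∈ (S k).1, φ' a = Finsupp.linearCombination R g (d a) :=
    fun k φ' h => exists_factor_of_finset hQ (hT (S k)) φ' h
  have hfac' : ∀ k, ∃ g : B → Q, ∀ a ∈ (S k).1, φ a = Finsupp.linearCombination R g (d a) :=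
    fun k => hfac k φ fun c hc => hφ c (hTV _ hc)
  have step : ∀ k (h : B → Q), (∀ a ∈ (S (k + 1)).1, φ a = Finsupp.linearCombination R h (d a)) →
      ∃ h' : B → Q, (∀ a ∈ (S (k + 2)).1, φ a = Finsupp.linearCombination R h' (d a)) ∧
        ∀ a ∈ (S k).1, h' a = h a := by
    intro k h hh
    obtain ⟨h₁, hh₁⟩ := hfac' (k + 2)
    obtain ⟨g, hg⟩ := hfac k (fun b => h₁ b - h b) fun c hc => by
      have hc' : c ∈ (S (k + 1)).1 := by rw [hS]; simp [hc]
      rw [linearCombination_fun_sub, ← hh c hc', ← hh₁ c (hmono (Nat.le_succ _) hc'), sub_self]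
    refine ⟨fun b => h₁ b - Finsupp.linearCombination R g (d b), fun a ha => ?_, fun a ha => ?_⟩
    · rw [linearCombination_fun_sub, linearCombination_linearCombination, hd, map_zero, sub_zero,
        hh₁ a ha]
    · change h₁ a - Finsupp.linearCombination R g (d a) = h a
      rw [← hg a ha]; abel
  choose! nxt hnxt₁ hnxt₂ using step
  obtain ⟨h₀, hh₀⟩ := hfac' 1
  let h : ℕ → B → Q := fun n => Nat.rec h₀ (fun k h => nxt k h) n
  have hh : ∀ k, ∀ a ∈ (S (k + 1)).1, φ a = Finsupp.linearCombination R (h k) (d a) := by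
    intro k
    induction k with
    | zero => exact hh₀
    | succ k ih => exact hnxt₁ k _ ih
  have hst : ∀ k, ∀ a ∈ (S k).1, ∀ j, k ≤ j → h j a = h k a := by
    intro k a ha j hj
    induction j, hj using Nat.le_induction with
    | base => rfl
    | succ j hj ih => rw [← ih]; exact hnxt₂ j _ (hh j) a (hmono hj ha)
  have hex : ∀ b ∈ Set.range f, ∃ k, b ∈ (S k).1 := by
    rintro _ ⟨k, rfl⟩
    exact ⟨k + 1, by rw [hS]; simp⟩
  have hex' : ∀ F : Finset B, ↑F ⊆ Set.range f → ∃ k, F ⊆ (S k).1 := by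
    intro F
    induction F using Finset.induction_on with
    | empty => exact fun _ => ⟨0, by simp⟩
    | insert a F _ ih =>
      intro hF
      rw [Finset.coe_insert, Set.insert_subset_iff] at hF
      obtain ⟨k, hk⟩ := ih hF.2
      obtain ⟨l, hl⟩ := hex a hF.1
      exact ⟨max k l, Finset.insert_subset (hmono (le_max_right k l) hl)
        (hk.trans (hmono (le_max_left k l)))⟩
  choose! κ hκ using hex
  refine ⟨fun b => h (κ b) b, fun b hb => ?_⟩
  obtain ⟨k, hk⟩ := hex' (insert b (d b).support) (by
    rw [Finset.coe_insert]; exact Set.insert_subset hb (hcl b hb))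
  rw [Finset.insert_subset_iff] at hk
  rw [hh k b (hmono (Nat.le_succ k) hk.1)]
  refine linearCombination_congr_of_support fun a ha => ?_
  have ha' := hκ a (hcl b hb ha)
  rw [← hst k a (hk.2 ha) (max k (κ a)) (le_max_left _ _),
    ← hst (κ a) a ha' (max k (κ a)) (le_max_right _ _)]

section Quotient

lemma subtypeDomain_compl_eq_zero {U : Set B} {J : Type u} [AddCommGroup J] {t : B →₀ J} :
    t.subtypeDomain (· ∈ Uᶜ) = 0 ↔ ↑t.support ⊆ U := by
  rw [DFunLike.ext_iff]
  constructor
  · intro h b hb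
    by_contra hbU
    exact Finsupp.mem_support_iff.1 hb (h ⟨b, hbU⟩)
  · intro h b
    by_contra hb
    exact b.2 (h (Finsupp.mem_support_iff.2 hb))

lemma mem_support_subtypeDomain_compl {U : Set B} {J : Type u} [AddCommGroup J] {t : B →₀ J}
    {c : ↥Uᶜ} : c ∈ (t.subtypeDomain (· ∈ Uᶜ)).support ↔ (c : B) ∈ t.support := by
  rw [Finsupp.mem_support_iff, Finsupp.mem_support_iff, Finsupp.subtypeDomain_apply]

variable (d) (U : Set B)

/-- The differential of the quotient of the free module on `B` by the one on `U`. -/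
def quotDiff : ↥Uᶜ → ↥Uᶜ →₀ R := fun c => (d c).subtypeDomain (· ∈ Uᶜ)

variable {d U} (hcl : ∀ b ∈ U, ↑(d b).support ⊆ U)
include hcl

omit [StarRing R] in
lemma linearCombination_quotDiff (hd : ∀ b, Finsupp.linearCombination R d (d b) = 0) (c : ↥Uᶜ) :
    Finsupp.linearCombination R (quotDiff d U) (quotDiff d U c) = 0 := by
  have h1 := linearCombination_subtypeDomain (R := R) (· ∈ Uᶜ)
    (fun b => (d b).subtypeDomain (· ∈ Uᶜ))
    (fun b hb => subtypeDomain_compl_eq_zero.2 (hcl b (not_not.1 hb))) (d c)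
  refine h1.trans ?_
  have h2 : ∀ x : B →₀ R, Finsupp.linearCombination R
      (fun b => (d b).subtypeDomain (· ∈ Uᶜ)) x =
      (Finsupp.linearCombination R d x).subtypeDomain (· ∈ Uᶜ) := fun x => by
    induction x using Finsupp.induction_linear with
    | zero => simp
    | add x y hx hy => rw [map_add, map_add, hx, hy, Finsupp.subtypeDomain_add]
    | single b r => ext a; simp
  rw [h2, hd, Finsupp.subtypeDomain_zero]

lemma tensorDiff_quotDiff {J : Type u} [AddCommGroup J] [Module R J] (t : B →₀ J) :
    tensorDiff (quotDiff d U) J (t.subtypeDomain (· ∈ Uᶜ)) =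
      (tensorDiff d J t).subtypeDomain (· ∈ Uᶜ) := by
  induction t using Finsupp.induction_linear with
  | zero => simp
  | add t t' h h' =>
    rw [Finsupp.subtypeDomain_add, map_add, map_add, Finsupp.subtypeDomain_add, h, h']
  | single b x =>
    by_cases hb : b ∈ U
    · have h1 : (Finsupp.single b x).subtypeDomain (· ∈ Uᶜ) = 0 :=
        subtypeDomain_compl_eq_zero.2 fun a ha => by
          rw [Finset.mem_singleton.1 (Finsupp.support_single_subset ha)]; exact hb
      rw [h1, map_zero]
      refine (subtypeDomain_compl_eq_zero.2 fun a ha => ?_).symm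
      refine hcl b hb (Finsupp.mem_support_iff.2 fun h0 => ?_)
      refine Finsupp.mem_support_iff.1 ha ?_
      rw [tensorDiff_single, h0, star_zero, zero_smul]
    · have h1 : (Finsupp.single b x).subtypeDomain (· ∈ Uᶜ) =
          Finsupp.single (⟨b, hb⟩ : ↥Uᶜ) x := by
        ext a
        rw [Finsupp.subtypeDomain_apply]
        by_cases h : a = ⟨b, hb⟩
        · subst h; simp
        · rw [Finsupp.single_eq_of_ne h, Finsupp.single_eq_of_ne fun h' => h (Subtype.ext h')]
      rw [h1]
      ext a
      simp [quotDiff]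

omit hcl in
lemma exists_subtypeDomain_eq {J : Type u} [AddCommGroup J] (t : ↥Uᶜ →₀ J) :
    ∃ t' : B →₀ J, t'.subtypeDomain (· ∈ Uᶜ) = t ∧
      ↑t'.support ⊆ Subtype.val '' (t.support : Set ↥Uᶜ) := by
  classical
  refine ⟨t.extendDomain, Finsupp.subtypeDomain_extendDomain t, fun b hb => ?_⟩
  have hb' : b ∈ Uᶜ := Finsupp.support_extendDomain_subset t hb
  refine ⟨⟨b, hb'⟩, ?_, rfl⟩
  rw [← Finsupp.subtypeDomain_extendDomain t]
  exact mem_support_subtypeDomain_compl.2 hb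

/-- Two out of three: the quotient of an acyclic complex by an acyclic subcomplex is acyclic. -/
lemma AcyclicOn.quotient (hd : ∀ b, Finsupp.linearCombination R d (d b) = 0)
    (hB : AcyclicOn d Set.univ) (hU : AcyclicOn d U) :
    AcyclicOn (quotDiff d U) Set.univ := by
  intro J _ _ hJ t _ ht
  obtain ⟨t', rfl, -⟩ := exists_subtypeDomain_eq t
  rw [tensorDiff_quotDiff hcl, subtypeDomain_compl_eq_zero] at ht
  obtain ⟨u, huU, hu⟩ := hU J hJ _ ht (tensorDiff_tensorDiff hd t')
  obtain ⟨s, -, hs⟩ := hB J hJ (t' - u) (Set.subset_univ _) (by rw [map_sub, hu, sub_self])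
  refine ⟨s.subtypeDomain (· ∈ Uᶜ), Set.subset_univ _, ?_⟩
  rw [tensorDiff_quotDiff hcl, hs, Finsupp.subtypeDomain_sub, subtypeDomain_compl_eq_zero.2 huU,
    sub_zero]

/-- Two out of three: an extension of an acyclic complex by an acyclic complex is acyclic. -/
lemma AcyclicOn.union (hd : ∀ b, Finsupp.linearCombination R d (d b) = 0)
    (hU : AcyclicOn d U) {T : Set ↥Uᶜ} (hT : AcyclicOn (quotDiff d U) T) :
    AcyclicOn d (U ∪ Subtype.val '' T) := by
  classical
  intro J _ _ hJ t htU ht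
  obtain ⟨s, hsT, hs⟩ := hT J hJ (t.subtypeDomain (· ∈ Uᶜ)) (fun c hc => by
    rcases htU (mem_support_subtypeDomain_compl.1 hc) with h | ⟨c', hc', h⟩
    · exact absurd h c.2
    · rwa [← Subtype.ext h]) (by rw [tensorDiff_quotDiff hcl, ht, Finsupp.subtypeDomain_zero])
  obtain ⟨s', rfl, hs'⟩ := exists_subtypeDomain_eq s
  rw [tensorDiff_quotDiff hcl] at hs
  obtain ⟨u, huU, hu⟩ := hU J hJ (t - tensorDiff d J s')
    (subtypeDomain_compl_eq_zero.1 (by rw [Finsupp.subtypeDomain_sub, hs, sub_self]))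
    (by rw [map_sub, ht, tensorDiff_tensorDiff hd, sub_self])
  refine ⟨u + s', fun b hb => ?_, by rw [map_add, hu, sub_add_cancel]⟩
  rcases Finset.mem_union.1 (Finsupp.support_add hb) with h | h
  · exact Or.inl (huU h)
  · obtain ⟨c, hc, rfl⟩ := hs' h
    exact Or.inr ⟨c, hsT hc, rfl⟩

end Quotient

/-- Uniform acyclicity makes countable acyclic subcomplexes abundant, although cycles supported in
a finite set need not form a finitely generated module. -/
lemma AcyclicOn.exists_countable (hB : AcyclicOn d Set.univ) (b₀ : B) :
    ∃ T : Set B, b₀ ∈ T ∧ T.Countable ∧ (∀ b ∈ T, ↑(d b).support ⊆ T) ∧ AcyclicOn d T := by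
  classical
  choose τ _ hτ using fun S : Finset B => hB.exists_finset S (Set.subset_univ _)
  let T : ℕ → Set B := fun n => Nat.rec {b₀}
    (fun _ T => T ∪ ⋃ F ∈ {F : Finset B | ↑F ⊆ T}, ↑(τ F ∪ F.biUnion fun b => (d b).support)) n
  have hT : ∀ n, T (n + 1) =
    T n ∪ ⋃ F ∈ {F : Finset B | ↑F ⊆ T n}, ↑(τ F ∪ F.biUnion fun b => (d b).support) := fun _ => rfl
  have hmono : Monotone T := monotone_nat_of_le_succ fun n => by
    rw [hT]; exact Set.subset_union_left
  have hc : ∀ n, (T n).Countable := by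
    intro n
    induction n with
    | zero => exact Set.countable_singleton b₀
    | succ n ih =>
      rw [hT]
      refine ih.union (Set.Countable.biUnion ?_ fun F _ => Finset.countable_toSet _)
      have h := (Set.countable_ofPred_finite_subset ih).preimage
        (Finset.coe_injective (α := B))
      refine h.mono fun F hF => ?_
      exact And.intro F.finite_toSet hF
  have hfin : ∀ F : Finset B, ↑F ⊆ ⋃ n, T n → ∃ n, ↑F ⊆ T n := fun F hF =>
    hmono.directed_le.exists_mem_subset_of_finset_subset_biUnion hF
  have hsub : ∀ F : Finset B, ↑F ⊆ ⋃ n, T n →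
      ↑(τ F ∪ F.biUnion fun b => (d b).support) ⊆ ⋃ n, T n := fun F hF => by
    obtain ⟨n, hn⟩ := hfin F hF
    refine Set.Subset.trans ?_ (Set.subset_iUnion T (n + 1))
    rw [hT]
    exact Set.subset_union_of_subset_right
      (Set.subset_biUnion_of_mem (u := fun F : Finset B =>
        (↑(τ F ∪ F.biUnion fun b => (d b).support) : Set B)) hn) _
  refine ⟨⋃ n, T n, Set.mem_iUnion.2 ⟨0, rfl⟩, Set.countable_iUnion hc, fun b hb => ?_, ?_⟩
  · refine Set.Subset.trans ?_ (hsub {b} (by simpa using hb))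
    simp
  · intro J _ _ hJ t htT ht
    obtain ⟨s, hsT, hs⟩ := hτ t.support J hJ t subset_rfl ht
    refine ⟨s, Set.Subset.trans ?_ (hsub t.support htT), hs⟩
    rw [Finset.coe_union]
    exact Set.Subset.trans (Finset.coe_subset.2 hsT) Set.subset_union_left

/-- If `J^σ ⊗ F` is acyclic for all injective `J`, then `Hom(F, Q)` is acyclic for every `Q` with
injective character module. By Zorn's lemma take a maximal acyclic subcomplex on which the
cocycle is a coboundary; its quotient contains a countable acyclic subcomplex if it is nonzero. -/
theorem AcyclicOn.exists_factor (hd : ∀ b, Finsupp.linearCombination R d (d b) = 0)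
    (hB : AcyclicOn d Set.univ) (hQ : Module.Injective R (StarDual Q)) (φ : B → Q)
    (hφ : ∀ b, Finsupp.linearCombination R φ (d b) = 0) :
    ∃ ψ : B → Q, ∀ b, φ b = Finsupp.linearCombination R ψ (d b) := by
  classical
  let X := {p : Set B × (B → Q) // (∀ b ∈ p.1, ↑(d b).support ⊆ p.1) ∧ AcyclicOn d p.1 ∧
    ∀ b ∈ p.1, φ b = Finsupp.linearCombination R p.2 (d b)}
  let r : X → X → Prop := fun p q => p.1.1 ⊆ q.1.1 ∧ ∀ b ∈ p.1.1, q.1.2 b = p.1.2 b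
  have hbase : AcyclicOn d ∅ := fun J _ _ _ t ht _ => ⟨0, by simp, by
    rw [map_zero, eq_comm, ← Finsupp.support_eq_empty, ← Finset.coe_eq_empty]
    exact Set.subset_empty_iff.1 ht⟩
  obtain ⟨⟨⟨U, ψ⟩, hcl, hU, hψ⟩, hmax⟩ := exists_maximal_of_chains_bounded (r := r) (by
    intro c hc
    rcases c.eq_empty_or_nonempty with rfl | hne
    · exact ⟨⟨⟨∅, 0⟩, by simp, hbase, by simp⟩, by simp⟩
    have hdir : DirectedOn (fun p q : X => p.1.1 ⊆ q.1.1) c := fun p hp q hq => by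
      rcases eq_or_ne p q with rfl | hpq
      · exact ⟨p, hp, subset_rfl, subset_rfl⟩
      · rcases hc hp hq hpq with h | h
        · exact ⟨q, hq, h.1, subset_rfl⟩
        · exact ⟨p, hp, subset_rfl, h.1⟩
    have hfin : ∀ F : Finset B, ↑F ⊆ ⋃ p ∈ c, p.1.1 → ∃ p ∈ c, ↑F ⊆ p.1.1 := fun F hF =>
      DirectedOn.exists_mem_subset_of_finset_subset_biUnion hne hdir hF
    have hag : ∀ p ∈ c, ∀ q ∈ c, ∀ b ∈ p.1.1, b ∈ q.1.1 → p.1.2 b = q.1.2 b := by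
      intro p hp q hq b hbp hbq
      rcases eq_or_ne p q with rfl | hpq
      · rfl
      · rcases hc hp hq hpq with h | h
        · exact (h.2 b hbp).symm
        · exact h.2 b hbq
    let ψ : B → Q := fun b => if h : ∃ p ∈ c, b ∈ p.1.1 then h.choose.1.2 b else 0
    have hψ : ∀ p ∈ c, ∀ b ∈ p.1.1, ψ b = p.1.2 b := fun p hp b hb => by
      have h : ∃ p ∈ c, b ∈ p.1.1 := ⟨p, hp, hb⟩
      simp only [ψ, dif_pos h]
      exact hag _ h.choose_spec.1 _ hp b h.choose_spec.2 hb
    refine ⟨⟨⟨⋃ p ∈ c, p.1.1, ψ⟩, fun b hb => ?_, ?_, fun b hb => ?_⟩,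
      fun p hp => ⟨Set.subset_biUnion_of_mem (u := fun p : X => p.1.1) hp, hψ p hp⟩⟩
    · obtain ⟨p, hp, hbp⟩ := Set.mem_iUnion₂.1 hb
      exact (p.2.1 b hbp).trans (Set.subset_biUnion_of_mem (u := fun p : X => p.1.1) hp)
    · intro J _ _ hJ t ht h0
      obtain ⟨p, hp, htp⟩ := hfin _ ht
      obtain ⟨s, hsp, hs⟩ := p.2.2.1 J hJ t htp h0
      exact ⟨s, hsp.trans (Set.subset_biUnion_of_mem (u := fun p : X => p.1.1) hp), hs⟩
    · obtain ⟨p, hp, hbp⟩ := Set.mem_iUnion₂.1 hb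
      rw [p.2.2.2 b hbp]
      exact linearCombination_congr_of_support fun a ha => (hψ p hp a (p.2.1 b hbp ha)).symm)
    (fun {p q s} h h' => ⟨h.1.trans h'.1, fun b hb => (h'.2 b (h.1 hb)).trans (h.2 b hb)⟩)
  by_cases hall : U = Set.univ
  · subst hall
    exact ⟨ψ, fun b => hψ b trivial⟩
  exfalso
  obtain ⟨b₀, hb₀⟩ := (Set.ne_univ_iff_exists_notMem U).1 hall
  simp only at hcl hU hψ
  obtain ⟨T, hbT, hTc, hTcl, hT⟩ := (hB.quotient hcl hd hU).exists_countable ⟨b₀, hb₀⟩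
  -- The error of the factorization on `U` is a cocycle on the quotient by `U`.
  let φ' : B → Q := fun b => φ b - Finsupp.linearCombination R ψ (d b)
  have hφ'U : ∀ b, b ∉ Uᶜ → φ' b = 0 := fun b hb => sub_eq_zero.2 (hψ b (not_not.1 hb))
  obtain ⟨ψ', hψ'⟩ := hT.exists_factor_of_countable (linearCombination_quotDiff hcl hd) hQ hTc hTcl
    (fun c => φ' c) fun c _ => by
      refine (linearCombination_subtypeDomain (· ∈ Uᶜ) φ' hφ'U (d c)).trans ?_
      rw [linearCombination_fun_sub, hφ, linearCombination_linearCombination, hd, map_zero,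
        sub_zero]
  let ψe : B → Q := fun b => if h : b ∈ Uᶜ then ψ' ⟨b, h⟩ else 0
  have hψe : ∀ x : B →₀ R, Finsupp.linearCombination R ψe x =
      Finsupp.linearCombination R ψ' (x.subtypeDomain (· ∈ Uᶜ)) := fun x => by
    rw [← linearCombination_subtypeDomain (· ∈ Uᶜ) ψe (fun b hb => by simp only [ψe, dif_neg hb])]
    congr 2
    funext c
    simp only [ψe, dif_pos c.2]
  have hadd : ∀ x : B →₀ R, Finsupp.linearCombination R (ψ + ψe) x =
      Finsupp.linearCombination R ψ x + Finsupp.linearCombination R ψe x := fun x => by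
    simp [Finsupp.linearCombination_apply, Finsupp.sum_add]
  have hle := (hmax ⟨⟨U ∪ Subtype.val '' T, ψ + ψe⟩, fun b hb => ?_, hU.union hcl hd hT,
    fun b hb => ?_⟩ ⟨Set.subset_union_left, fun b hb => ?_⟩).1
  · exact hb₀ (hle (Or.inr ⟨_, hbT, rfl⟩))
  · rcases hb with hb | ⟨c, hc, rfl⟩
    · exact (hcl b hb).trans Set.subset_union_left
    · intro a ha
      by_cases haU : a ∈ U
      · exact Or.inl haU
      · exact Or.inr ⟨⟨a, haU⟩, hTcl c hc
          (mem_support_subtypeDomain_compl.2 ha), rfl⟩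
  · simp only
    rw [hadd, hψe]
    rcases hb with hb | ⟨c, hc, rfl⟩
    · rw [subtypeDomain_compl_eq_zero.2 (hcl b hb), map_zero, add_zero, hψ b hb]
    · have := hψ' c hc
      rw [quotDiff] at this
      rw [← this]
      simp [φ']
  · simp only [Pi.add_apply, ψe]
    rw [dif_neg (fun h => h hb), add_zero]

end Lifting

/-! ### Acyclic complexes of projective modules are totally acyclic -/

section

variable {R : Type u} [Ring R] [StarRing R] {B : Type u} {d : B → B →₀ R}

variable (d) in
/-- The complex `(B →₀ J, d)` is acyclic. -/
def TensorExact (J : Type u) [AddCommGroup J] [Module R J] : Prop :=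
  ∀ t : B →₀ J, tensorDiff d J t = 0 → ∃ s, tensorDiff d J s = t

omit [StarRing R] in
lemma exists_mapRange_eq {J J' : Type u} [AddCommGroup J] [AddCommGroup J'] [Module R J]
    [Module R J'] (g : J →ₗ[R] J') (hg : Function.Surjective g) (t : B →₀ J') :
    ∃ t' : B →₀ J, t'.mapRange g (map_zero g) = t :=
  Finsupp.mapRange_surjective g (map_zero g) hg t

lemma TensorExact.of_shortExact {J₁ J₂ J₃ : Type u} [AddCommGroup J₁] [AddCommGroup J₂]
    [AddCommGroup J₃] [Module R J₁] [Module R J₂] [Module R J₃] (f : J₁ →ₗ[R] J₂) (g : J₂ →ₗ[R] J₃)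
    (hf : Function.Injective f) (hfg : Function.Exact f g) (hg : Function.Surjective g)
    (hd : ∀ b, Finsupp.linearCombination R d (d b) = 0)
    (h₁ : TensorExact d J₁) (h₂ : TensorExact d J₂) : TensorExact d J₃ := by
  have lift : ∀ z : B →₀ J₂, z.mapRange g (map_zero g) = 0 →
      ∃ w : B →₀ J₁, w.mapRange f (map_zero f) = z := fun z hz => by
    have : ∀ b, ∃ x, f x = z b := fun b => (hfg _).1 (by simpa using DFunLike.congr_fun hz b)
    choose x hx using this
    refine ⟨Finsupp.onFinset z.support x fun b hb => ?_, by ext b; simp [hx]⟩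
    rw [Finsupp.mem_support_iff, ← hx]
    exact fun h => hb (hf (by rw [h, map_zero]))
  intro t ht
  obtain ⟨t', rfl⟩ := exists_mapRange_eq g hg t
  rw [tensorDiff_mapRange] at ht
  obtain ⟨z, hz⟩ := lift _ ht
  obtain ⟨w, rfl⟩ := h₁ z (by
    refine Finsupp.mapRange_injective f (map_zero f) hf ?_
    rw [← tensorDiff_mapRange, hz, tensorDiff_tensorDiff hd, Finsupp.mapRange_zero])
  rw [← tensorDiff_mapRange] at hz
  obtain ⟨y, hy⟩ := h₂ (t' - w.mapRange f (map_zero f)) (by rw [map_sub, hz, sub_self])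
  refine ⟨y.mapRange g (map_zero g), ?_⟩
  rw [tensorDiff_mapRange, hy]
  ext b
  simp [hfg.apply_apply_eq_zero]

lemma tensorDiff_mapRange_star (x : B →₀ R) :
    tensorDiff d R (x.mapRange star (star_zero R)) =
      (Finsupp.linearCombination R d x).mapRange star (star_zero R) := by
  induction x using Finsupp.induction_linear with
  | zero => simp
  | add x y hx hy =>
    rw [Finsupp.mapRange_add star_add, map_add, map_add, Finsupp.mapRange_add star_add, hx, hy]
  | single b r => ext a; simp

/-- The complex `R^σ ⊗ F` is `F` itself. -/
lemma tensorExact_self (hex : ∀ x, Finsupp.linearCombination R d x = 0 →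
    ∃ y, Finsupp.linearCombination R d y = x) : TensorExact d R := by
  have key : ∀ t : B →₀ R, (t.mapRange star (star_zero R)).mapRange star (star_zero R) = t :=
    fun t => by ext; simp
  intro t ht
  have h1 := tensorDiff_mapRange_star (d := d) (t.mapRange star (star_zero R))
  rw [key, ht] at h1
  obtain ⟨y, hy⟩ := hex (t.mapRange star (star_zero R)) (by
    refine Finsupp.mapRange_injective star (star_zero R) star_injective ?_
    rw [← h1, Finsupp.mapRange_zero])
  exact ⟨y.mapRange star (star_zero R), by rw [tensorDiff_mapRange_star, hy, key]⟩

lemma TensorExact.finsupp (h : TensorExact d R) (S : Type u) : TensorExact d (S →₀ R) := by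
  classical
  intro t ht
  have h1 : ∀ s : S, ∃ y, tensorDiff d R y =
      t.mapRange (Finsupp.lapply (R := R) s) (map_zero _) := fun s =>
    h _ (by rw [tensorDiff_mapRange, ht, Finsupp.mapRange_zero])
  choose y hy using h1
  let F : Finset S := t.support.biUnion fun b => (t b).support
  refine ⟨∑ s ∈ F, (y s).mapRange (Finsupp.lsingle (R := R) s) (map_zero _), ?_⟩
  rw [map_sum]
  simp only [tensorDiff_mapRange, hy]
  ext b s
  rw [Finsupp.finsetSum_apply, Finsupp.finsetSum_apply]
  simp only [Finsupp.mapRange_apply, Finsupp.lsingle_apply, Finsupp.lapply_apply]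
  rw [Finset.sum_eq_single s]
  · simp
  · intro s' _ hs'; exact Finsupp.single_eq_of_ne hs'.symm
  · intro hs
    rw [Finsupp.single_eq_same]
    by_contra h0
    refine hs (Finset.mem_biUnion.2 ⟨b, Finsupp.mem_support_iff.2 fun hb => h0 (by rw [hb]; rfl),
      Finsupp.mem_support_iff.2 h0⟩)

lemma TensorExact.of_projective (h : TensorExact d R) (J : Type u) [AddCommGroup J] [Module R J]
    [Module.Projective R J] : TensorExact d J := by
  obtain ⟨s, hs⟩ := Module.Projective.out (R := R) (P := J)
  intro t ht
  obtain ⟨y, hy⟩ := h.finsupp J (t.mapRange s (map_zero s)) (by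
    rw [tensorDiff_mapRange, ht, Finsupp.mapRange_zero])
  refine ⟨y.mapRange (Finsupp.linearCombination R id) (map_zero _), ?_⟩
  rw [tensorDiff_mapRange, hy]
  ext b
  simpa using hs (t b)

omit [StarRing R] in
lemma shortExact_ker {M P : Type u} [AddCommGroup M] [Module R M] [AddCommGroup P] [Module R P]
    (p : P →ₗ[R] M) (hp : Function.Surjective p) :
    (ShortComplex.mk (ModuleCat.ofHom p.ker.subtype) (ModuleCat.ofHom p)
      (by ext x; exact x.2)).ShortExact where
  exact := by
    rw [ShortComplex.ShortExact.moduleCat_exact_iff_function_exact]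
    exact LinearMap.exact_subtype_ker_map p
  mono_f := (ModuleCat.mono_iff_injective _).2 (Submodule.subtype_injective _)
  epi_g := (ModuleCat.epi_iff_surjective _).2 hp

lemma TensorExact.of_hasProjectiveDimensionLT (hd : ∀ b, Finsupp.linearCombination R d (d b) = 0)
    (h : TensorExact d R) (n : ℕ) (J : Type u) [AddCommGroup J] [Module R J]
    (hJ : HasProjectiveDimensionLT (ModuleCat.of R J) n) : TensorExact d J := by
  induction n generalizing J with
  | zero =>
    have := ModuleCat.subsingleton_of_isZero (isZero_of_hasProjectiveDimensionLT_zero (ModuleCat.of R J))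
    exact fun t _ => ⟨0, by ext b; exact Subsingleton.elim (α := J) _ _⟩
  | succ n ih =>
    rcases n with - | n
    · have : Module.Projective R J := (IsProjective.iff_projective J).2 inferInstance
      exact h.of_projective J
    · have hs := Finsupp.linearCombination_id_surjective R J
      have hS := shortExact_ker _ hs
      refine TensorExact.of_shortExact _ _ (Submodule.subtype_injective _)
        (LinearMap.exact_subtype_ker_map _) hs hd (ih _ ?_) (h.finsupp J)
      have hP : Projective (ModuleCat.of R (J →₀ R)) :=
        (IsProjective.iff_projective _).1 inferInstance
      exact (hS.hasProjectiveDimensionLT_X₃_iff n hP).1 hJ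

end

section

variable {R : Type u} [Ring R]

/-- The Eilenberg swindle: `T ⊕ M^{(ℕ)} ≅ M^{(ℕ)}` if `T` is a direct summand of `M`. -/
def swindle {T M : Type u} [AddCommGroup T] [Module R T] [AddCommGroup M] [Module R M]
    (i : T →ₗ[R] M) (s : M →ₗ[R] T) (h : ∀ t, s (i t) = t) : (T × (ℕ →₀ M)) ≃ₗ[R] (ℕ →₀ M) :=
  let e : M →ₗ[R] M := i ∘ₗ s
  let e' : M →ₗ[R] M := LinearMap.id - e
  LinearEquiv.ofLinearMap
    ((Finsupp.lsingle 0 ∘ₗ i).coprod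
      (Finsupp.mapRange.linearMap e' + Finsupp.lmapDomain M R Nat.succ ∘ₗ
        Finsupp.mapRange.linearMap e))
    ((s ∘ₗ Finsupp.lapply 0).prod (Finsupp.mapRange.linearMap e' +
      Finsupp.mapRange.linearMap e ∘ₗ Finsupp.lcomapDomain Nat.succ Nat.succ_injective))
    (by
      refine LinearMap.ext fun y => Finsupp.ext fun n => ?_
      rcases n with - | n
      · simp [e, e', h, Finsupp.mapDomain_of_notMem_range]
      · simp [e, e', h, Finsupp.mapDomain_apply Nat.succ_injective])
    (by
      refine LinearMap.ext fun y => Prod.ext ?_ (Finsupp.ext fun n => ?_)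
      · simp [e, e', h, Finsupp.mapDomain_of_notMem_range]
      · rcases n with - | n <;>
        simp [e, e', h, Finsupp.mapDomain_apply Nat.succ_injective, Finsupp.mapDomain_of_notMem_range])

variable [StarRing R]

/-- An exact differential projective module `(T, d)` stays exact under `Hom(-, Q)`, if injective
modules have finite projective dimension and `Q^∨` is injective. After adding a contractible
summand `X ⊕ X` the module is free, so that `AcyclicOn.exists_factor` applies. -/
theorem exists_factor_of_exact
    (hR : ∀ (J : Type u) [AddCommGroup J] [Module R J], Module.Injective R J →
      ∃ n, HasProjectiveDimensionLT (ModuleCat.of R J) n)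
    {T : Type u} [AddCommGroup T] [Module R T] [Module.Projective R T] (dT : T →ₗ[R] T)
    (hT : Function.Exact dT dT) {Q : Type u} [AddCommGroup Q] [Module R Q]
    (hQ : Module.Injective R (StarDual Q)) (φ : T →ₗ[R] Q) (hφ : ∀ t, φ (dT t) = 0) :
    ∃ ψ : T →ₗ[R] Q, ∀ t, ψ (dT t) = φ t := by
  obtain ⟨i, hi⟩ := Module.Projective.out (R := R) (P := T)
  let X := ℕ →₀ (T →₀ R)
  let W := T × (X × X)
  have hW : Module.Free R W := Module.Free.of_equiv
    ((LinearEquiv.prodAssoc R T X X).symm ≪≫ₗ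
      LinearEquiv.prodCongr (swindle i (Finsupp.linearCombination R id) hi)
        (LinearEquiv.refl R X)).symm
  let dW : W →ₗ[R] W := dT.prodMap (LinearMap.inl R X X ∘ₗ LinearMap.snd R X X)
  have hdW : ∀ w, dW (dW w) = 0 := fun w => Prod.ext (hT.apply_apply_eq_zero w.1)
    (Prod.ext rfl rfl)
  have hexW : ∀ w, dW w = 0 → ∃ w', dW w' = w := fun w hw => by
    obtain ⟨t, ht⟩ := (hT w.1).1 (congrArg Prod.fst hw)
    have h2 : w.2.2 = 0 := congrArg (fun z : W => z.2.1) hw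
    exact ⟨(t, (0, w.2.1)), Prod.ext ht (Prod.ext rfl h2.symm)⟩
  let b := Module.Free.chooseBasis R W
  let d : Module.Free.ChooseBasisIndex R W → Module.Free.ChooseBasisIndex R W →₀ R :=
    fun c => b.repr (dW (b c))
  have hlin : ∀ {Y : Type u} [AddCommGroup Y] [Module R Y] (g : W →ₗ[R] Y)
      (x : Module.Free.ChooseBasisIndex R W →₀ R),
      Finsupp.linearCombination R (fun c => g (b c)) x = g (b.repr.symm x) := fun g x => by
    rw [Module.Basis.repr_symm_apply, Finsupp.apply_linearCombination]
    rfl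
  have hd : ∀ x, Finsupp.linearCombination R d x = b.repr (dW (b.repr.symm x)) := fun x =>
    hlin (b.repr.toLinearMap ∘ₗ dW) x
  have hdd : ∀ c, Finsupp.linearCombination R d (d c) = 0 := fun c => by
    rw [hd, LinearEquiv.symm_apply_apply, hdW, map_zero]
  have hself : TensorExact d R := tensorExact_self fun x hx => by
    rw [hd, LinearEquiv.map_eq_zero_iff] at hx
    obtain ⟨w, hw⟩ := hexW _ hx
    exact ⟨b.repr w, by rw [hd, LinearEquiv.symm_apply_apply, hw, LinearEquiv.apply_symm_apply]⟩
  have hac : AcyclicOn d Set.univ := fun J _ _ hJ t _ ht => by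
    obtain ⟨n, hn⟩ := hR J hJ
    obtain ⟨s, hs⟩ := hself.of_hasProjectiveDimensionLT hdd n J hn t ht
    exact ⟨s, Set.subset_univ _, hs⟩
  let φW : W →ₗ[R] Q := φ ∘ₗ LinearMap.fst R T (X × X)
  obtain ⟨ψ, hψ⟩ := hac.exists_factor hdd hQ (fun c => φW (b c)) fun c => by
    rw [hlin, LinearEquiv.symm_apply_apply]
    exact hφ _
  have hψ' : b.constr ℕ ψ ∘ₗ dW = φW := b.ext fun c => by
    rw [hψ c, LinearMap.comp_apply, ← (b.repr.symm_apply_apply (dW (b c))),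
      ← hlin (b.constr ℕ ψ)]
    simp [d]
  exact ⟨b.constr ℕ ψ ∘ₗ LinearMap.inl R T (X × X), fun t =>
    LinearMap.congr_fun hψ' (t, 0)⟩

end

/-! ### Syzygies and doubly infinite exact sequences in abelian categories -/

section Abelian

open Limits

universe v w

variable {C : Type w} [Category.{v} C] [Abelian C]

/-- There is a short exact sequence `0 → X → Y → Z → 0`. -/
def IsSES (X Y Z : C) : Prop :=
  ∃ (i : X ⟶ Y) (p : Y ⟶ Z) (w : i ≫ p = 0), (ShortComplex.mk i p w).ShortExact

/-- There is a short exact sequence `0 → X → P → Z → 0` with `P` in the class `𝓟`. -/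
def Link (𝓟 : C → Prop) (X Z : C) : Prop := ∃ P, 𝓟 P ∧ IsSES X P Z

/-- `K` is an `m`-th syzygy of `M`: there is an exact sequence
`0 → K → P_{m-1} → ⋯ → P_0 → M → 0` with projective `P_i`. -/
def Syz : ℕ → C → C → Prop
  | 0, M, K => Nonempty (K ≅ M)
  | m + 1, M, K => ∃ K₁, Link Projective K₁ M ∧ Syz m K₁ K

lemma _root_.CategoryTheory.ShortComplex.ShortExact.isSES {S : ShortComplex C}
    (hS : S.ShortExact) : IsSES S.X₁ S.X₂ S.X₃ := ⟨S.f, S.g, S.zero, hS⟩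

lemma IsSES.of_iso {X Y Z X' Y' Z' : C} (h : IsSES X Y Z) (e₁ : X' ≅ X) (e₂ : Y ≅ Y')
    (e₃ : Z ≅ Z') : IsSES X' Y' Z' := by
  obtain ⟨i, p, w, h⟩ := h
  refine ⟨e₁.hom ≫ i ≫ e₂.hom, e₂.inv ≫ p ≫ e₃.hom, by simp [reassoc_of% w], ?_⟩
  exact ShortComplex.shortExact_of_iso
    (ShortComplex.isoMk e₁.symm e₂ e₃ (by simp) (by simp)) h

lemma IsSES.mk' {X Y Z : C} (i : X ⟶ Y) (p : Y ⟶ Z) (w : i ≫ p = 0) [Mono i] [Epi p]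
    (h : ∀ {A : C} (a : A ⟶ Y), a ≫ p = 0 → ∃ b : A ⟶ X, b ≫ i = a) : IsSES X Y Z :=
  ⟨i, p, w, { exact := ShortComplex.exact_of_f_is_kernel _
                (KernelFork.IsLimit.ofι' _ _ fun a ha => ⟨(h a ha).choose, (h a ha).choose_spec⟩) }⟩

lemma IsSES.of_epi {Y Z : C} (p : Y ⟶ Z) [Epi p] : IsSES (kernel p) Y Z :=
  IsSES.mk' (kernel.ι p) p (kernel.condition p) fun a ha => ⟨kernel.lift p a ha, by simp⟩

lemma IsSES.of_mono {X Y : C} (i : X ⟶ Y) [Mono i] : IsSES X Y (cokernel i) :=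
  ⟨i, cokernel.π i, cokernel.condition i, { exact := ShortComplex.exact_cokernel i }⟩

lemma IsSES.unop {X Y Z : Cᵒᵖ} (h : IsSES X Y Z) : IsSES Z.unop Y.unop X.unop := by
  obtain ⟨i, p, w, h⟩ := h
  exact h.unop.isSES

/-- One step of the horseshoe lemma: only the existence of the lift `l` is needed. -/
lemma IsSES.horseshoe_of_lift {M I M' K P K' P' : C} {f : M ⟶ I} {g : I ⟶ M'} {w : f ≫ g = 0}
    (h : (ShortComplex.mk f g w).ShortExact) {k : K ⟶ P} {π : P ⟶ M} {wk : k ≫ π = 0}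
    (hk : (ShortComplex.mk k π wk).ShortExact) {k' : K' ⟶ P'} {π' : P' ⟶ M'} {wk' : k' ≫ π' = 0}
    (hk' : (ShortComplex.mk k' π' wk').ShortExact) (l : P' ⟶ I) (hl : l ≫ g = π') :
    ∃ L, IsSES L (P ⊞ P') I ∧ IsSES K L K' := by
  have := h.mono_f; have := h.epi_g; have := hk.mono_f; have := hk.epi_g
  have := hk'.mono_f; have := hk'.epi_g
  dsimp at *
  let π₂ : P ⊞ P' ⟶ I := biprod.desc (π ≫ f) l
  have hπ₂ : π₂ ≫ g = biprod.snd ≫ π' := by ext <;> simp [π₂, w, hl]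
  have : Epi π₂ := Preadditive.epi_of_cancel_zero _ fun {Y} a ha => by
    have h1 : f ≫ a = 0 := by
      rw [← cancel_epi π, ← Category.assoc, comp_zero]
      simpa [π₂] using biprod.inl ≫= ha
    have h2 : g ≫ h.exact.desc a h1 = a := h.exact.g_desc a h1
    have h3 : h.exact.desc a h1 = 0 := by
      rw [← cancel_epi π', ← hl, Category.assoc, h2, comp_zero]
      simpa [π₂] using biprod.inr ≫= ha
    rw [← h2, h3, comp_zero]
  refine ⟨kernel π₂, IsSES.of_epi π₂, ?_⟩
  let u : K ⟶ kernel π₂ := kernel.lift π₂ (k ≫ biprod.inl) (by simp [π₂, reassoc_of% wk])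
  have hu : u ≫ kernel.ι π₂ = k ≫ biprod.inl := kernel.lift_ι _ _ _
  have hv0 : (kernel.ι π₂ ≫ biprod.snd) ≫ π' = 0 := by
    rw [Category.assoc, ← hπ₂, kernel.condition_assoc, zero_comp]
  let v : kernel π₂ ⟶ K' := hk'.exact.lift (kernel.ι π₂ ≫ biprod.snd) hv0
  have hv : v ≫ k' = kernel.ι π₂ ≫ biprod.snd := hk'.exact.lift_f _ hv0
  have : Mono u := mono_of_mono_fac hu
  have : Epi v := by
    rw [epi_iff_surjective_up_to_refinements]
    intro A y
    obtain ⟨m, hm⟩ : ∃ m : A ⟶ M, m ≫ f = y ≫ k' ≫ l :=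
      ⟨h.exact.lift (y ≫ k' ≫ l) (by simp [hl, wk']), h.exact.lift_f _ _⟩
    obtain ⟨A', q, hq, x, hx⟩ := surjective_up_to_refinements_of_epi π m
    refine ⟨A', q, hq, kernel.lift π₂ (biprod.lift (-x) (q ≫ y ≫ k')) ?_, ?_⟩
    · have hx' : x ≫ π ≫ f = q ≫ y ≫ k' ≫ l := by
        rw [← hm, ← Category.assoc, ← hx, Category.assoc]
      simp [π₂, hx']
    · rw [← cancel_mono k', Category.assoc, Category.assoc, hv, kernel.lift_ι_assoc,
        biprod.lift_snd]
  refine IsSES.mk' u v ?_ fun {A} a ha => ?_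
  · rw [← cancel_mono k', Category.assoc, hv, ← Category.assoc, hu]; simp
  · have h1 : a ≫ kernel.ι π₂ ≫ biprod.snd = 0 := by
      rw [← hv, ← Category.assoc, ha, zero_comp]
    have h2 : a ≫ kernel.ι π₂ = (a ≫ kernel.ι π₂ ≫ biprod.fst) ≫ biprod.inl := by
      ext
      · simp
      · simpa using h1
    have h3 : (a ≫ kernel.ι π₂ ≫ biprod.fst) ≫ π = 0 := by
      rw [← cancel_mono f, zero_comp]
      have h4 := (a ≫ kernel.ι π₂) ≫= (rfl : π₂ = π₂)
      conv_rhs at h4 => rw [h2]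
      rw [Category.assoc, kernel.condition, comp_zero] at h4
      simpa [π₂] using h4.symm
    refine ⟨hk.exact.lift _ h3, ?_⟩
    rw [← cancel_mono (kernel.ι π₂), Category.assoc, hu, ← Category.assoc]
    erw [hk.exact.lift_f _ h3]
    rw [h2]

/-- The horseshoe lemma, for one step of a projective resolution. -/
lemma IsSES.horseshoe {M I M' K K' : C} (h : IsSES M I M') (hK : Link Projective K M)
    (hK' : Link Projective K' M') : ∃ L, Link Projective L I ∧ IsSES K L K' := by
  obtain ⟨f, g, w, h⟩ := h
  obtain ⟨P, hP, k, π, wk, hk⟩ := hK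
  obtain ⟨P', hP', k', π', wk', hk'⟩ := hK'
  have := h.epi_g
  obtain ⟨L, hL, hKL⟩ := IsSES.horseshoe_of_lift h hk hk' (Projective.factorThru π' g)
    (Projective.factorThru_comp _ _)
  exact ⟨L, ⟨P ⊞ P', inferInstance, hL⟩, hKL⟩

lemma IsSES.of_isZero_right {X Z : C} (hZ : IsZero Z) : IsSES X X Z :=
  have : Epi (0 : X ⟶ Z) := ⟨fun _ _ _ => hZ.eq_of_src _ _⟩
  IsSES.mk' (𝟙 X) 0 comp_zero fun a _ => ⟨a, by simp⟩

lemma Link.of_iso {𝓟 : C → Prop} {X Z X' Z' : C} (h : Link 𝓟 X Z) (e₁ : X' ≅ X) (e₃ : Z ≅ Z') :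
    Link 𝓟 X' Z' := by
  obtain ⟨P, hP, h⟩ := h
  exact ⟨P, hP, h.of_iso e₁ (Iso.refl _) e₃⟩

lemma Link.mono {𝓟 𝓠 : C → Prop} (h𝓟 : ∀ X, 𝓟 X → 𝓠 X) {X Z : C} (h : Link 𝓟 X Z) :
    Link 𝓠 X Z := by
  obtain ⟨P, hP, h⟩ := h
  exact ⟨P, h𝓟 P hP, h⟩

lemma exists_link_projective [EnoughProjectives C] (M : C) : ∃ K, Link Projective K M :=
  ⟨_, Projective.over M, inferInstance, IsSES.of_epi (Projective.π M)⟩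

lemma exists_link_injective [EnoughInjectives C] (M : C) : ∃ K, Link Injective M K :=
  ⟨_, Injective.under M, inferInstance, IsSES.of_mono (Injective.ι M)⟩

namespace Syz

lemma exists_right [EnoughProjectives C] (m : ℕ) (M : C) : ∃ K, Syz m M K := by
  induction m generalizing M with
  | zero => exact ⟨M, ⟨Iso.refl M⟩⟩
  | succ m ih =>
    obtain ⟨K₁, h₁⟩ := exists_link_projective M
    obtain ⟨K, h⟩ := ih K₁
    exact ⟨K, K₁, h₁, h⟩

lemma append {m : ℕ} {M K K' : C} (h : Syz m M K) (h' : Link Projective K' K) :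
    Syz (m + 1) M K' := by
  induction m generalizing M with
  | zero =>
    obtain ⟨e⟩ := h
    exact ⟨K', h'.of_iso (Iso.refl _) e, ⟨Iso.refl _⟩⟩
  | succ m ih =>
    obtain ⟨K₁, h₁, h⟩ := h
    exact ⟨K₁, h₁, ih h⟩

/-- A projective object is an `m`-th syzygy, for every `m`. -/
lemma exists_of_projective (m : ℕ) (P : C) (hP : Projective P) : ∃ M, Syz m M P := by
  have h0 : ∀ m : ℕ, ∃ Z : C, IsZero Z ∧ Syz m Z Z := fun m => by
    obtain ⟨Z, hZ⟩ := HasZeroObject.zero (C := C)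
    refine ⟨Z, hZ, ?_⟩
    have hZP : Projective Z := ⟨fun f _ _ => ⟨0, hZ.eq_of_src _ _⟩⟩
    induction m with
    | zero => exact ⟨Iso.refl Z⟩
    | succ m ih => exact ⟨Z, ⟨Z, hZP, IsSES.of_isZero_right hZ⟩, ih⟩
  rcases m with - | m
  · exact ⟨P, ⟨Iso.refl P⟩⟩
  · obtain ⟨Z, hZ, h⟩ := h0 m
    exact ⟨Z, h.append ⟨P, hP, IsSES.of_isZero_right hZ⟩⟩

lemma horseshoe {m : ℕ} {M I M' K K' : C} (h : IsSES M I M') (hK : Syz m M K)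
    (hK' : Syz m M' K') : ∃ L, Syz m I L ∧ IsSES K L K' := by
  induction m generalizing M I M' with
  | zero =>
    obtain ⟨e⟩ := hK
    obtain ⟨e'⟩ := hK'
    exact ⟨I, ⟨Iso.refl I⟩, h.of_iso e (Iso.refl I) e'.symm⟩
  | succ m ih =>
    obtain ⟨K₁, h₁, hK⟩ := hK
    obtain ⟨K₁', h₁', hK'⟩ := hK'
    obtain ⟨L₁, hL₁, h⟩ := h.horseshoe h₁ h₁'
    obtain ⟨L, hL, hKL⟩ := ih h hK hK'
    exact ⟨L, ⟨L₁, hL₁, hL⟩, hKL⟩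

end Syz

/-- If every object of the class `𝓠` is both a left and a right end of a link inside `𝓠`, then
links can be spliced to an exact sequence that is infinite in both directions. -/
lemma exists_splice {𝓟 𝓠 : C → Prop} (hr : ∀ X, 𝓠 X → ∃ Y, 𝓠 Y ∧ Link 𝓟 X Y)
    (hl : ∀ X, 𝓠 X → ∃ Y, 𝓠 Y ∧ Link 𝓟 Y X) (X : C) (hX : 𝓠 X) :
    ∃ Z : ℤ → C, Z 0 = X ∧ (∀ n, 𝓠 (Z n)) ∧ ∀ n, Link 𝓟 (Z n) (Z (n + 1)) := by
  choose! r hr₁ hr₂ using hr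
  choose! l hl₁ hl₂ using hl
  let f : ℕ → C := fun n => Nat.rec X (fun _ Y => r Y) n
  let g : ℕ → C := fun n => Nat.rec (l X) (fun _ Y => l Y) n
  have hf : ∀ n, 𝓠 (f n) := fun n => by
    induction n with
    | zero => exact hX
    | succ n ih => exact hr₁ _ ih
  have hg : ∀ n, 𝓠 (g n) := fun n => by
    induction n with
    | zero => exact hl₁ _ hX
    | succ n ih => exact hl₁ _ ih
  refine ⟨fun n => match n with
    | Int.ofNat n => f n
    | Int.negSucc n => g n, rfl, fun n => ?_, fun n => ?_⟩
  · rcases n with n | n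
    · exact hf n
    · exact hg n
  · rcases n with n | n
    · exact hr₂ _ (hf n)
    · rcases n with - | n
      · exact hl₂ _ hX
      · exact hl₂ _ (hg n)

/-- If the `m`-th syzygies of injective objects lie in the class `𝓟`, then every `m`-th syzygy is a
cycle object of an acyclic complex of objects of `𝓟`: to continue a projective resolution of `M` to
the right, embed `M` into an injective object and use the horseshoe lemma. -/
theorem exists_splice_of_syz [EnoughProjectives C] [EnoughInjectives C] {𝓟 : C → Prop} (m : ℕ)
    (hproj : ∀ P, Projective P → 𝓟 P) (hinj : ∀ I L, Injective I → Syz m I L → 𝓟 L)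
    {M K : C} (h : Syz m M K) :
    ∃ Z : ℤ → C, Z 0 = K ∧ (∀ n, ∃ N, Syz m N (Z n)) ∧ ∀ n, Link 𝓟 (Z n) (Z (n + 1)) := by
  refine exists_splice (𝓠 := fun K => ∃ M, Syz m M K) ?_ ?_ K ⟨M, h⟩
  · rintro K ⟨M, hK⟩
    obtain ⟨M', I, hI, hMI⟩ := exists_link_injective M
    obtain ⟨K', hK'⟩ := Syz.exists_right m M'
    obtain ⟨L, hL, hKL⟩ := Syz.horseshoe hMI hK hK'
    exact ⟨K', ⟨M', hK'⟩, L, hinj I L hI hL, hKL⟩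
  · rintro K ⟨M, hK⟩
    obtain ⟨K', hK'⟩ := exists_link_projective K
    obtain ⟨M₁, -, hM₁⟩ := hK.append hK'
    exact ⟨K', ⟨M₁, hM₁⟩, hK'.mono hproj⟩

end Abelian

/-! ### Dimension shifting -/

section DimensionShifting

open Abelian

universe v w w'

variable {C : Type w} [Category.{v} C] [Abelian C] [HasExt.{w'} C]

lemma ext_subsingleton_of_forall {X Y : C} {n : ℕ} (h : ∀ e : Ext X Y n, e = 0) :
    Subsingleton (Ext X Y n) := ⟨fun a b => (h a).trans (h b).symm⟩

lemma _root_.CategoryTheory.Retract.ext_subsingleton_left {X Y : C} (r : Retract X Y) {Q : C}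
    {n : ℕ} (h : Subsingleton (Ext Y Q n)) : Subsingleton (Ext X Q n) :=
  ext_subsingleton_of_forall fun e => by
    rw [← e.mk₀_id_comp, ← r.retract, ← Ext.mk₀_comp_mk₀, Ext.comp_assoc_of_second_deg_zero,
      Subsingleton.elim ((Ext.mk₀ r.r).comp e (zero_add n)) 0, Ext.comp_zero]

lemma _root_.CategoryTheory.Retract.ext_subsingleton_right {X Y : C} (r : Retract X Y) {I : C}
    {n : ℕ} (h : Subsingleton (Ext I Y n)) : Subsingleton (Ext I X n) :=
  ext_subsingleton_of_forall fun e => by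
    rw [← e.comp_mk₀_id, ← r.retract, ← Ext.mk₀_comp_mk₀, ← Ext.comp_assoc_of_third_deg_zero,
      Subsingleton.elim (e.comp (Ext.mk₀ r.i) (add_zero n)) 0, Ext.zero_comp]

namespace IsSES

variable {X P Y : C} (h : IsSES X P Y) {Q : C} {n : ℕ}
include h

lemma ext_right (h₁ : Subsingleton (Ext X Q n)) (h₂ : Subsingleton (Ext P Q (n + 1))) :
    Subsingleton (Ext Y Q (n + 1)) := by
  obtain ⟨i, p, w, h⟩ := h
  refine ext_subsingleton_of_forall fun e => ?_
  obtain ⟨x, rfl⟩ := Ext.contravariant_sequence_exact₃ h Q e (Subsingleton.elim _ _)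
    (add_comm 1 n)
  rw [Subsingleton.elim x 0, Ext.comp_zero]

lemma ext_left (h₂ : Subsingleton (Ext P Q n)) (h₃ : Subsingleton (Ext Y Q (n + 1))) :
    Subsingleton (Ext X Q n) := by
  obtain ⟨i, p, w, h⟩ := h
  refine ext_subsingleton_of_forall fun e => ?_
  obtain ⟨x, rfl⟩ := Ext.contravariant_sequence_exact₁ h Q e (add_comm 1 n)
    (Subsingleton.elim _ _)
  rw [Subsingleton.elim x 0, Ext.comp_zero]

lemma ext_mid (h₁ : Subsingleton (Ext X Q n)) (h₃ : Subsingleton (Ext Y Q n)) :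
    Subsingleton (Ext P Q n) := by
  obtain ⟨i, p, w, h⟩ := h
  refine ext_subsingleton_of_forall fun e => ?_
  obtain ⟨x, rfl⟩ := Ext.contravariant_sequence_exact₂ h Q e (Subsingleton.elim _ _)
  rw [Subsingleton.elim x 0, Ext.comp_zero]

lemma ext_left' (h₃ : Subsingleton (Ext Q Y n)) (h₂ : Subsingleton (Ext Q P (n + 1))) :
    Subsingleton (Ext Q X (n + 1)) := by
  obtain ⟨i, p, w, h⟩ := h
  refine ext_subsingleton_of_forall fun e => ?_
  obtain ⟨x, rfl⟩ := Ext.covariant_sequence_exact₁ Q h e (Subsingleton.elim _ _) rfl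
  rw [Subsingleton.elim x 0, Ext.zero_comp]

lemma ext_right' (h₂ : Subsingleton (Ext Q P n)) (h₁ : Subsingleton (Ext Q X (n + 1))) :
    Subsingleton (Ext Q Y n) := by
  obtain ⟨i, p, w, h⟩ := h
  refine ext_subsingleton_of_forall fun e => ?_
  obtain ⟨x, rfl⟩ := Ext.covariant_sequence_exact₃ Q h e rfl (Subsingleton.elim _ _)
  rw [Subsingleton.elim x 0, Ext.zero_comp]

end IsSES

section

variable {S : ShortComplex C} (hS : S.ShortExact) {Q : C}
include hS

lemma exists_extension_of_ext (h : Subsingleton (Ext S.X₃ Q 1)) (f : S.X₁ ⟶ Q) :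
    ∃ g : S.X₂ ⟶ Q, S.f ≫ g = f := by
  obtain ⟨x, hx⟩ := Ext.contravariant_sequence_exact₁ hS Q (Ext.mk₀ f) (add_zero 1)
    (Subsingleton.elim _ _)
  obtain ⟨g, rfl⟩ := Ext.homEquiv₀.symm.surjective x
  exact ⟨g, Ext.homEquiv₀.symm.injective (by simpa using hx)⟩

lemma ext_of_exists_extension (h₂ : Subsingleton (Ext S.X₂ Q 1))
    (H : ∀ f : S.X₁ ⟶ Q, ∃ g : S.X₂ ⟶ Q, S.f ≫ g = f) : Subsingleton (Ext S.X₃ Q 1) := by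
  refine ext_subsingleton_of_forall fun e => ?_
  obtain ⟨x, rfl⟩ := Ext.contravariant_sequence_exact₃ hS Q e (Subsingleton.elim _ _) (add_zero 1)
  obtain ⟨f, rfl⟩ := Ext.homEquiv₀.symm.surjective x
  obtain ⟨g, rfl⟩ := H f
  rw [Ext.homEquiv₀_symm_apply, ← Ext.mk₀_comp_mk₀, ← Ext.comp_assoc _ _ _ (add_zero 1)
    (zero_add 0) (by omega), hS.extClass_comp, Ext.zero_comp]

lemma exists_lift_of_ext (h : Subsingleton (Ext Q S.X₁ 1)) (f : Q ⟶ S.X₃) :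
    ∃ g : Q ⟶ S.X₂, g ≫ S.g = f := by
  obtain ⟨x, hx⟩ := Ext.covariant_sequence_exact₃ Q hS (Ext.mk₀ f) (zero_add 1)
    (Subsingleton.elim _ _)
  obtain ⟨g, rfl⟩ := Ext.homEquiv₀.symm.surjective x
  exact ⟨g, Ext.homEquiv₀.symm.injective (by simpa using hx)⟩

lemma ext_of_exists_lift (h₂ : Subsingleton (Ext Q S.X₂ 1))
    (H : ∀ f : Q ⟶ S.X₃, ∃ g : Q ⟶ S.X₂, g ≫ S.g = f) : Subsingleton (Ext Q S.X₁ 1) := by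
  refine ext_subsingleton_of_forall fun e => ?_
  obtain ⟨x, rfl⟩ := Ext.covariant_sequence_exact₁ Q hS e (Subsingleton.elim _ _) (zero_add 1)
  obtain ⟨f, rfl⟩ := Ext.homEquiv₀.symm.surjective x
  obtain ⟨g, rfl⟩ := H f
  rw [Ext.homEquiv₀_symm_apply, ← Ext.mk₀_comp_mk₀, Ext.comp_assoc _ _ _ (zero_add 0)
    (zero_add 1) (by omega), hS.comp_extClass, Ext.comp_zero]

end

lemma ext_projective (P Q : C) [Projective P] (n : ℕ) : Subsingleton (Ext P Q (n + 1)) :=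
  ext_subsingleton_of_forall fun e => e.eq_zero_of_projective

lemma ext_injective (X I : C) [Injective I] (n : ℕ) : Subsingleton (Ext X I (n + 1)) :=
  ext_subsingleton_of_forall fun e => e.eq_zero_of_injective

/-- Dimension shifting along a projective resolution. -/
lemma Syz.ext_iff {m : ℕ} {M K : C} (h : Syz m M K) (Q : C) (n : ℕ) :
    Subsingleton (Ext K Q (n + 1)) ↔ Subsingleton (Ext M Q (n + 1 + m)) := by
  induction m generalizing M with
  | zero =>
    obtain ⟨e⟩ := h
    exact ⟨e.symm.retract.ext_subsingleton_left, e.retract.ext_subsingleton_left⟩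
  | succ m ih =>
    obtain ⟨K₁, ⟨P, hP, hs⟩, h⟩ := h
    rw [ih h]
    have e : n + 1 + m = n + m + 1 := by omega
    rw [show n + 1 + (m + 1) = n + m + 1 + 1 by omega, e]
    exact ⟨fun h' => hs.ext_right h' (ext_projective _ _ _),
      fun h' => hs.ext_left (ext_projective _ _ _) h'⟩

/-- An `m`-th syzygy of an object of projective dimension at most `m` is projective. -/
lemma Syz.projective [EnoughInjectives C] {m : ℕ} {M K : C} (h : Syz m M K)
    [hM : HasProjectiveDimensionLT M (m + 1)] : Projective K := by
  rw [projective_iff_hasProjectiveDimensionLT_one]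
  refine hasProjectiveDimensionLT_of_enoughInjectives K 1 fun Y => (h.ext_iff Y 0).2 ?_
  exact HasProjectiveDimensionLT.subsingleton M (m + 1) _ (by omega) Y

end DimensionShifting

/-! ### Acyclic complexes as spliced short exact sequences -/

section Cycles

open Abelian

variable {R : Type u} [Ring R]

lemma IsSES.hom {X Y Z : ModuleCat.{u} R} (f : X ⟶ Y) (g : Y ⟶ Z)
    (hf : Function.Injective f) (hfg : Function.Exact f g) (hg : Function.Surjective g) :
    ∃ w : f ≫ g = 0, (ShortComplex.mk f g w).ShortExact :=
  ⟨by ext x; exact hfg.apply_apply_eq_zero x,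
    { exact := (ShortComplex.ShortExact.moduleCat_exact_iff_function_exact _).2 hfg
      mono_f := (ModuleCat.mono_iff_injective _).2 hf
      epi_g := (ModuleCat.epi_iff_surjective _).2 hg }⟩

lemma IsSES.of_linearMap {X Y Z : ModuleCat.{u} R} (f : X →ₗ[R] Y) (g : Y →ₗ[R] Z)
    (hf : Function.Injective f) (hfg : Function.Exact f g) (hg : Function.Surjective g) :
    IsSES X Y Z := by
  obtain ⟨w, h⟩ := IsSES.hom (ModuleCat.ofHom f) (ModuleCat.ofHom g) hf hfg hg
  exact ⟨_, _, w, h⟩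

lemma IsSES.exists_linearMap {X Y Z : ModuleCat.{u} R} (h : IsSES X Y Z) :
    ∃ (f : X →ₗ[R] Y) (g : Y →ₗ[R] Z),
      Function.Injective f ∧ Function.Exact f g ∧ Function.Surjective g := by
  obtain ⟨i, p, w, h⟩ := h
  exact ⟨i.hom, p.hom, (ModuleCat.mono_iff_injective _).1 h.mono_f,
    (ShortComplex.ShortExact.moduleCat_exact_iff_function_exact _).1 h.exact,
    (ModuleCat.epi_iff_surjective _).1 h.epi_g⟩

/-- Presentation of a complex `K` as the splice of short exact sequences
`0 → Z n → K n → Z (n + 1) → 0`. -/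
structure CycleData (K : CochainComplex (ModuleCat.{u} R) ℤ) where
  /-- the cycle modules -/
  Z : ℤ → ModuleCat.{u} R
  /-- the inclusions of the cycles -/
  i : ∀ n, Z n ⟶ K.X n
  /-- the projections to the cycles -/
  p : ∀ n, K.X n ⟶ Z (n + 1)
  w : ∀ n, i n ≫ p n = 0
  exact : ∀ n, (ShortComplex.mk (i n) (p n) (w n)).ShortExact
  d_eq : ∀ n, K.d n (n + 1) = p n ≫ i (n + 1)

namespace CycleData

variable {K : CochainComplex (ModuleCat.{u} R) ℤ}

/-- The cycles of an acyclic complex. -/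
def ofAcyclic (hK : K.Acyclic) : CycleData K where
  Z n := ModuleCat.of R (K.d n (n + 1)).hom.ker
  i n := ModuleCat.ofHom (K.d n (n + 1)).hom.ker.subtype
  p n := ModuleCat.ofHom ((K.d n (n + 1)).hom.codRestrict _ fun x => by
    have := K.d_comp_d n (n + 1) (n + 1 + 1)
    exact LinearMap.congr_fun (congrArg ModuleCat.Hom.hom this) x)
  w n := by ext x; exact LinearMap.mem_ker.1 x.2
  exact n := by
    refine (IsSES.hom _ _ (Submodule.subtype_injective _) (fun x => ?_) fun y => ?_).2
    · constructor
      · intro hx; exact ⟨⟨x, congrArg Subtype.val hx⟩, rfl⟩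
      · rintro ⟨y, rfl⟩; exact Subtype.ext y.2
    · have h := (K.exactAt_iff' n (n + 1) (n + 1 + 1) (by simp) (by simp)).1 (hK (n + 1))
      rw [ShortComplex.ShortExact.moduleCat_exact_iff_function_exact] at h
      obtain ⟨x, hx⟩ := (h y.1).1 y.2
      exact ⟨x, Subtype.ext hx⟩
  d_eq n := rfl

variable (D : CycleData K)

lemma i_injective (n : ℤ) : Function.Injective (D.i n) :=
  (ModuleCat.mono_iff_injective _).1 (D.exact n).mono_f

lemma p_surjective (n : ℤ) : Function.Surjective (D.p n) :=
  (ModuleCat.epi_iff_surjective _).1 (D.exact n).epi_g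

lemma fun_exact (n : ℤ) : Function.Exact (D.i n) (D.p n) :=
  (ShortComplex.ShortExact.moduleCat_exact_iff_function_exact _).1 (D.exact n).exact

lemma isSES (n : ℤ) : IsSES (D.Z n) (K.X n) (D.Z (n + 1)) := ⟨_, _, _, D.exact n⟩

lemma d_apply (n : ℤ) (x : K.X n) : K.d n (n + 1) x = D.i (n + 1) (D.p n x) := by
  rw [D.d_eq]; rfl

lemma d_eq_zero_iff (n : ℤ) (x : K.X n) : K.d n (n + 1) x = 0 ↔ ∃ z, D.i n z = x := by
  rw [d_apply, map_eq_zero_iff _ (D.i_injective _)]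
  exact D.fun_exact n x

include D in
lemma acyclic : K.Acyclic := fun n => by
  obtain ⟨k, rfl⟩ : ∃ k, n = k + 1 := ⟨n - 1, by ring⟩
  rw [K.exactAt_iff' k (k + 1) (k + 1 + 1) (by simp) (by simp),
    ShortComplex.ShortExact.moduleCat_exact_iff_function_exact]
  intro (y : K.X (k + 1))
  change K.d (k + 1) (k + 1 + 1) y = 0 ↔ ∃ x, K.d k (k + 1) x = y
  rw [D.d_eq_zero_iff]
  constructor
  · rintro ⟨z, rfl⟩
    obtain ⟨x, rfl⟩ := D.p_surjective k z
    exact ⟨x, D.d_apply k x⟩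
  · rintro ⟨x, rfl⟩
    exact ⟨_, (D.d_apply k x).symm⟩

/-- The cycle modules are the kernels of the differentials. -/
def kerEquiv (n : ℤ) : D.Z n ≃ₗ[R] (K.d n (n + 1)).hom.ker :=
  LinearEquiv.ofBijective ((D.i n).hom.codRestrict _ fun x =>
    (D.d_eq_zero_iff n _).2 ⟨x, rfl⟩)
    ⟨fun x y h => D.i_injective n (congrArg Subtype.val h), fun y => by
      obtain ⟨z, hz⟩ := (D.d_eq_zero_iff n y.1).1 y.2
      exact ⟨z, Subtype.ext hz⟩⟩

end CycleData

lemma exists_cycleData {𝓟 : ModuleCat.{u} R → Prop} (Z : ℤ → ModuleCat.{u} R)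
    (hZ : ∀ n, Link 𝓟 (Z n) (Z (n + 1))) :
    ∃ (K : CochainComplex (ModuleCat.{u} R) ℤ) (D : CycleData K), D.Z = Z ∧ ∀ n, 𝓟 (K.X n) := by
  choose P hP i p w hS using hZ
  refine ⟨CochainComplex.of P (fun n => p n ≫ i (n + 1)) fun n => ?_,
    { Z := Z, i := i, p := p, w := w, exact := hS, d_eq := fun n => ?_ }, rfl, hP⟩
  · rw [Category.assoc, reassoc_of% (w (n + 1)), Limits.zero_comp, Limits.comp_zero]
  · exact CochainComplex.of_d P (fun n => p n ≫ i (n + 1)) n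

/-- Gorenstein projective modules in terms of spliced short exact sequences: total acyclicity means
that `Ext¹(-, Q)` vanishes on the cycles. -/
lemma isGorensteinProjective_iff (M : ModuleCat.{u} R) :
    IsGorensteinProjective R M ↔ ∃ Z : ℤ → ModuleCat.{u} R, Nonempty (M ≅ Z 0) ∧
      (∀ n, Link Projective (Z n) (Z (n + 1))) ∧
      ∀ n (Q : ModuleCat.{u} R), Projective Q → Subsingleton (Ext (Z n) Q 1) := by
  constructor
  · rintro ⟨K, hP, hK, hQ, ⟨e⟩⟩
    let D := CycleData.ofAcyclic hK
    refine ⟨D.Z, ⟨e.toModuleIso⟩, fun n => ⟨_, hP n, D.isSES n⟩, fun m Q hQ' => ?_⟩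
    obtain ⟨n, rfl⟩ : ∃ k, m = k + 1 + 1 := ⟨m - 2, by ring⟩
    have := hP (n + 1)
    refine ext_of_exists_extension (D.exact (n + 1)) (ext_projective _ _ 0) fun f => ?_
    have h1 := hQ Q hQ' n
    obtain ⟨k, hk⟩ : ∃ k, k = n - 1 := ⟨_, rfl⟩
    rw [← hk] at h1
    obtain rfl : n = k + 1 := by omega
    obtain ⟨g, hg⟩ := (h1 (D.p (k + 1) ≫ f)).1 (by
      change K.d k (k + 1) ≫ D.p (k + 1) ≫ f = 0
      rw [D.d_eq, Category.assoc, reassoc_of% (D.w (k + 1)), Limits.zero_comp, Limits.comp_zero])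
    have := (D.exact (k + 1)).epi_g
    refine ⟨g, ?_⟩
    rw [← cancel_epi (D.p (k + 1))]
    refine Eq.trans ?_ hg
    change D.p (k + 1) ≫ D.i (k + 1 + 1) ≫ g = K.d (k + 1) (k + 1 + 1) ≫ g
    rw [D.d_eq, Category.assoc]
  · rintro ⟨Z, ⟨e⟩, hZ, hQ⟩
    obtain ⟨K, D, rfl, hP⟩ := exists_cycleData Z hZ
    refine ⟨K, hP, D.acyclic, fun Q hQ' n => ?_, ⟨e.toLinearEquiv ≪≫ₗ D.kerEquiv 0⟩⟩
    obtain ⟨k, hk⟩ : ∃ k, k = n - 1 := ⟨_, rfl⟩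
    rw [← hk]
    obtain rfl : n = k + 1 := by omega
    intro f
    constructor
    · intro hf
      change K.d k (k + 1) ≫ f = 0 at hf
      have := (D.exact k).epi_g
      have h1 : D.i (k + 1) ≫ f = 0 := by
        rw [← cancel_epi (D.p k), ← Category.assoc, ← D.d_eq, hf, Limits.comp_zero]
      have := (D.exact (k + 1)).epi_g
      obtain ⟨g, hg⟩ := exists_extension_of_ext (D.exact (k + 1 + 1)) (hQ _ Q hQ')
        ((D.exact (k + 1)).exact.desc f h1)
      refine ⟨g, ?_⟩
      change K.d (k + 1) (k + 1 + 1) ≫ g = f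
      rw [D.d_eq, Category.assoc]
      erw [hg]
      exact (D.exact (k + 1)).exact.g_desc f h1
    · rintro ⟨g, rfl⟩
      change K.d k (k + 1) ≫ K.d (k + 1) (k + 1 + 1) ≫ g = 0
      rw [← Category.assoc, K.d_comp_d, Limits.zero_comp]

/-- Gorenstein injective modules in terms of spliced short exact sequences. -/
lemma isGorensteinInjective_iff (M : ModuleCat.{u} R) :
    IsGorensteinInjective R M ↔ ∃ Z : ℤ → ModuleCat.{u} R, Nonempty (M ≅ Z 0) ∧
      (∀ n, Link Injective (Z n) (Z (n + 1))) ∧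
      ∀ n (I : ModuleCat.{u} R), Injective I → Subsingleton (Ext I (Z n) 1) := by
  constructor
  · rintro ⟨K, hP, hK, hI, ⟨e⟩⟩
    let D := CycleData.ofAcyclic hK
    refine ⟨D.Z, ⟨e.toModuleIso⟩, fun n => ⟨_, hP n, D.isSES n⟩, fun k I hI' => ?_⟩
    have := hP k
    refine ext_of_exists_lift (D.exact k) (ext_injective _ _ 0) fun f => ?_
    have h1 := hI I hI' (k + 1)
    obtain ⟨k', hk'⟩ : ∃ k', k' = k + 1 - 1 := ⟨_, rfl⟩
    rw [← hk'] at h1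
    obtain rfl : k' = k := by omega
    have := (D.exact (k' + 1)).mono_f
    obtain ⟨g, hg⟩ := (h1 (f ≫ D.i (k' + 1))).1 (by
      change (f ≫ D.i (k' + 1)) ≫ K.d (k' + 1) (k' + 1 + 1) = 0
      rw [D.d_eq, Category.assoc, reassoc_of% (D.w (k' + 1)), Limits.zero_comp, Limits.comp_zero])
    refine ⟨g, ?_⟩
    rw [← cancel_mono (D.i (k' + 1))]
    refine Eq.trans ?_ hg
    change (g ≫ D.p k') ≫ D.i (k' + 1) = g ≫ K.d k' (k' + 1)
    rw [D.d_eq, Category.assoc]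
  · rintro ⟨Z, ⟨e⟩, hZ, hI⟩
    obtain ⟨K, D, rfl, hP⟩ := exists_cycleData Z hZ
    refine ⟨K, hP, D.acyclic, fun I hI' n => ?_, ⟨e.toLinearEquiv ≪≫ₗ D.kerEquiv 0⟩⟩
    obtain ⟨k, hk⟩ : ∃ k, k = n - 1 := ⟨_, rfl⟩
    rw [← hk]
    obtain rfl : n = k + 1 := by omega
    intro f
    constructor
    · intro hf
      change f ≫ K.d (k + 1) (k + 1 + 1) = 0 at hf
      have := (D.exact (k + 1 + 1)).mono_f
      have h1 : f ≫ D.p (k + 1) = 0 := by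
        rw [← cancel_mono (D.i (k + 1 + 1)), Category.assoc, ← D.d_eq, hf, Limits.zero_comp]
      have := (D.exact (k + 1)).mono_f
      obtain ⟨g, hg⟩ := exists_lift_of_ext (D.exact k) (hI _ I hI')
        ((D.exact (k + 1)).exact.lift f h1)
      refine ⟨g, ?_⟩
      change g ≫ K.d k (k + 1) = f
      rw [D.d_eq, ← Category.assoc]
      erw [hg]
      exact (D.exact (k + 1)).exact.lift_f f h1
    · rintro ⟨g, rfl⟩
      change (g ≫ K.d k (k + 1)) ≫ K.d (k + 1) (k + 1 + 1) = 0
      rw [Category.assoc, K.d_comp_d, Limits.comp_zero]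

end Cycles

/-! ### Gorenstein projective and injective dimensions when `spli` is finite -/

section Spli

open Abelian Limits

variable {R : Type u} [Ring R]

/-- The injective modules have projective dimension at most `m`. -/
def SpliLE (R : Type u) [Ring R] (m : ℕ) : Prop :=
  ∀ I : ModuleCat.{u} R, Injective I → HasProjectiveDimensionLT I (m + 1)

/-! #### Resolutions from syzygies -/

lemma hasResolution_of_syz {𝓟 : ModuleCat.{u} R → Prop} (hproj : ∀ P, Projective P → 𝓟 P) {m : ℕ}
    {M K : ModuleCat.{u} R} (h : Syz m M K) (hK : 𝓟 K) : HasResolution 𝓟 m M := by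
  induction m generalizing M with
  | zero => exact .zero M K hK h.some
  | succ m ih =>
    obtain ⟨K₁, ⟨P, hP, hs⟩, h⟩ := h
    obtain ⟨f, g, hf, hfg, hg⟩ := hs.exists_linearMap
    exact .succ m K₁ P M (hproj P hP) (ih h) f g hf hfg hg

lemma hasCoresolution_of_syz {𝓟 : ModuleCat.{u} R → Prop} (hinj : ∀ E, Injective E → 𝓟 E) {m : ℕ}
    {M K : (ModuleCat.{u} R)ᵒᵖ} (h : Syz m M K) (hK : 𝓟 K.unop) :
    HasCoresolution 𝓟 m M.unop := by
  induction m generalizing M with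
  | zero => exact .zero M.unop K.unop hK h.some.unop
  | succ m ih =>
    obtain ⟨K₁, ⟨P, hP, hs⟩, h⟩ := h
    obtain ⟨f, g, hf, hfg, hg⟩ := hs.unop.exists_linearMap
    exact .succ m M.unop P.unop K₁.unop (hinj _ inferInstance) (ih h) f g hf hfg hg

lemma resolutionDim_le {𝓟 : ModuleCat.{u} R → Prop} {m : ℕ} {M : ModuleCat.{u} R}
    (h : HasResolution 𝓟 m M) : resolutionDim 𝓟 M ≤ m := iInf₂_le m h

lemma coresolutionDim_le {𝓟 : ModuleCat.{u} R → Prop} {m : ℕ} {M : ModuleCat.{u} R}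
    (h : HasCoresolution 𝓟 m M) : coresolutionDim 𝓟 M ≤ m := iInf₂_le m h

lemma exists_of_resolutionDim_lt {𝓟 : ModuleCat.{u} R → Prop} {M : ModuleCat.{u} R}
    (h : resolutionDim 𝓟 M < ⊤) : ∃ m, HasResolution 𝓟 m M := by
  by_contra! H
  exact h.ne (iInf₂_eq_top.2 fun m hm => absurd hm (H m))

lemma exists_of_coresolutionDim_lt {𝓟 : ModuleCat.{u} R → Prop} {M : ModuleCat.{u} R}
    (h : coresolutionDim 𝓟 M < ⊤) : ∃ m, HasCoresolution 𝓟 m M := by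
  by_contra! H
  exact h.ne (iInf₂_eq_top.2 fun m hm => absurd hm (H m))

/-! #### Total acyclicity -/

lemma projective_module (P : ModuleCat.{u} R) [hP : Projective P] : Module.Projective R P :=
  (IsProjective.iff_projective P).2 hP

lemma injective_module (I : ModuleCat.{u} R) [hI : Injective I] : Module.Injective R I :=
  (Module.injective_iff_injective_object R I).2 hI

lemma injective_starDual_of_projective [StarRing R] (Q : Type u) [AddCommGroup Q] [Module R Q]
    [Module.Projective R Q] : Module.Injective R (StarDual Q) where
  out X Y _ _ _ _ f hf g := by
    obtain ⟨h, hh⟩ := Module.projective_lifting_property (StarDual.map f) (StarDual.swap g)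
      (StarDual.map_surjective f hf)
    refine ⟨StarDual.swap h, fun x => ?_⟩
    ext q
    exact DFunLike.congr_fun (LinearMap.congr_fun hh q) x

section TotalDiff

variable {X : ℤ → Type u} [∀ n, AddCommGroup (X n)] [∀ n, Module R (X n)]
  (d : ∀ n, X n →ₗ[R] X (n + 1))

/-- The differential of the total module `⨁ X n` of a complex. -/
def totalDiff : DirectSum ℤ X →ₗ[R] DirectSum ℤ X :=
  DirectSum.toModule R ℤ _ fun n => DirectSum.lof R ℤ X (n + 1) ∘ₗ d n

lemma totalDiff_lof (n : ℤ) (x : X n) :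
    totalDiff d (DirectSum.lof R ℤ X n x) = DirectSum.lof R ℤ X (n + 1) (d n x) :=
  DirectSum.toModule_lof R n x

lemma component_totalDiff (n : ℤ) (t : DirectSum ℤ X) :
    DirectSum.component R ℤ X (n + 1) (totalDiff d t) = d n (DirectSum.component R ℤ X n t) := by
  have : DirectSum.component R ℤ X (n + 1) ∘ₗ totalDiff d =
      d n ∘ₗ DirectSum.component R ℤ X n := by
    refine DirectSum.linearMap_ext R fun j => LinearMap.ext fun x => ?_
    simp only [LinearMap.comp_apply]
    rw [totalDiff_lof]
    rcases eq_or_ne j n with rfl | hj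
    · rw [DirectSum.component.lof_self, DirectSum.component.lof_self]
    · rw [DirectSum.component.of, DirectSum.component.of, dif_neg hj, dif_neg (by omega), map_zero]
  exact LinearMap.congr_fun this t

lemma totalDiff_exact (hd : ∀ n, Function.Exact (d n) (d (n + 1))) :
    Function.Exact (totalDiff d) (totalDiff d) := fun t => by
  classical
  let c := fun n => DirectSum.component R ℤ X n
  constructor
  · intro ht
    have h1 : ∀ n, ∃ y : X n, d n y = c (n + 1) t ∧ (c (n + 1) t = 0 → y = 0) := by
      intro n
      by_cases h0 : c (n + 1) t = 0
      · exact ⟨0, by rw [h0, map_zero], fun _ => rfl⟩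
      · obtain ⟨y, hy⟩ := (hd n (c (n + 1) t)).1 (by
          rw [← component_totalDiff, ht, map_zero])
        exact ⟨y, hy, fun h => absurd h h0⟩
    choose y hy hy0 using h1
    let s : Finset ℤ := (DFinsupp.support (t : Π₀ n, X n)).image fun n => n - 1
    let Y : DirectSum ℤ X := DFinsupp.mk s fun n => y n
    have hY : ∀ n, c n Y = y n := fun n => by
      change (DFinsupp.mk s fun n => y n : Π₀ n, X n) n = y n
      rw [DFinsupp.mk_apply]
      split_ifs with h
      · rfl
      · refine (hy0 n ?_).symm
        by_contra h0
        exact h (Finset.mem_image.2 ⟨n + 1, DFinsupp.mem_support_iff.2 h0, by ring⟩)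
    refine ⟨Y, DFinsupp.ext fun n => ?_⟩
    obtain ⟨j, rfl⟩ : ∃ j, n = j + 1 := ⟨n - 1, by ring⟩
    exact (component_totalDiff d j Y).trans ((congrArg (d j) (hY j)).trans (hy j))
  · rintro ⟨y, rfl⟩
    refine DFinsupp.ext fun n => ?_
    obtain ⟨j, rfl⟩ : ∃ j, n = j + 1 + 1 := ⟨n - 2, by ring⟩
    refine (component_totalDiff d (j + 1) _).trans ?_
    rw [component_totalDiff, (hd j).apply_apply_eq_zero]
    rfl

end TotalDiff

/-- Acyclic complexes of projective modules are totally acyclic if injective modules have finite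
projective dimension. -/
theorem ext_splice_projective [StarRing R] {m : ℕ} (hR : SpliLE R m) {Z : ℤ → ModuleCat.{u} R}
    (hZ : ∀ n, Link Projective (Z n) (Z (n + 1))) (n : ℤ) (Q : ModuleCat.{u} R)
    (hQ : Projective Q) : Subsingleton (Ext (Z n) Q 1) := by
  obtain ⟨K, D, rfl, hP⟩ := exists_cycleData Z hZ
  obtain ⟨k, rfl⟩ : ∃ k, n = k + 1 + 1 + 1 := ⟨n - 3, by ring⟩
  have hP' : ∀ n, Module.Projective R (K.X n) := fun n => by have := hP n; exact projective_module _
  have := projective_module Q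
  have := hP (k + 1 + 1)
  refine ext_of_exists_extension (D.exact (k + 1 + 1)) (ext_projective _ _ 0)
    fun (f : D.Z (k + 1 + 1) ⟶ Q) => ?_
  have hex : ∀ n, Function.Exact (K.d n (n + 1)).hom (K.d (n + 1) (n + 1 + 1)).hom := fun n x => by
    refine (D.d_eq_zero_iff (n + 1) x).trans ⟨?_, ?_⟩
    · rintro ⟨z, rfl⟩
      obtain ⟨y, rfl⟩ := D.p_surjective n z
      exact ⟨y, D.d_apply n y⟩
    · rintro ⟨y, rfl⟩
      exact ⟨_, (D.d_apply n y).symm⟩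
  obtain ⟨ψ, hψ⟩ := exists_factor_of_exact
    (fun J _ _ hJ => ⟨m + 1, hR _ ((Module.injective_iff_injective_object R J).1 hJ)⟩)
    (totalDiff fun n => (K.d n (n + 1)).hom) (totalDiff_exact _ hex)
    (injective_starDual_of_projective Q) (f.hom ∘ₗ (D.p (k + 1)).hom ∘ₗ
      DirectSum.component R ℤ (fun n => K.X n) (k + 1)) fun t => by
      change f (D.p (k + 1) (DirectSum.component R ℤ (fun n => K.X n) (k + 1) _)) = 0
      rw [component_totalDiff]
      change f (D.p (k + 1) (K.d k (k + 1) _)) = 0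
      rw [D.d_apply, (D.fun_exact (k + 1)).apply_apply_eq_zero, map_zero]
  refine ⟨ModuleCat.ofHom (ψ ∘ₗ DirectSum.lof R ℤ (fun n => K.X n) (k + 1 + 1)), ?_⟩
  ext z
  obtain ⟨x, rfl⟩ := D.p_surjective (k + 1) z
  have h2 := hψ (DirectSum.lof R ℤ (fun n => K.X n) (k + 1) x)
  rw [totalDiff_lof] at h2
  change ψ (DirectSum.lof R ℤ (fun n => K.X n) _ (K.d (k + 1) (k + 1 + 1) x)) = _ at h2
  rw [D.d_apply] at h2
  refine h2.trans ?_
  change f (D.p (k + 1) (DirectSum.component R ℤ (fun n => K.X n) (k + 1) _)) = _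
  rw [DirectSum.component.lof_self]

lemma Syz.isGorensteinProjective [StarRing R] {m : ℕ} (hR : SpliLE R m) {M K : ModuleCat.{u} R}
    (h : Syz m M K) : IsGorensteinProjective R K := by
  obtain ⟨Z, rfl, -, hZ⟩ := exists_splice_of_syz (𝓟 := Projective) m (fun _ h => h)
    (fun I L hI hL => have := hR I hI; hL.projective) h
  exact (isGorensteinProjective_iff _).2 ⟨Z, ⟨Iso.refl _⟩, hZ, ext_splice_projective hR hZ⟩

theorem Gpd_le [StarRing R] {m : ℕ} (hR : SpliLE R m) (M : ModuleCat.{u} R) : Gpd R M ≤ m := by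
  obtain ⟨K, hK⟩ := Syz.exists_right m M
  refine resolutionDim_le (hasResolution_of_syz (fun P hP => ?_) hK (hK.isGorensteinProjective hR))
  obtain ⟨N, hN⟩ := Syz.exists_of_projective m P hP
  exact hN.isGorensteinProjective hR

/-- Projective modules have finite injective dimension if injective modules have finite projective
dimension. -/
lemma SpliLE.hasInjectiveDimensionLT [StarRing R] {m : ℕ} (hR : SpliLE R m) (Q : ModuleCat.{u} R)
    (hQ : Projective Q) : HasInjectiveDimensionLT Q (m + 1) := by
  refine hasInjectiveDimensionLT_of_enoughProjectives Q (m + 1) fun M => ?_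
  obtain ⟨K, hK⟩ := Syz.exists_right m M
  obtain ⟨Z, ⟨e⟩, -, hZ⟩ := (isGorensteinProjective_iff K).1 (hK.isGorensteinProjective hR)
  have := (hK.ext_iff Q 0).1 (e.retract.ext_subsingleton_left (hZ 0 Q hQ))
  rwa [show 0 + 1 + m = m + 1 by omega] at this

lemma Syz.injective_unop {m : ℕ} {Q L : (ModuleCat.{u} R)ᵒᵖ} (h : Syz m Q L)
    (hQ : HasInjectiveDimensionLT Q.unop (m + 1)) : Injective L.unop := by
  induction m generalizing Q with
  | zero =>
    exact injective_iff_hasInjectiveDimensionLT_one.2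
      (hasInjectiveDimensionLT_of_iso h.some.unop 1)
  | succ m ih =>
    obtain ⟨K₁, ⟨P, hP, hs⟩, h⟩ := h
    obtain ⟨i, p, w, hs⟩ := hs.unop
    exact ih h ((hs.hasInjectiveDimensionLT_X₃_iff m (inferInstanceAs (Injective P.unop))).2 hQ)

lemma ext_splice_injective {Z : ℤ → ModuleCat.{u} R}
    (hZ : ∀ n, Link Injective (Z n) (Z (n + 1))) {I : ModuleCat.{u} R} (j : ℕ)
    (h : ∀ n, Subsingleton (Ext I (Z n) (j + 1))) (n : ℤ) : Subsingleton (Ext I (Z n) 1) := by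
  induction j generalizing n with
  | zero => exact h n
  | succ j ih =>
    refine ih (fun n => ?_) n
    obtain ⟨k, rfl⟩ : ∃ k, n = k + 1 := ⟨n - 1, by ring⟩
    obtain ⟨P, hP, hs⟩ := hZ k
    exact hs.ext_right' (ext_injective _ _ _) (h k)

lemma Syz.isGorensteinInjective [StarRing R] {m : ℕ} (hR : SpliLE R m)
    {M K : (ModuleCat.{u} R)ᵒᵖ} (h : Syz m M K) : IsGorensteinInjective R K.unop := by
  obtain ⟨Z, rfl, -, hZ⟩ := exists_splice_of_syz (𝓟 := fun X : (ModuleCat.{u} R)ᵒᵖ =>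
    Injective X.unop) m (fun _ h => inferInstance)
    (fun I L hI hL => hL.injective_unop (hR.hasInjectiveDimensionLT _ inferInstance)) h
  have hZ' : ∀ n : ℤ, Link Injective (Z (-n)).unop (Z (-(n + 1))).unop := fun n => by
    obtain ⟨P, hP, hs⟩ := hZ (-(n + 1))
    rw [show -(n + 1) + 1 = -n by ring] at hs
    exact ⟨P.unop, hP, hs.unop⟩
  refine (isGorensteinInjective_iff _).2 ⟨fun n => (Z (-n)).unop, ⟨Iso.refl _⟩, hZ',
    fun n I hI => ext_splice_injective hZ' m (fun n => ?_) n⟩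
  have := hR I hI
  exact HasProjectiveDimensionLT.subsingleton I (m + 1) _ le_rfl _

theorem Gid_le [StarRing R] {m : ℕ} (hR : SpliLE R m) (M : ModuleCat.{u} R) : Gid R M ≤ m := by
  obtain ⟨K, hK⟩ := Syz.exists_right m (Opposite.op M)
  refine coresolutionDim_le (hasCoresolution_of_syz (fun E hE => ?_) hK
    (hK.isGorensteinInjective hR))
  obtain ⟨N, hN⟩ := Syz.exists_of_projective m (Opposite.op E) inferInstance
  exact hN.isGorensteinInjective hR

end Spli

/-! ### Finiteness of all Gorenstein dimensions bounds `spli` -/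

section Bounds

open Abelian Limits

variable {R : Type u} [Ring R]

/-- The factors of a product are retracts. -/
def retractPi (Y : ℕ → ModuleCat.{u} R) (k : ℕ) : Retract (Y k) (∏ᶜ Y) where
  i := Pi.ι Y k
  r := Pi.π Y k
  retract := Pi.ι_π_eq_id Y k

/-! #### The injective case -/

lemma IsGorensteinInjective.ext_subsingleton {M I : ModuleCat.{u} R}
    (hM : IsGorensteinInjective R M) (hI : Injective I) (i : ℕ) :
    Subsingleton (Ext I M (i + 1)) := by
  obtain ⟨Z, ⟨e⟩, hZ, hext⟩ := (isGorensteinInjective_iff M).1 hM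
  have key : ∀ i n, Subsingleton (Ext I (Z n) (i + 1)) := fun i => by
    induction i with
    | zero => exact fun n => hext n I hI
    | succ i ih =>
      intro n
      obtain ⟨P, hP, hs⟩ := hZ n
      exact hs.ext_left' (ih (n + 1)) (ext_injective _ _ _)
  exact e.retract.ext_subsingleton_right (key i 0)

lemma HasCoresolution.ext_subsingleton {𝓟 : ModuleCat.{u} R → Prop} {I : ModuleCat.{u} R}
    (h𝓟 : ∀ E, 𝓟 E → ∀ i, Subsingleton (Ext I E (i + 1))) {m : ℕ} {M : ModuleCat.{u} R}
    (h : HasCoresolution 𝓟 m M) (i : ℕ) (hi : m ≤ i) : Subsingleton (Ext I M (i + 1)) := by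
  induction h generalizing i with
  | zero M E hE e => exact e.retract.ext_subsingleton_right (h𝓟 E hE i)
  | succ n M E L hE hL f g hf hfg hg ih =>
    obtain ⟨j, rfl⟩ : ∃ j, i = j + 1 := ⟨i - 1, by omega⟩
    exact (IsSES.of_linearMap f g hf hfg hg).ext_left' (ih j (by omega)) (h𝓟 E hE (j + 1))

/-- If all modules have finite Gorenstein injective dimension, then the projective dimensions of
injective modules are bounded: the product of test modules of growing degrees would violate
finiteness. -/
theorem exists_spliLE_of_Gid (h : ∀ M : ModuleCat.{u} R, Gid R M < ⊤) : ∃ m, SpliLE R m := by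
  by_contra! H
  have H' : ∀ k, ∃ I Y : ModuleCat.{u} R, Injective I ∧ ¬ Subsingleton (Ext I Y (k + 1)) := by
    intro k
    have hk := H k
    simp only [SpliLE, not_forall] at hk
    obtain ⟨I, hI, hI'⟩ := hk
    by_contra! h0
    exact hI' (hasProjectiveDimensionLT_of_enoughInjectives I (k + 1) fun Y => h0 I Y hI)
  choose I Y hI hY using H'
  obtain ⟨m, hm⟩ := exists_of_coresolutionDim_lt (h (∏ᶜ Y))
  exact hY m ((retractPi Y m).ext_subsingleton_right
    (hm.ext_subsingleton (fun E hE => hE.ext_subsingleton (hI m)) m le_rfl))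

/-! #### The projective case -/

/-- The right half of a complex exhibiting a Gorenstein projective module, in coinductive form. -/
def IsRightGP (M : ModuleCat.{u} R) : Prop :=
  ∃ 𝓓 : ModuleCat.{u} R → Prop, 𝓓 M ∧ ∀ X, 𝓓 X →
    (∀ Q : ModuleCat.{u} R, Projective Q → Subsingleton (Ext X Q 1)) ∧
      ∃ Y, 𝓓 Y ∧ Link Projective X Y

lemma IsGorensteinProjective.isRightGP {M : ModuleCat.{u} R} (h : IsGorensteinProjective R M) :
    IsRightGP M := by
  obtain ⟨Z, ⟨e⟩, hZ, hext⟩ := (isGorensteinProjective_iff M).1 h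
  refine ⟨fun X => ∃ n, Nonempty (X ≅ Z n), ⟨0, ⟨e⟩⟩, ?_⟩
  rintro X ⟨n, ⟨f⟩⟩
  exact ⟨fun Q hQ => f.retract.ext_subsingleton_left (hext n Q hQ), Z (n + 1),
    ⟨n + 1, ⟨Iso.refl _⟩⟩, (hZ n).of_iso f (Iso.refl _)⟩

lemma IsRightGP.ext_subsingleton {M : ModuleCat.{u} R} (h : IsRightGP M) (Q : ModuleCat.{u} R)
    (hQ : Projective Q) : Subsingleton (Ext M Q 1) := by
  obtain ⟨𝓓, hM, h⟩ := h
  exact (h M hM).1 Q hQ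

lemma IsRightGP.exists_link {M : ModuleCat.{u} R} (h : IsRightGP M) :
    ∃ Y, IsRightGP Y ∧ Link Projective M Y := by
  obtain ⟨𝓓, hM, h⟩ := h
  obtain ⟨Y, hY, hl⟩ := (h M hM).2
  exact ⟨Y, ⟨𝓓, hY, h⟩, hl⟩

/-- Extensions of modules that embed into projective modules with cokernels in `^⊥ Proj` embed in
the same way, compatibly. -/
lemma IsSES.exists_link_projective {X M Y X' Y' : ModuleCat.{u} R} (h : IsSES X M Y)
    (hX : Link Projective X X') (hY : Link Projective Y Y')
    (hext : ∀ Q : ModuleCat.{u} R, Projective Q → Subsingleton (Ext Y Q 1)) :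
    ∃ M', Link Projective M M' ∧ IsSES X' M' Y' := by
  obtain ⟨f, g, w, h⟩ := h
  obtain ⟨P, hP, i, p, wp, hp⟩ := hX
  obtain ⟨P', hP', i', p', wp', hp'⟩ := hY
  obtain ⟨l, hl⟩ := exists_extension_of_ext h (hext P hP) i
  dsimp at hl
  -- The horseshoe lemma in the opposite category.
  obtain ⟨L, hL, hKL⟩ := IsSES.horseshoe_of_lift h.op hp'.op hp.op l.op
    (congrArg Quiver.Hom.op hl)
  have : Injective (Opposite.op P' ⊞ Opposite.op P) := inferInstance
  exact ⟨L.unop, ⟨_, inferInstanceAs (Projective (Opposite.op P' ⊞ Opposite.op P).unop),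
    hL.unop⟩, hKL.unop⟩

lemma IsRightGP.extension {X M Y : ModuleCat.{u} R} (hX : IsRightGP X) (hY : IsRightGP Y)
    (h : IsSES X M Y) : IsRightGP M := by
  refine ⟨fun M => ∃ X Y, IsRightGP X ∧ IsRightGP Y ∧ IsSES X M Y, ⟨X, Y, hX, hY, h⟩, ?_⟩
  rintro M ⟨X, Y, hX, hY, h⟩
  refine ⟨fun Q hQ => h.ext_mid (hX.ext_subsingleton Q hQ) (hY.ext_subsingleton Q hQ), ?_⟩
  obtain ⟨X', hX', hlX⟩ := hX.exists_link
  obtain ⟨Y', hY', hlY⟩ := hY.exists_link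
  obtain ⟨M', hM', hs⟩ := h.exists_link_projective hlX hlY fun Q hQ => hY.ext_subsingleton Q hQ
  exact ⟨M', ⟨X', Y', hX', hY', hs⟩, hM'⟩

/-- Pushout of a short exact sequence along a monomorphism. -/
lemma IsSES.pushout {K G M L G' : ModuleCat.{u} R} (h : IsSES K G M) (h' : IsSES K L G') :
    ∃ E, IsSES L E M ∧ IsSES G E G' := by
  obtain ⟨i, p, hi, hip, hp⟩ := h.exists_linearMap
  obtain ⟨j, q, hj, hjq, hq⟩ := h'.exists_linearMap
  let W : Submodule R (G × L) := LinearMap.range (i.prod (-j))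
  have hW : ∀ x : G × L, W.mkQ x = 0 ↔ ∃ k, i k = x.1 ∧ -j k = x.2 := fun x => by
    rw [Submodule.mkQ_apply, Submodule.Quotient.mk_eq_zero, LinearMap.mem_range]
    simp [Prod.ext_iff]
  let a : (G × L) ⧸ W →ₗ[R] M := W.liftQ (p ∘ₗ LinearMap.fst R G L) (by
    rintro _ ⟨k, rfl⟩
    exact hip.apply_apply_eq_zero k)
  let b : (G × L) ⧸ W →ₗ[R] G' := W.liftQ (q ∘ₗ LinearMap.snd R G L) (by
    rintro _ ⟨k, rfl⟩
    simp [hjq.apply_apply_eq_zero])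
  refine ⟨ModuleCat.of R ((G × L) ⧸ W),
    IsSES.of_linearMap (Z := M) (W.mkQ ∘ₗ LinearMap.inr R G L) a ?_ ?_ ?_,
    IsSES.of_linearMap (Z := G') (W.mkQ ∘ₗ LinearMap.inl R G L) b ?_ ?_ ?_⟩
  · refine (injective_iff_map_eq_zero _).2 fun l hl => ?_
    obtain ⟨k, hk, hk'⟩ := (hW (0, l)).1 hl
    rw [(map_eq_zero_iff i hi).1 hk] at hk'
    simpa using hk'.symm
  · intro x
    obtain ⟨⟨g, l⟩, rfl⟩ := W.mkQ_surjective x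
    constructor
    · intro hx
      obtain ⟨k, rfl⟩ := (hip g).1 hx
      refine ⟨l + j k, ?_⟩
      rw [← sub_eq_zero]
      exact (hW ((0, l + j k) - (i k, l))).2 ⟨-k, by simp⟩
    · rintro ⟨l', hl'⟩
      rw [← hl']
      exact map_zero p
  · intro m
    obtain ⟨g, rfl⟩ := hp m
    exact ⟨W.mkQ (g, 0), rfl⟩
  · refine (injective_iff_map_eq_zero _).2 fun g hg => ?_
    obtain ⟨k, hk, hk'⟩ := (hW (g, 0)).1 hg
    replace hk : i k = g := hk
    have : j k = 0 := by simpa using hk'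
    rw [← hk, (map_eq_zero_iff j hj).1 this, map_zero]
  · intro x
    obtain ⟨⟨g, l⟩, rfl⟩ := W.mkQ_surjective x
    constructor
    · intro hx
      obtain ⟨k, rfl⟩ := (hjq l).1 hx
      refine ⟨g + i k, ?_⟩
      rw [← sub_eq_zero]
      exact (hW ((g + i k, 0) - (g, j k))).2 ⟨k, by simp⟩
    · rintro ⟨l', hl'⟩
      rw [← hl']
      exact map_zero q
  · intro m
    obtain ⟨l, rfl⟩ := hq m
    exact ⟨W.mkQ (0, l), rfl⟩

/-- For `L ⊆ E ⊆ P`, the quotient `P/L` is an extension of `P/E` by `E/L`. -/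
lemma IsSES.quotient {L E M P G : ModuleCat.{u} R} (h : IsSES L E M) (h' : IsSES E P G) :
    ∃ N, IsSES L P N ∧ IsSES M N G := by
  obtain ⟨f, q, hf, hfq, hq⟩ := h.exists_linearMap
  obtain ⟨e, r, he, her, hr⟩ := h'.exists_linearMap
  let W : Submodule R P := LinearMap.range (e ∘ₗ f)
  let a : (E ⧸ LinearMap.ker q) →ₗ[R] P ⧸ W := (LinearMap.ker q).mapQ W e (by
    intro x hx
    obtain ⟨l, rfl⟩ := (hfq x).1 hx
    exact ⟨l, rfl⟩)
  let b : P ⧸ W →ₗ[R] G := W.liftQ r (by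
    rintro _ ⟨l, rfl⟩
    exact her.apply_apply_eq_zero _)
  let σ := (q.quotKerEquivOfSurjective hq).symm
  have hσ : ∀ x, σ (q x) = (LinearMap.ker q).mkQ x := fun x =>
    (q.quotKerEquivOfSurjective hq).symm_apply_eq.2 rfl
  refine ⟨ModuleCat.of R (P ⧸ W), IsSES.of_linearMap (Z := ModuleCat.of R (P ⧸ W)) (e ∘ₗ f) W.mkQ
    (he.comp hf) (fun x => ?_) W.mkQ_surjective,
    IsSES.of_linearMap (X := M) (Y := ModuleCat.of R (P ⧸ W)) (a ∘ₗ σ.toLinearMap) b ?_ ?_ ?_⟩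
  · exact (Submodule.Quotient.mk_eq_zero W).trans Iff.rfl
  · refine (injective_iff_map_eq_zero _).2 fun x hx => ?_
    obtain ⟨x, rfl⟩ := hq x
    have h1 : a (σ (q x)) = 0 := hx
    rw [hσ] at h1
    obtain ⟨l, hl⟩ := (Submodule.Quotient.mk_eq_zero W).1 h1
    rw [← he hl]
    exact hfq.apply_apply_eq_zero l
  · intro x
    obtain ⟨x, rfl⟩ := W.mkQ_surjective x
    constructor
    · intro hx
      obtain ⟨y, rfl⟩ := (her x).1 hx
      refine ⟨q y, ?_⟩
      change a (σ (q y)) = _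
      rw [hσ]
      rfl
    · rintro ⟨y, hy⟩
      obtain ⟨y, rfl⟩ := hq y
      change a (σ (q y)) = _ at hy
      rw [hσ] at hy
      rw [← hy]
      exact her.apply_apply_eq_zero y
  · intro g
    obtain ⟨x, rfl⟩ := hr g
    exact ⟨W.mkQ x, rfl⟩

/-- A module of Gorenstein projective dimension at most `n` embeds into a module of projective
dimension at most `n`. -/
lemma HasResolution.exists_isSES {n : ℕ} {M : ModuleCat.{u} R}
    (h : HasResolution (IsGorensteinProjective R) n M) :
    ∃ L G, IsSES M L G ∧ IsRightGP G ∧ HasProjectiveDimensionLT L (n + 1) := by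
  induction h with
  | zero M P hP e =>
    obtain ⟨G, hG, L, hL, hs⟩ := hP.isRightGP.exists_link
    exact ⟨L, G, hs.of_iso e.symm (Iso.refl _) (Iso.refl _), hG, inferInstance⟩
  | succ n K G M hG _ i p hi hip hp ih =>
    obtain ⟨L, G', hL, hG', hLn⟩ := ih
    obtain ⟨E, hE, hE'⟩ := (IsSES.of_linearMap i p hi hip hp).pushout hL
    obtain ⟨G'', hG'', P, hP, hs⟩ := (hG.isRightGP.extension hG' hE').exists_link
    obtain ⟨N, ⟨f, g, w, hN⟩, hMN⟩ := hE.quotient hs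
    exact ⟨N, G'', hMN, hG'', (hN.hasProjectiveDimensionLT_X₃_iff n hP).2 hLn⟩

/-- If all modules have finite Gorenstein projective dimension, then the projective dimensions of
injective modules are bounded: an injective module is a direct summand of any module it embeds
into, and bounds follow from taking products. -/
theorem exists_spliLE_of_Gpd (h : ∀ M : ModuleCat.{u} R, Gpd R M < ⊤) : ∃ m, SpliLE R m := by
  by_contra! H
  have H' : ∀ k, ∃ I : ModuleCat.{u} R, Injective I ∧ ¬ HasProjectiveDimensionLT I (k + 1) := by
    intro k
    simpa only [SpliLE, not_forall, exists_prop] using H k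
  choose I hI hI' using H'
  obtain ⟨m, hm⟩ := exists_of_resolutionDim_lt (h (∏ᶜ I))
  obtain ⟨L, G, ⟨i, p, w, hs⟩, -, hL⟩ := hm.exists_isSES
  have : Injective (∏ᶜ I) := inferInstance
  have := hs.mono_f
  let r : Retract (∏ᶜ I) L := ⟨i, Injective.factorThru (𝟙 (∏ᶜ I)) i, Injective.comp_factorThru _ _⟩
  exact hI' m (((retractPi I m).trans r).hasProjectiveDimensionLT (m + 1))

end Bounds

/-! ### Flatness and character modules -/

section Pairings

variable {R : Type u} [Ring R]

namespace BalancedTensor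

section

variable {N N' : Type u} [AddCommGroup N] [Module Rᵐᵒᵖ N] [AddCommGroup N'] [Module Rᵐᵒᵖ N']
variable {M M' : Type u} [AddCommGroup M] [Module R M] [AddCommGroup M'] [Module R M']

variable (R) in
/-- The pure tensor `n ⊗ m`. -/
def tmul (n : N) (m : M) : BalancedTensor R N M := QuotientAddGroup.mk (n ⊗ₜ[ℤ] m)

lemma tmul_add (n : N) (m m' : M) : tmul R n (m + m') = tmul R n m + tmul R n m' :=
  congrArg QuotientAddGroup.mk (TensorProduct.tmul_add n m m')

lemma add_tmul (n n' : N) (m : M) : tmul R (n + n') m = tmul R n m + tmul R n' m :=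
  congrArg QuotientAddGroup.mk (TensorProduct.add_tmul n n' m)

lemma smul_tmul (n : N) (r : R) (m : M) : tmul R (MulOpposite.op r • n) m = tmul R n (r • m) := by
  rw [← sub_eq_zero]
  exact (QuotientAddGroup.eq_zero_iff _).2 (AddSubgroup.subset_closure ⟨n, r, m, rfl⟩)

lemma hom_ext {B : Type*} [AddCommGroup B] {φ ψ : BalancedTensor R N M →+ B}
    (h : ∀ n m, φ (tmul R n m) = ψ (tmul R n m)) : φ = ψ := by
  refine DFunLike.ext _ _ fun t => ?_
  obtain ⟨t, rfl⟩ := QuotientAddGroup.mk_surjective t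
  induction t using TensorProduct.induction_on with
  | zero => exact (map_zero φ).trans (map_zero ψ).symm
  | tmul n m => exact h n m
  | add a b ha hb => rw [QuotientAddGroup.mk_add, map_add, map_add, ha, hb]

variable [StarRing R] {J : Type u} [AddCommGroup J] [Module R J]

/-- The character of `N ⊗_R M` with `n ⊗ m ↦ φ n m`. Here `N` is the right module obtained from the
left module `J` by means of the involution. -/
def lift (e : J ≃+ N) (he : ∀ (r : R) j, e (star r • j) = MulOpposite.op r • e j)
    (φ : J →ₗ[R] StarDual M) : BalancedTensor R N M →+ AddCircle (1 : ℚ) :=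
  let β : N →+ M →+ AddCircle (1 : ℚ) :=
    AddMonoidHom.mk' (fun n => (φ (e.symm n) : M →+ AddCircle (1 : ℚ))) fun n n' => by
      rw [map_add, map_add]; rfl
  QuotientAddGroup.lift (balancedRel R N M) (TensorProduct.liftAddHom (R := ℤ) β fun k n m => by
    rw [map_zsmul, map_zsmul, AddMonoidHom.zsmul_apply]) <| by
  unfold balancedRel
  rw [AddSubgroup.closure_le]
  rintro _ ⟨n, r, m, rfl⟩
  have h : e.symm (MulOpposite.op r • n) = star r • e.symm n := by
    rw [e.symm_apply_eq, he, e.apply_symm_apply]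
  change (_ : AddCircle (1 : ℚ)) = 0
  rw [map_sub, sub_eq_zero]
  change φ (e.symm (MulOpposite.op r • n)) m = φ (e.symm n) (r • m)
  simp [h]

/-- A character of `N ⊗_R M` as a linear map `J → M^∨`. -/
def curry (e : J ≃+ N) (he : ∀ (r : R) j, e (star r • j) = MulOpposite.op r • e j)
    (χ : BalancedTensor R N M →+ AddCircle (1 : ℚ)) : J →ₗ[R] StarDual M where
  toFun j := StarDual.ofHom (AddMonoidHom.mk' (fun m => χ (tmul R (e j) m)) fun m m' => by
    rw [tmul_add, map_add])
  map_add' j j' := StarDual.ext fun m => by simp [add_tmul]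
  map_smul' r j := StarDual.ext fun m => by
    have := he (star r) j
    rw [star_star] at this
    change χ (tmul R (e (r • j)) m) = χ (tmul R (e j) (star r • m))
    rw [this, smul_tmul]

@[simp] lemma lift_tmul (e : J ≃+ N) (he : ∀ (r : R) j, e (star r • j) = MulOpposite.op r • e j)
    (φ : J →ₗ[R] StarDual M) (j : J) (m : M) : lift e he φ (tmul R (e j) m) = φ j m := by
  change φ (e.symm (e j)) m = _
  rw [e.symm_apply_apply]

end

end BalancedTensor

variable [StarRing R]

/-- The left module underlying a right module, by means of the involution. -/
def LeftOf (N : Type u) : Type u := N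

instance (N : Type u) [AddCommGroup N] : AddCommGroup (LeftOf N) := inferInstanceAs (AddCommGroup N)

instance (N : Type u) [AddCommGroup N] [Module Rᵐᵒᵖ N] : Module R (LeftOf N) :=
  Module.compHom N (starRingEquiv : R ≃+* Rᵐᵒᵖ).toRingHom

/-- The identity map, from the left module `LeftOf N` to `N`. -/
def LeftOf.equiv (N : Type u) [AddCommGroup N] : LeftOf N ≃+ N := AddEquiv.refl N

lemma LeftOf.equiv_star_smul (N : Type u) [AddCommGroup N] [Module Rᵐᵒᵖ N] (r : R) (n : LeftOf N) :
    LeftOf.equiv N (star r • n) = MulOpposite.op r • LeftOf.equiv N n := by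
  change MulOpposite.op (star (star r)) • (LeftOf.equiv N n) = _
  rw [star_star]

/-- The right module underlying a left module, by means of the involution. -/
def RightOf (J : Type u) : Type u := J

instance (J : Type u) [AddCommGroup J] : AddCommGroup (RightOf J) :=
  inferInstanceAs (AddCommGroup J)

instance (J : Type u) [AddCommGroup J] [Module R J] : Module Rᵐᵒᵖ (RightOf J) :=
  Module.compHom J (starRingEquiv : R ≃+* Rᵐᵒᵖ).symm.toRingHom

/-- The identity map, from `J` to the right module `RightOf J`. -/
def RightOf.equiv (J : Type u) [AddCommGroup J] : J ≃+ RightOf J := AddEquiv.refl J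

lemma RightOf.equiv_star_smul (J : Type u) [AddCommGroup J] [Module R J] (r : R) (j : J) :
    RightOf.equiv J (star r • j) = MulOpposite.op r • RightOf.equiv J j := by
  have : (starRingEquiv : R ≃+* Rᵐᵒᵖ).symm (MulOpposite.op r) = star r := rfl
  change _ = ((starRingEquiv : R ≃+* Rᵐᵒᵖ).symm (MulOpposite.op r)) • j
  rw [this]
  rfl

attribute [local instance] RingHomInvPair.of_ringEquiv in
lemma injective_leftOf (N : Type u) [AddCommGroup N] [Module Rᵐᵒᵖ N] [Module.Injective Rᵐᵒᵖ N] :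
    Module.Injective R (LeftOf N) :=
  Module.Injective.of_ringEquiv (starRingEquiv : R ≃+* Rᵐᵒᵖ).symm
    { (LeftOf.equiv N).symm with
      map_smul' := fun r n => by
        obtain ⟨r, rfl⟩ := (starRingEquiv : R ≃+* Rᵐᵒᵖ).surjective r
        change _ = ((starRingEquiv : R ≃+* Rᵐᵒᵖ).symm (starRingEquiv r)) • (LeftOf.equiv N).symm n
        rw [RingEquiv.symm_apply_apply]
        rfl }

attribute [local instance] RingHomInvPair.of_ringEquiv in
lemma injective_rightOf (J : Type u) [AddCommGroup J] [Module R J] [Module.Injective R J] :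
    Module.Injective Rᵐᵒᵖ (RightOf J) :=
  Module.Injective.of_ringEquiv (starRingEquiv : R ≃+* Rᵐᵒᵖ)
    { RightOf.equiv J with
      map_smul' := fun r j => by
        change _ = ((starRingEquiv : R ≃+* Rᵐᵒᵖ).symm (starRingEquiv r)) • j
        rw [RingEquiv.symm_apply_apply]
        rfl }

/-- Over a ring with involution, a module is flat if and only if its character module is injective
(Lambek). -/
lemma isFlat_iff (M : ModuleCat.{u} R) : IsFlat R M ↔ Module.Injective R (StarDual M) := by
  constructor
  · intro hM
    refine ⟨fun X Y _ _ _ _ f hf g => ?_⟩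
    let f' : RightOf X →ₗ[Rᵐᵒᵖ] RightOf Y :=
      { toFun := fun x => RightOf.equiv Y (f ((RightOf.equiv X).symm x))
        map_add' := fun x y => by simp
        map_smul' := fun r x => by
          obtain ⟨x, rfl⟩ := (RightOf.equiv X).surjective x
          induction r using MulOpposite.rec' with
          | _ r =>
          rw [← RightOf.equiv_star_smul, AddEquiv.symm_apply_apply, map_smul,
            RightOf.equiv_star_smul, AddEquiv.symm_apply_apply]
          rfl }
    obtain ⟨ψ, hψ⟩ := StarDual.exists_extension _ (hM (ModuleCat.of _ (RightOf X))
      (ModuleCat.of _ (RightOf Y)) f' hf)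
      (BalancedTensor.lift (RightOf.equiv X) (RightOf.equiv_star_smul X) g)
    refine ⟨BalancedTensor.curry (RightOf.equiv Y) (RightOf.equiv_star_smul Y) ψ, fun x => ?_⟩
    ext m
    refine (hψ (BalancedTensor.tmul R (RightOf.equiv X x) m)).trans ?_
    rw [BalancedTensor.lift_tmul]
  · intro hM N N' f hf
    refine (injective_iff_map_eq_zero _).2 fun t ht => ?_
    refine StarDual.eq_zero_of_forall_apply fun χ => ?_
    let f' : LeftOf N →ₗ[R] LeftOf N' :=
      { toFun := fun x => (LeftOf.equiv N').symm (f (LeftOf.equiv N x))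
        map_add' := fun x y => by simp
        map_smul' := fun r x => by
          obtain ⟨r, rfl⟩ := star_involutive.surjective r
          rw [LeftOf.equiv_star_smul, map_smul, AddEquiv.symm_apply_eq, RingHom.id_apply,
            LeftOf.equiv_star_smul, AddEquiv.apply_symm_apply] }
    obtain ⟨ψ, hψ⟩ := hM.out f' hf (BalancedTensor.curry (LeftOf.equiv N)
      (LeftOf.equiv_star_smul N) (χ : BalancedTensor R N M →+ AddCircle (1 : ℚ)))
    have key : (χ : BalancedTensor R N M →+ AddCircle (1 : ℚ)) =
        (BalancedTensor.lift (LeftOf.equiv N') (LeftOf.equiv_star_smul N') ψ).comp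
          (BalancedTensor.map f LinearMap.id) := BalancedTensor.hom_ext fun n m => by
      obtain ⟨n, rfl⟩ := (LeftOf.equiv N).surjective n
      refine (DFunLike.congr_fun (hψ n) m).symm.trans ?_
      exact (BalancedTensor.lift_tmul (LeftOf.equiv N') (LeftOf.equiv_star_smul N') ψ (f' n) m).symm
    refine (DFunLike.congr_fun key t).trans ?_
    exact (congrArg _ ht).trans
      (map_zero (BalancedTensor.lift (LeftOf.equiv N') (LeftOf.equiv_star_smul N') ψ))

/-- Exactness of `N ⊗_R M₁ → N ⊗_R M₂ → N ⊗_R M₃` in terms of characters: the complex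
`Hom_R(J, M₃^∨) → Hom_R(J, M₂^∨) → Hom_R(J, M₁^∨)` is exact, where `J` is the left module
corresponding to `N`. -/
lemma BalancedTensor.exact_iff {N J M₁ M₂ M₃ : Type u} [AddCommGroup N] [Module Rᵐᵒᵖ N]
    [AddCommGroup J] [Module R J] [AddCommGroup M₁] [Module R M₁] [AddCommGroup M₂] [Module R M₂]
    [AddCommGroup M₃] [Module R M₃] (e : J ≃+ N)
    (he : ∀ (r : R) j, e (star r • j) = MulOpposite.op r • e j) (a : M₁ →ₗ[R] M₂)
    (b : M₂ →ₗ[R] M₃) (hab : ∀ x, b (a x) = 0) :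
    Function.Exact (map (LinearMap.id : N →ₗ[Rᵐᵒᵖ] N) a) (map LinearMap.id b) ↔
      ∀ φ : J →ₗ[R] StarDual M₂, StarDual.map a ∘ₗ φ = 0 →
        ∃ ψ : J →ₗ[R] StarDual M₃, StarDual.map b ∘ₗ ψ = φ := by
  constructor
  · intro h φ hφ
    have h1 : (lift e he φ).comp (map LinearMap.id a) = 0 := hom_ext fun n m => by
      obtain ⟨j, rfl⟩ := e.surjective n
      refine (lift_tmul e he φ j (a m)).trans ?_
      exact DFunLike.congr_fun (LinearMap.congr_fun hφ j) m
    let k := QuotientAddGroup.lift (map (LinearMap.id : N →ₗ[Rᵐᵒᵖ] N) b).ker (lift e he φ) (by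
      intro t ht
      obtain ⟨s, rfl⟩ := (h t).1 ht
      exact DFunLike.congr_fun h1 s)
    obtain ⟨ψ, hψ⟩ := StarDual.exists_extension
      (QuotientAddGroup.kerLift (map (LinearMap.id : N →ₗ[Rᵐᵒᵖ] N) b))
      (QuotientAddGroup.kerLift_injective _) k
    refine ⟨curry e he ψ, LinearMap.ext fun j => StarDual.ext fun m => ?_⟩
    exact (hψ (tmul R (e j) m : BalancedTensor R N M₂)).trans (lift_tmul e he φ j m)
  · intro h t
    constructor
    · intro ht
      by_contra ht'
      obtain ⟨χ, hχ, hχt⟩ := StarDual.exists_character_of_notMem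
        (map (LinearMap.id : N →ₗ[Rᵐᵒᵖ] N) a).range ht'
      obtain ⟨ψ, hψ⟩ := h (curry e he (χ : BalancedTensor R N M₂ →+ AddCircle (1 : ℚ)))
        (LinearMap.ext fun j => StarDual.ext fun m => hχ _ ⟨tmul R (e j) m, rfl⟩)
      have key : (χ : BalancedTensor R N M₂ →+ AddCircle (1 : ℚ)) =
          (lift e he ψ).comp (map LinearMap.id b) := hom_ext fun n m => by
        obtain ⟨j, rfl⟩ := e.surjective n
        refine (DFunLike.congr_fun (LinearMap.congr_fun hψ j) m).symm.trans ?_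
        exact (lift_tmul e he ψ j (b m)).symm
      refine hχt ((DFunLike.congr_fun key t).trans ?_)
      exact (congrArg _ ht).trans (map_zero (lift e he ψ))
    · rintro ⟨s, rfl⟩
      have : (map (LinearMap.id : N →ₗ[Rᵐᵒᵖ] N) b).comp (map LinearMap.id a) = 0 :=
        hom_ext fun n m => by
          change tmul R n (b (a m)) = 0
          rw [hab]
          exact (add_eq_left (a := tmul R n (0 : M₃))).1 (by rw [← tmul_add, add_zero])
      exact DFunLike.congr_fun this s

end Pairings

/-! ### Gorenstein flat modules -/

section Flat

open Abelian Limits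

variable {R : Type u} [Ring R] [StarRing R]

/-- The character module as an object of the category of `R`-modules. -/
abbrev dual (M : ModuleCat.{u} R) : ModuleCat.{u} R := ModuleCat.of R (StarDual M)

lemma isFlat_iff_injective_dual (M : ModuleCat.{u} R) : IsFlat R M ↔ Injective (dual M) :=
  (isFlat_iff M).trans (Module.injective_iff_injective_object R _)

lemma isFlat_of_projective (P : ModuleCat.{u} R) (hP : Projective P) : IsFlat R P := by
  have := projective_module P
  exact (isFlat_iff P).2 (injective_starDual_of_projective P)

lemma IsSES.dual {X Y Z : ModuleCat.{u} R} (h : IsSES X Y Z) :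
    IsSES (dual Z) (dual Y) (dual X) := by
  obtain ⟨f, g, hf, hfg, hg⟩ := h.exists_linearMap
  exact IsSES.of_linearMap (StarDual.map g) (StarDual.map f) (StarDual.map_injective g hg)
    (StarDual.map_exact f g hfg) (StarDual.map_surjective f hf)

/-- Dualization of a retract. -/
def dualRetract {X Y : ModuleCat.{u} R} (r : Retract X Y) : Retract (dual X) (dual Y) where
  i := ModuleCat.ofHom (StarDual.map r.r.hom)
  r := ModuleCat.ofHom (StarDual.map r.i.hom)
  retract := by
    refine ModuleCat.hom_ext (LinearMap.ext fun χ => StarDual.ext fun x => ?_)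
    have : r.r (r.i x) = x := ConcreteCategory.congr_hom r.retract x
    exact congrArg χ this

/-- `Ext¹(L, W^∨)` and `Ext¹(W, L^∨)` are both the character module of the same `Tor`. -/
lemma ext_dual_comm (L W : ModuleCat.{u} R) (h : Subsingleton (Ext L (dual W) 1)) :
    Subsingleton (Ext W (dual L) 1) := by
  obtain ⟨K, P, hP, hs⟩ := exists_link_projective W
  obtain ⟨i, p, hi, hip, hp⟩ := hs.exists_linearMap
  obtain ⟨w, hs⟩ := IsSES.hom (ModuleCat.ofHom i) (ModuleCat.ofHom p) hi hip hp
  obtain ⟨w', hs'⟩ := IsSES.hom (X := dual W) (Y := dual P) (Z := dual K)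
    (ModuleCat.ofHom (StarDual.map p)) (ModuleCat.ofHom (StarDual.map i))
    (StarDual.map_injective p hp) (StarDual.map_exact i p hip) (StarDual.map_surjective i hi)
  refine ext_of_exists_extension hs (ext_projective _ _ 0) fun f => ?_
  obtain ⟨g, hg⟩ := exists_lift_of_ext hs' h (ModuleCat.ofHom (StarDual.swap f.hom))
  refine ⟨ModuleCat.ofHom (StarDual.swap g.hom), ?_⟩
  refine ModuleCat.hom_ext (LinearMap.ext fun k => StarDual.ext fun l => ?_)
  exact DFunLike.congr_fun (ConcreteCategory.congr_hom hg l) k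

/-- Gorenstein flat modules in terms of spliced short exact sequences. -/
lemma isGorensteinFlat_iff (M : ModuleCat.{u} R) :
    IsGorensteinFlat R M ↔ ∃ Z : ℤ → ModuleCat.{u} R, Nonempty (M ≅ Z 0) ∧
      (∀ n, Link (IsFlat R) (Z n) (Z (n + 1))) ∧
      ∀ n (I : ModuleCat.{u} R), Injective I → Subsingleton (Ext I (dual (Z n)) 1) := by
  have hdual : ∀ {K : CochainComplex (ModuleCat.{u} R) ℤ} (D : CycleData K) (n : ℤ),
      ∃ w, (ShortComplex.mk (X₁ := dual (D.Z (n + 1))) (X₂ := dual (K.X n)) (X₃ := dual (D.Z n))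
        (ModuleCat.ofHom (StarDual.map (D.p n).hom))
        (ModuleCat.ofHom (StarDual.map (D.i n).hom)) w).ShortExact := fun D n =>
    IsSES.hom _ _ (StarDual.map_injective _ (D.p_surjective n))
      (StarDual.map_exact (D.i n).hom (D.p n).hom (D.fun_exact n))
      (StarDual.map_surjective _ (D.i_injective n))
  have hdd : ∀ {K : CochainComplex (ModuleCat.{u} R) ℤ} (D : CycleData K) (n : ℤ) (x : K.X n),
      (K.d (n + 1) (n + 1 + 1)).hom ((K.d n (n + 1)).hom x) = 0 := fun D n x =>
    (D.d_eq_zero_iff _ _).2 ⟨_, (D.d_apply n x).symm⟩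
  constructor
  · rintro ⟨K, hP, hK, hI, ⟨e⟩⟩
    let D := CycleData.ofAcyclic hK
    refine ⟨D.Z, ⟨e.toModuleIso⟩, fun n => ⟨_, hP n, D.isSES n⟩, fun n I hI' => ?_⟩
    obtain ⟨k, rfl⟩ : ∃ k, n = k + 1 + 1 + 1 := ⟨n - 3, by ring⟩
    obtain ⟨w, hs⟩ := hdual D (k + 1 + 1)
    have := (isFlat_iff_injective_dual _).1 (hP (k + 1 + 1))
    refine ext_of_exists_lift hs (ext_injective _ _ 0) fun f => ?_
    have := injective_module I
    have := injective_rightOf (R := R) I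
    have h1 : ∀ l, l = k + 1 - 1 → Function.Exact
        (BalancedTensor.map (LinearMap.id : RightOf I →ₗ[Rᵐᵒᵖ] RightOf I) (K.d l (k + 1)).hom)
        (BalancedTensor.map LinearMap.id (K.d (k + 1) (k + 1 + 1)).hom) := by
      rintro _ rfl
      exact hI (ModuleCat.of _ (RightOf I))
        ((Module.injective_iff_injective_object _ _).1 this) (k + 1)
    obtain ⟨ψ, hψ⟩ := (BalancedTensor.exact_iff (RightOf.equiv I) (RightOf.equiv_star_smul I)
      (K.d k (k + 1)).hom (K.d (k + 1) (k + 1 + 1)).hom (hdd D k)).1 (h1 k (by ring))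
      (StarDual.map (D.p (k + 1)).hom ∘ₗ f.hom) (by
        ext i : 1
        refine StarDual.ext fun x => ?_
        change f i (D.p (k + 1) (K.d k (k + 1) x)) = 0
        rw [D.d_apply, (D.fun_exact (k + 1)).apply_apply_eq_zero, map_zero])
    refine ⟨ModuleCat.ofHom ψ, ?_⟩
    ext i : 2
    refine StarDual.ext fun z => ?_
    obtain ⟨x, rfl⟩ := D.p_surjective (k + 1) z
    change ψ i (D.i (k + 1 + 1) (D.p (k + 1) x)) = f i (D.p (k + 1) x)
    rw [← D.d_apply]
    exact DFunLike.congr_fun (LinearMap.congr_fun hψ i) x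
  · rintro ⟨Z, ⟨e⟩, hZ, hI⟩
    obtain ⟨K, D, rfl, hP⟩ := exists_cycleData Z hZ
    refine ⟨K, hP, D.acyclic, fun N hN n => ?_, ⟨e.toLinearEquiv ≪≫ₗ D.kerEquiv 0⟩⟩
    suffices H : ∀ k, k = n - 1 → Function.Exact
        (BalancedTensor.map (LinearMap.id : N →ₗ[Rᵐᵒᵖ] N) (K.d k n).hom)
        (BalancedTensor.map LinearMap.id (K.d n (n + 1)).hom) from H _ rfl
    intro k hk
    obtain rfl : n = k + 1 := by omega
    refine (BalancedTensor.exact_iff (LeftOf.equiv N) (LeftOf.equiv_star_smul N)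
      (K.d k (k + 1)).hom (K.d (k + 1) (k + 1 + 1)).hom (hdd D k)).2 fun φ hφ => ?_
    have := injective_module N
    have hNl := injective_leftOf (R := R) N
    obtain ⟨w, hs⟩ := hdual D (k + 1)
    obtain ⟨w', hs'⟩ := hdual D (k + 1 + 1)
    have := hs.mono_f
    -- `φ` vanishes on cycles, hence factors through the next cycle module.
    let φ' : ModuleCat.of R (LeftOf N) ⟶ dual (K.X (k + 1)) := ModuleCat.ofHom φ
    have h0 : φ' ≫ ModuleCat.ofHom (StarDual.map (D.i (k + 1)).hom) = 0 := by
      ext j : 2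
      refine StarDual.ext fun z => ?_
      obtain ⟨x, rfl⟩ := D.p_surjective k z
      change φ j (D.i (k + 1) (D.p k x)) = 0
      rw [← D.d_apply]
      exact DFunLike.congr_fun (LinearMap.congr_fun hφ j) x
    obtain ⟨ψ, hψ⟩ := exists_lift_of_ext hs' (hI (k + 1 + 1 + 1) (ModuleCat.of R (LeftOf N))
      ((Module.injective_iff_injective_object _ _).1 hNl)) (hs.exact.lift φ' h0)
    refine ⟨ψ.hom, ?_⟩
    ext j : 1
    refine StarDual.ext fun x => ?_
    change ψ j (K.d (k + 1) (k + 1 + 1) x) = φ j x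
    rw [D.d_apply]
    refine (DFunLike.congr_fun (ConcreteCategory.congr_hom hψ j) (D.p (k + 1) x)).trans ?_
    exact DFunLike.congr_fun (ConcreteCategory.congr_hom (hs.exact.lift_f φ' h0) j) x

lemma IsGorensteinFlat.ext_subsingleton {M I : ModuleCat.{u} R}
    (hM : IsGorensteinFlat R M) (hI : Injective I) (i : ℕ) :
    Subsingleton (Ext I (dual M) (i + 1)) := by
  obtain ⟨Z, ⟨e⟩, hZ, hext⟩ := (isGorensteinFlat_iff M).1 hM
  have key : ∀ i n, Subsingleton (Ext I (dual (Z n)) (i + 1)) := fun i => by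
    induction i with
    | zero => exact fun n => hext n I hI
    | succ i ih =>
      intro n
      obtain ⟨k, rfl⟩ : ∃ k, n = k + 1 := ⟨n - 1, by ring⟩
      obtain ⟨P, hP, hs⟩ := hZ k
      have := (isFlat_iff_injective_dual _).1 hP
      exact hs.dual.ext_left' (ih k) (ext_injective _ _ _)
  exact (dualRetract e.retract).ext_subsingleton_right (key i 0)

lemma HasResolution.ext_dual_subsingleton {𝓟 : ModuleCat.{u} R → Prop} {I : ModuleCat.{u} R}
    (h𝓟 : ∀ E, 𝓟 E → ∀ i, Subsingleton (Ext I (dual E) (i + 1))) {m : ℕ} {M : ModuleCat.{u} R}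
    (h : HasResolution 𝓟 m M) (i : ℕ) (hi : m ≤ i) : Subsingleton (Ext I (dual M) (i + 1)) := by
  induction h generalizing i with
  | zero M P hP e => exact (dualRetract e.symm.retract).ext_subsingleton_right (h𝓟 P hP i)
  | succ n K P M hP hK f g hf hfg hg ih =>
    obtain ⟨j, rfl⟩ : ∃ j, i = j + 1 := ⟨i - 1, by omega⟩
    exact (IsSES.of_linearMap f g hf hfg hg).dual.ext_left' (ih j (by omega)) (h𝓟 P hP (j + 1))

/-- The flat dimension, measured by the injective dimension of the character module. -/
lemma HasResolution.hasInjectiveDimensionLT_dual {n : ℕ} {M : ModuleCat.{u} R}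
    (h : HasResolution (IsFlat R) n M) : HasInjectiveDimensionLT (dual M) (n + 1) :=
  hasInjectiveDimensionLT_of_enoughProjectives _ _ fun I =>
    h.ext_dual_subsingleton (fun E hE i => by
      have := (isFlat_iff_injective_dual _).1 hE
      exact ext_injective _ _ _) n le_rfl

/-- The injective modules have flat dimension at most `m`; the flat dimension is measured by the
injective dimension of the character module. -/
def SfliLE (R : Type u) [Ring R] [StarRing R] (m : ℕ) : Prop :=
  ∀ I : ModuleCat.{u} R, Injective I → HasInjectiveDimensionLT (dual I) (m + 1)

lemma Syz.injective_dual_iff {m : ℕ} {M K : ModuleCat.{u} R} (h : Syz m M K) :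
    Injective (dual K) ↔ HasInjectiveDimensionLT (dual M) (m + 1) := by
  induction m generalizing M with
  | zero =>
    obtain ⟨e⟩ := h
    rw [injective_iff_hasInjectiveDimensionLT_one]
    exact ⟨fun _ => (dualRetract e.symm.retract).hasInjectiveDimensionLT 1,
      fun _ => (dualRetract e.retract).hasInjectiveDimensionLT 1⟩
  | succ m ih =>
    obtain ⟨K₁, ⟨P, hP, hs⟩, h⟩ := h
    obtain ⟨i, p, w, hs⟩ := hs.dual
    rw [ih h]
    exact hs.hasInjectiveDimensionLT_X₃_iff m
      ((isFlat_iff_injective_dual _).1 (isFlat_of_projective P hP))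

lemma ext_splice_flat {m : ℕ} (hR : SfliLE R m) {Z : ℤ → ModuleCat.{u} R}
    (hZ : ∀ n, Link (IsFlat R) (Z n) (Z (n + 1))) {I : ModuleCat.{u} R} (hI : Injective I) (n : ℤ) :
    Subsingleton (Ext I (dual (Z n)) 1) := by
  have key : ∀ j : ℕ, (∀ n, Subsingleton (Ext I (dual (Z n)) (j + 1))) →
      ∀ n, Subsingleton (Ext I (dual (Z n)) 1) := fun j => by
    induction j with
    | zero => exact id
    | succ j ih =>
      refine fun h => ih fun n => ?_
      obtain ⟨P, hP, hs⟩ := hZ n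
      have := (isFlat_iff_injective_dual _).1 hP
      exact hs.dual.ext_right' (ext_injective _ _ _) (h (n + 1))
  refine key m (fun n => ?_) n
  obtain ⟨L, hL⟩ := Syz.exists_right m I
  have := hL.injective_dual_iff.2 (hR I hI)
  rw [add_comm]
  have h0 := (hL.ext_iff (dual (Z n)) 0).1 (ext_dual_comm _ _ (ext_injective _ _ 0))
  rwa [zero_add] at h0

lemma Syz.isGorensteinFlat {m : ℕ} (hR : SfliLE R m) {M K : ModuleCat.{u} R}
    (h : Syz m M K) : IsGorensteinFlat R K := by
  obtain ⟨Z, rfl, -, hZ⟩ := exists_splice_of_syz (𝓟 := IsFlat R) m isFlat_of_projective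
    (fun I L hI hL => (isFlat_iff_injective_dual _).2 (hL.injective_dual_iff.2 (hR I hI))) h
  exact (isGorensteinFlat_iff _).2
    ⟨Z, ⟨Iso.refl _⟩, hZ, fun n I hI => ext_splice_flat hR hZ hI n⟩

theorem Gfd_le {m : ℕ} (hR : SfliLE R m) (M : ModuleCat.{u} R) : Gfd R M ≤ m := by
  obtain ⟨K, hK⟩ := Syz.exists_right m M
  refine resolutionDim_le (hasResolution_of_syz (fun P hP => ?_) hK (hK.isGorensteinFlat hR))
  obtain ⟨N, hN⟩ := Syz.exists_of_projective m P hP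
  exact hN.isGorensteinFlat hR

/-- If all modules have finite Gorenstein flat dimension, then the flat dimensions of the injective
modules are bounded: the product of test modules of growing degrees would violate finiteness. -/
theorem exists_sfliLE_of_Gfd (h : ∀ M : ModuleCat.{u} R, Gfd R M < ⊤) : ∃ m, SfliLE R m := by
  by_contra! H
  have H' : ∀ k, ∃ I Y : ModuleCat.{u} R, Injective I ∧
      ¬ Subsingleton (Ext I (dual Y) (k + 1)) := by
    intro k
    have hk := H k
    simp only [SfliLE, not_forall] at hk
    obtain ⟨I, hI, hI'⟩ := hk
    by_contra! h0
    obtain ⟨L, hL⟩ := Syz.exists_right k I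
    refine hI' (hL.injective_dual_iff.1 (injective_iff_subsingleton_ext_one.2 fun Y => ?_))
    refine ext_dual_comm _ _ ((hL.ext_iff (dual Y) 0).2 ?_)
    have := h0 I Y hI
    rwa [zero_add, add_comm]
  choose I Y hI hY using H'
  obtain ⟨m, hm⟩ := exists_of_resolutionDim_lt (h (∏ᶜ Y))
  exact hY m ((dualRetract (retractPi Y m)).ext_subsingleton_right
    (hm.ext_dual_subsingleton (fun E hE => hE.ext_subsingleton (hI m)) m le_rfl))

end Flat

/-! ### Diagonal actions of groups on tensor products -/

section Diagonal

variable {A : Type u} [CommRing A] {G : Type u} [Group G]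

/-- The involution of a group algebra with `g ↦ g⁻¹`. -/
@[reducible] def groupStar (A : Type u) [CommRing A] (G : Type u) [Group G] :
    StarRing (MonoidAlgebra A G) :=
  let σ : MonoidAlgebra A G →ₐ[A] (MonoidAlgebra A G)ᵐᵒᵖ := MonoidAlgebra.lift A _ G
    { toFun := fun g => MulOpposite.op (MonoidAlgebra.of A G g⁻¹)
      map_one' := by rw [inv_one, map_one, MulOpposite.op_one]
      map_mul' := fun g h => by rw [mul_inv_rev, map_mul, MulOpposite.op_mul] }
  have hσ : ∀ g, σ (MonoidAlgebra.of A G g) = MulOpposite.op (MonoidAlgebra.of A G g⁻¹) :=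
    fun g => MonoidAlgebra.lift_of _ g
  { star := fun x => (σ x).unop
    star_involutive := fun x => by
      change (σ (σ x).unop).unop = x
      induction x using MonoidAlgebra.induction_on with
      | of g => rw [hσ, MulOpposite.unop_op, hσ, MulOpposite.unop_op, inv_inv]
      | add x y hx hy =>
        rw [map_add, MulOpposite.unop_add, map_add, MulOpposite.unop_add, hx, hy]
      | smul r x hx => rw [map_smul, MulOpposite.unop_smul, map_smul, MulOpposite.unop_smul, hx]
    star_mul := fun x y => by
      change (σ (x * y)).unop = _
      rw [map_mul, MulOpposite.unop_mul]
    star_add := fun x y => by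
      change (σ (x + y)).unop = _
      rw [map_add, MulOpposite.unop_add] }

attribute [local instance] groupStar

lemma star_of (g : G) : star (MonoidAlgebra.of A G g) = MonoidAlgebra.of A G g⁻¹ :=
  congrArg MulOpposite.unop (MonoidAlgebra.lift_of _ g)

lemma star_algebraMap (a : A) :
    star (algebraMap A (MonoidAlgebra A G) a) = algebraMap A (MonoidAlgebra A G) a :=
  congrArg MulOpposite.unop (AlgHom.commutes (MonoidAlgebra.lift A (MonoidAlgebra A G)ᵐᵒᵖ G _) a)

/-- An additive map between `AG`-modules that commutes with `A` and with `G` is linear. -/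
def equivariant {X Y : Type u} [AddCommGroup X] [Module (MonoidAlgebra A G) X] [AddCommGroup Y]
    [Module (MonoidAlgebra A G) Y] (f : X →+ Y)
    (hA : ∀ (a : A) x, f (algebraMap A (MonoidAlgebra A G) a • x) =
      algebraMap A (MonoidAlgebra A G) a • f x)
    (hG : ∀ (g : G) x, f (MonoidAlgebra.of A G g • x) = MonoidAlgebra.of A G g • f x) :
    X →ₗ[MonoidAlgebra A G] Y where
  toFun := f
  map_add' := f.map_add
  map_smul' r x := by
    rw [RingHom.id_apply]
    induction r using MonoidAlgebra.induction_on generalizing x with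
    | of g => exact hG g x
    | add r s hr hs => rw [add_smul, map_add, hr, hs, add_smul]
    | smul a r hr => rw [Algebra.smul_def, mul_smul, hA, hr, mul_smul]

/-- An `AG`-module as an `A`-module. -/
@[reducible] def baseModule (X : ModuleCat.{u} (MonoidAlgebra A G)) : Module A X :=
  Module.compHom X (algebraMap A (MonoidAlgebra A G))

attribute [local instance] baseModule

lemma isScalarTower_base (X : ModuleCat.{u} (MonoidAlgebra A G)) :
    IsScalarTower A (MonoidAlgebra A G) X :=
  ⟨fun a r x => by rw [Algebra.smul_def, mul_smul]; rfl⟩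

attribute [local instance] isScalarTower_base

lemma asModule_of_smul {V : Type u} [AddCommGroup V] [Module A V] (ρ : Representation A G V)
    (g : G) (v : ρ.asModule) : MonoidAlgebra.of A G g • v = (ρ g (ρ.asModuleEquiv v) : V) :=
  (ρ.asModuleEquiv_symm_map_rho g (ρ.asModuleEquiv v)).symm

lemma asModule_algebraMap_smul {V : Type u} [AddCommGroup V] [Module A V]
    (ρ : Representation A G V) (a : A) (v : ρ.asModule) :
    algebraMap A (MonoidAlgebra A G) a • v = (a • ρ.asModuleEquiv v : V) :=
  (ρ.asModuleEquiv_symm_map_smul a (ρ.asModuleEquiv v)).symm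

/-- The representation on an `AG`-module. -/
abbrev rep (X : ModuleCat.{u} (MonoidAlgebra A G)) : Representation A G X :=
  Representation.ofModule' X

/-- The tensor product over `A` with the diagonal action of `G`. -/
def diag (X M : ModuleCat.{u} (MonoidAlgebra A G)) : ModuleCat.{u} (MonoidAlgebra A G) :=
  ModuleCat.of _ ((rep X).tprod (rep M)).asModule

/-- The `A`-linear maps from `X` to `Y`, on which `g` acts by `φ ↦ g φ g⁻¹`. -/
def homDiag (X Y : ModuleCat.{u} (MonoidAlgebra A G)) : ModuleCat.{u} (MonoidAlgebra A G) :=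
  ModuleCat.of _ (Representation.linHom (rep X) (rep Y)).asModule

/-- The identity map, from the tensor product to its copy with the diagonal action. -/
def diagEquiv (X M : ModuleCat.{u} (MonoidAlgebra A G)) : X ⊗[A] M ≃+ diag X M :=
  AddEquiv.refl (X ⊗[A] M)

/-- The pure tensor `x ⊗ m` in `diag X M`. -/
def diagTmul {X M : ModuleCat.{u} (MonoidAlgebra A G)} (x : X) (m : M) : diag X M :=
  diagEquiv X M (x ⊗ₜ[A] m)

lemma add_diagTmul {X M : ModuleCat.{u} (MonoidAlgebra A G)} (x x' : X) (m : M) :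
    diagTmul (x + x') m = diagTmul x m + diagTmul x' m :=
  congrArg (diagEquiv X M) (TensorProduct.add_tmul x x' m)

lemma diagTmul_add {X M : ModuleCat.{u} (MonoidAlgebra A G)} (x : X) (m m' : M) :
    diagTmul x (m + m') = diagTmul x m + diagTmul x m' :=
  congrArg (diagEquiv X M) (TensorProduct.tmul_add x m m')

lemma diagTmul_smul {X M : ModuleCat.{u} (MonoidAlgebra A G)} (a : A) (x : X) (m : M) :
    diagTmul x (a • m) = diagTmul (a • x) m :=
  congrArg (diagEquiv X M) (TensorProduct.smul_tmul a x m).symm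

lemma of_smul_diagTmul {X M : ModuleCat.{u} (MonoidAlgebra A G)} (g : G) (x : X) (m : M) :
    MonoidAlgebra.of A G g • diagTmul x m =
      diagTmul (MonoidAlgebra.of A G g • x) (MonoidAlgebra.of A G g • m) :=
  asModule_of_smul ((rep X).tprod (rep M)) g (x ⊗ₜ[A] m : X ⊗[A] M)

lemma algebraMap_smul_diagTmul {X M : ModuleCat.{u} (MonoidAlgebra A G)} (a : A) (x : X) (m : M) :
    algebraMap A (MonoidAlgebra A G) a • diagTmul x m = diagTmul (a • x) m :=
  asModule_algebraMap_smul ((rep X).tprod (rep M)) a (x ⊗ₜ[A] m : X ⊗[A] M)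

lemma diag_induction {X M : ModuleCat.{u} (MonoidAlgebra A G)} {p : diag X M → Prop} (t : diag X M)
    (zero : p 0) (tmul : ∀ x m, p (diagTmul x m)) (add : ∀ s t, p s → p t → p (s + t)) : p t := by
  obtain ⟨t, rfl⟩ := (diagEquiv X M).surjective t
  induction t using TensorProduct.induction_on with
  | zero => exact zero
  | tmul x m => exact tmul x m
  | add s t hs ht =>
    rw [map_add]
    exact add _ _ hs ht

/-- Linear maps out of `diag X M`. -/
def diagLift {X M : ModuleCat.{u} (MonoidAlgebra A G)} {Y : Type u} [AddCommGroup Y]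
    [Module (MonoidAlgebra A G) Y] (f : X →+ M →+ Y)
    (hl : ∀ (a : A) x m, f (a • x) m = algebraMap A (MonoidAlgebra A G) a • f x m)
    (hr : ∀ (a : A) x m, f x (a • m) = algebraMap A (MonoidAlgebra A G) a • f x m)
    (hG : ∀ (g : G) x m, f (MonoidAlgebra.of A G g • x) (MonoidAlgebra.of A G g • m) =
      MonoidAlgebra.of A G g • f x m) : diag X M →ₗ[MonoidAlgebra A G] Y :=
  equivariant (X := diag X M)
    ((TensorProduct.liftAddHom (R := A) f fun a x m => (hl a x m).trans (hr a x m).symm).comp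
      (diagEquiv X M).symm.toAddMonoidHom)
    (fun a t => by
      induction t using diag_induction with
      | zero => rw [smul_zero, map_zero, smul_zero]
      | tmul x m =>
        rw [algebraMap_smul_diagTmul]
        exact hl a x m
      | add s t hs ht => rw [smul_add, map_add, map_add, smul_add, hs, ht])
    (fun g t => by
      induction t using diag_induction with
      | zero => rw [smul_zero, map_zero, smul_zero]
      | tmul x m =>
        rw [of_smul_diagTmul]
        exact hG g x m
      | add s t hs ht => rw [smul_add, map_add, map_add, smul_add, hs, ht])

end Diagonal

section Diagonal

variable {A : Type u} [CommRing A] {G : Type u} [Group G]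

attribute [local instance] groupStar baseModule isScalarTower_base

/-- The tensor product of two linear maps. -/
def diagMap {X X' M M' : ModuleCat.{u} (MonoidAlgebra A G)} (f : X →ₗ[MonoidAlgebra A G] X')
    (g : M →ₗ[MonoidAlgebra A G] M') : diag X M →ₗ[MonoidAlgebra A G] diag X' M' :=
  equivariant ((diagEquiv X' M').toAddMonoidHom.comp
      ((TensorProduct.map (f.restrictScalars A) (g.restrictScalars A)).toAddMonoidHom.comp
        (diagEquiv X M).symm.toAddMonoidHom))
    (fun a t => by
      induction t using diag_induction with
      | zero => rw [smul_zero, map_zero, smul_zero]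
      | tmul x m =>
        change _ = algebraMap A (MonoidAlgebra A G) a • diagTmul (f x) (g m)
        rw [algebraMap_smul_diagTmul, algebraMap_smul_diagTmul]
        change diagTmul ((f.restrictScalars A) (a • x)) (g m) = _
        rw [map_smul]
        rfl
      | add s t hs ht => rw [smul_add, map_add, map_add, smul_add, hs, ht])
    (fun a t => by
      induction t using diag_induction with
      | zero => rw [smul_zero, map_zero, smul_zero]
      | tmul x m =>
        change _ = MonoidAlgebra.of A G a • diagTmul (f x) (g m)
        rw [of_smul_diagTmul, of_smul_diagTmul]
        change diagTmul (f (MonoidAlgebra.of A G a • x)) (g (MonoidAlgebra.of A G a • m)) = _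
        rw [map_smul, map_smul]
      | add s t hs ht => rw [smul_add, map_add, map_add, smul_add, hs, ht])

lemma diagMap_injective {X X' M : ModuleCat.{u} (MonoidAlgebra A G)} [Module.Flat A M]
    (f : X →ₗ[MonoidAlgebra A G] X') (hf : Function.Injective f) :
    Function.Injective (diagMap f (LinearMap.id : M →ₗ[MonoidAlgebra A G] M)) :=
  Module.Flat.rTensor_preserves_injective_linearMap (M := M) (f.restrictScalars A) hf

lemma diag_isSES_left {X X' X'' : ModuleCat.{u} (MonoidAlgebra A G)} (h : IsSES X X' X'')
    (M : ModuleCat.{u} (MonoidAlgebra A G)) [Module.Flat A M] :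
    IsSES (diag X M) (diag X' M) (diag X'' M) := by
  obtain ⟨f, g, hf, hfg, hg⟩ := h.exists_linearMap
  exact IsSES.of_linearMap (diagMap f LinearMap.id) (diagMap g LinearMap.id)
    (diagMap_injective f hf)
    (rTensor_exact M (f := f.restrictScalars A) (g := g.restrictScalars A) hfg hg)
    (LinearMap.rTensor_surjective M (g := g.restrictScalars A) hg)

lemma diag_isSES_right {M M' M'' : ModuleCat.{u} (MonoidAlgebra A G)} (h : IsSES M M' M'')
    (X : ModuleCat.{u} (MonoidAlgebra A G)) [Module.Flat A M''] :
    IsSES (diag X M) (diag X M') (diag X M'') := by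
  obtain ⟨f, g, hf, hfg, hg⟩ := h.exists_linearMap
  exact IsSES.of_linearMap (diagMap LinearMap.id f) (diagMap LinearMap.id g)
    (LinearMap.lTensor_injective_of_exact_of_flat (g.restrictScalars A) hg (f.restrictScalars A)
      hf hfg X)
    (lTensor_exact X (f := f.restrictScalars A) (g := g.restrictScalars A) hfg hg)
    (LinearMap.lTensor_surjective X (g := g.restrictScalars A) hg)

lemma flat_of_isSES {M M' M'' : ModuleCat.{u} (MonoidAlgebra A G)} (h : IsSES M M' M'')
    [Module.Flat A M'] [Module.Flat A M''] : Module.Flat A M := by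
  obtain ⟨f, g, hf, hfg, hg⟩ := h.exists_linearMap
  refine Module.Flat.iff_lTensor_preserves_injective_linearMap.2 fun N N' _ _ _ _ j hj => ?_
  have h1 : Function.Injective ((f.restrictScalars A).rTensor N) := by
    have := LinearMap.lTensor_injective_of_exact_of_flat (g.restrictScalars A) hg
      (f.restrictScalars A) hf hfg N
    rwa [LinearMap.lTensor_inj_iff_rTensor_inj] at this
  have h2 := (Module.Flat.lTensor_preserves_injective_linearMap (M := M') j hj).comp h1
  have h3 : (j.lTensor M') ∘ₗ ((f.restrictScalars A).rTensor N) =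
      ((f.restrictScalars A).rTensor N') ∘ₗ (j.lTensor M) := by
    rw [LinearMap.lTensor_comp_rTensor, LinearMap.rTensor_comp_lTensor]
  rw [← LinearMap.coe_comp, h3] at h2
  exact Function.Injective.of_comp h2

instance : Module.Free A (MonoidAlgebra A G) := Module.Free.of_basis (MonoidAlgebra.basis G A)

lemma projective_base (P : ModuleCat.{u} (MonoidAlgebra A G)) (hP : Projective P) :
    Module.Projective A P := by
  obtain ⟨s, hs⟩ := Module.projective_def'.1 (projective_module P)
  exact Module.Projective.of_split (s.restrictScalars A)
    ((Finsupp.linearCombination (MonoidAlgebra A G) (id : P → P)).restrictScalars A)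
    (LinearMap.ext fun x => LinearMap.congr_fun hs x)

lemma injective_base (I : ModuleCat.{u} (MonoidAlgebra A G)) (hI : Injective I) :
    Module.Injective A I where
  out X Y _ _ _ _ f hf g := by
    have := injective_module I
    let b : MonoidAlgebra A G →ₗ[MonoidAlgebra A G] X →ₗ[A] I :=
      LinearMap.toSpanSingleton (MonoidAlgebra A G) (X →ₗ[A] I) g
    -- Extend the scalars to the group algebra.
    obtain ⟨h, hh⟩ := this.out (TensorProduct.AlgebraTensorModule.map
      (LinearMap.id : MonoidAlgebra A G →ₗ[MonoidAlgebra A G] MonoidAlgebra A G) f)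
      (Module.Flat.lTensor_preserves_injective_linearMap (M := MonoidAlgebra A G) f hf)
      (TensorProduct.AlgebraTensorModule.lift b)
    refine ⟨h.restrictScalars A ∘ₗ TensorProduct.mk A (MonoidAlgebra A G) Y 1, fun x => ?_⟩
    refine (hh (1 ⊗ₜ x)).trans ?_
    change (1 : MonoidAlgebra A G) • g x = g x
    rw [one_smul]

/-! #### Linear maps with the diagonal action -/

/-- The identity map, from the `A`-linear maps to their copy with the action of `G`. -/
def homDiagEquiv (X Y : ModuleCat.{u} (MonoidAlgebra A G)) : (X →ₗ[A] Y) ≃+ homDiag X Y :=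
  AddEquiv.refl (X →ₗ[A] Y)

lemma of_smul_homDiag {X Y : ModuleCat.{u} (MonoidAlgebra A G)} (g : G) (φ : X →ₗ[A] Y) :
    MonoidAlgebra.of A G g • homDiagEquiv X Y φ = homDiagEquiv X Y (rep Y g ∘ₗ φ ∘ₗ rep X g⁻¹) :=
  asModule_of_smul (Representation.linHom (rep X) (rep Y)) g φ

lemma algebraMap_smul_homDiag {X Y : ModuleCat.{u} (MonoidAlgebra A G)} (a : A) (φ : X →ₗ[A] Y) :
    algebraMap A (MonoidAlgebra A G) a • homDiagEquiv X Y φ = homDiagEquiv X Y (a • φ) :=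
  asModule_algebraMap_smul (Representation.linHom (rep X) (rep Y)) a φ

lemma projective_diag (X P : ModuleCat.{u} (MonoidAlgebra A G)) [Module.Projective A X]
    (hP : Projective P) : Projective (diag X P) where
  factors {Y' Y} f e he := by
    have := projective_module P
    have he' : Function.Surjective e := (ModuleCat.epi_iff_surjective e).1 he
    let E : homDiag X Y' →ₗ[MonoidAlgebra A G] homDiag X Y := equivariant
      ((homDiagEquiv X Y).toAddMonoidHom.comp
        ((LinearMap.compRight A (e.hom.restrictScalars A)).toAddMonoidHom.comp
          (homDiagEquiv X Y').symm.toAddMonoidHom))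
      (fun a φ => by
        obtain ⟨φ, rfl⟩ := (homDiagEquiv X Y').surjective φ
        rw [algebraMap_smul_homDiag]
        change homDiagEquiv X Y ((e.hom.restrictScalars A) ∘ₗ (a • φ)) =
          algebraMap A (MonoidAlgebra A G) a • homDiagEquiv X Y ((e.hom.restrictScalars A) ∘ₗ φ)
        rw [algebraMap_smul_homDiag, LinearMap.comp_smul])
      (fun g φ => by
        obtain ⟨φ, rfl⟩ := (homDiagEquiv X Y').surjective φ
        rw [of_smul_homDiag]
        change homDiagEquiv X Y ((e.hom.restrictScalars A) ∘ₗ (rep Y' g ∘ₗ φ ∘ₗ rep X g⁻¹)) =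
          MonoidAlgebra.of A G g • homDiagEquiv X Y ((e.hom.restrictScalars A) ∘ₗ φ)
        rw [of_smul_homDiag]
        refine congrArg _ (LinearMap.ext fun x => ?_)
        exact map_smul e.hom (MonoidAlgebra.of A G g) _)
    have hE : Function.Surjective E := fun φ => by
      obtain ⟨ψ, hψ⟩ := Module.projective_lifting_property (e.hom.restrictScalars A)
        ((homDiagEquiv X Y).symm φ) he'
      exact ⟨homDiagEquiv X Y' ψ, (homDiagEquiv X Y).symm.injective hψ⟩
    let c (p : P) : X →ₗ[A] Y :=
      { toFun := fun x => f (diagTmul x p)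
        map_add' := fun x x' => by rw [add_diagTmul, map_add]
        map_smul' := fun a x => by
          rw [← algebraMap_smul_diagTmul, map_smul]
          rfl }
    let F : P →ₗ[MonoidAlgebra A G] homDiag X Y := equivariant
      (AddMonoidHom.mk' (fun p => homDiagEquiv X Y (c p)) fun p p' => by
        rw [← map_add]
        refine congrArg _ (LinearMap.ext fun x => ?_)
        change f (diagTmul x (p + p')) = f (diagTmul x p) + f (diagTmul x p')
        rw [diagTmul_add, map_add])
      (fun a p => by
        refine Eq.trans ?_ (algebraMap_smul_homDiag a (c p)).symm
        refine congrArg (homDiagEquiv X Y) (LinearMap.ext fun x => ?_)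
        change f (diagTmul x (a • p)) = algebraMap A (MonoidAlgebra A G) a • f (diagTmul x p)
        rw [diagTmul_smul, ← algebraMap_smul_diagTmul]
        exact map_smul f.hom _ _)
      (fun g p => by
        refine Eq.trans ?_ (of_smul_homDiag g (c p)).symm
        refine congrArg (homDiagEquiv X Y) (LinearMap.ext fun x => ?_)
        change f (diagTmul x (MonoidAlgebra.of A G g • p)) =
          MonoidAlgebra.of A G g • f (diagTmul (MonoidAlgebra.of A G g⁻¹ • x) p)
        refine Eq.trans ?_ (map_smul f.hom _ _)
        rw [of_smul_diagTmul, smul_smul, ← map_mul, mul_inv_cancel, map_one, one_smul])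
    obtain ⟨ψ, hψ⟩ := Module.projective_lifting_property E F hE
    refine ⟨ModuleCat.ofHom (diagLift
      (AddMonoidHom.flip (AddMonoidHom.mk' (fun p =>
        ((homDiagEquiv X Y').symm (ψ p)).toAddMonoidHom) fun p p' => by
          rw [map_add, map_add]; rfl))
      (fun a x p => map_smul ((homDiagEquiv X Y').symm (ψ p)) a x)
      (fun a x p => by
        have h := map_smul ψ (algebraMap A (MonoidAlgebra A G) a) p
        obtain ⟨φ, hφ⟩ := (homDiagEquiv X Y').surjective (ψ p)
        rw [← hφ, algebraMap_smul_homDiag] at h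
        change (homDiagEquiv X Y').symm (ψ (algebraMap A (MonoidAlgebra A G) a • p)) x =
          algebraMap A (MonoidAlgebra A G) a • (homDiagEquiv X Y').symm (ψ p) x
        rw [h, ← hφ]
        rfl)
      (fun g x p => by
        have h := map_smul ψ (MonoidAlgebra.of A G g) p
        obtain ⟨φ, hφ⟩ := (homDiagEquiv X Y').surjective (ψ p)
        rw [← hφ, of_smul_homDiag] at h
        change (homDiagEquiv X Y').symm (ψ (MonoidAlgebra.of A G g • p))
          (MonoidAlgebra.of A G g • x) =
          MonoidAlgebra.of A G g • (homDiagEquiv X Y').symm (ψ p) x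
        rw [h, ← hφ, AddEquiv.symm_apply_apply, AddEquiv.symm_apply_apply]
        change MonoidAlgebra.of A G g • φ (MonoidAlgebra.of A G g⁻¹ • MonoidAlgebra.of A G g • x) =
          _
        rw [smul_smul, ← map_mul, inv_mul_cancel, map_one, one_smul])), ?_⟩
    refine ModuleCat.hom_ext (LinearMap.ext fun t => ?_)
    induction t using diag_induction with
    | zero => rw [map_zero, map_zero]
    | tmul x p =>
      have h := congrArg (homDiagEquiv X Y).symm (LinearMap.congr_fun hψ p)
      exact LinearMap.congr_fun h x
    | add s t hs ht => rw [map_add, map_add, hs, ht]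

/-- A `G`-invariant trilinear form on `Y × X × M`, given as a map `Y ⊗ X → M^∨`, rotated into a map
`X ⊗ M → Y^∨`. -/
def rot {X Y M : ModuleCat.{u} (MonoidAlgebra A G)}
    (ψ : diag Y X →ₗ[MonoidAlgebra A G] StarDual M) :
    diag X M →ₗ[MonoidAlgebra A G] StarDual Y :=
  diagLift
    (AddMonoidHom.mk' (fun x => AddMonoidHom.mk' (fun m => StarDual.ofHom
      (AddMonoidHom.mk' (fun y => ψ (diagTmul y x) m) fun y y' => by
        rw [add_diagTmul, map_add]; rfl))
      fun m m' => StarDual.ext fun y => map_add (ψ (diagTmul y x)) m m')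
      fun x x' => AddMonoidHom.ext fun m => StarDual.ext fun y => by
        change ψ (diagTmul y (x + x')) m = ψ (diagTmul y x) m + ψ (diagTmul y x') m
        rw [diagTmul_add, map_add]; rfl)
    (fun a x m => StarDual.ext fun y => by
      rw [StarDual.smul_apply, star_algebraMap]
      change ψ (diagTmul y (a • x)) m = ψ (diagTmul (a • y) x) m
      rw [diagTmul_smul])
    (fun a x m => StarDual.ext fun y => by
      rw [StarDual.smul_apply, star_algebraMap]
      change ψ (diagTmul y x) (algebraMap A (MonoidAlgebra A G) a • m) = ψ (diagTmul (a • y) x) m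
      rw [← algebraMap_smul_diagTmul, map_smul ψ, StarDual.smul_apply, star_algebraMap])
    (fun g x m => StarDual.ext fun y => by
      rw [StarDual.smul_apply, star_of]
      change ψ (diagTmul y (MonoidAlgebra.of A G g • x)) (MonoidAlgebra.of A G g • m) =
        ψ (diagTmul (MonoidAlgebra.of A G g⁻¹ • y) x) m
      have h : diagTmul y (MonoidAlgebra.of A G g • x) =
          MonoidAlgebra.of A G g • diagTmul (MonoidAlgebra.of A G g⁻¹ • y) x := by
        rw [of_smul_diagTmul, smul_smul, ← map_mul, mul_inv_cancel, map_one, one_smul]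
      rw [h, map_smul ψ, StarDual.smul_apply, star_of, smul_smul, ← map_mul, inv_mul_cancel, map_one,
        one_smul])

lemma rot_apply {X Y M : ModuleCat.{u} (MonoidAlgebra A G)}
    (ψ : diag Y X →ₗ[MonoidAlgebra A G] StarDual M) (x : X) (y : Y) (m : M) :
    rot ψ (diagTmul x m) y = ψ (diagTmul y x) m := rfl

end Diagonal

/-! ### Dimensions of diagonal tensor products -/

section Diagonal

variable {A : Type u} [CommRing A] {G : Type u} [Group G]

attribute [local instance] groupStar baseModule isScalarTower_base starRingOfComm

lemma IsSES.restrict {X Y Z : ModuleCat.{u} (MonoidAlgebra A G)} (h : IsSES X Y Z) :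
    IsSES ((toBase A G).obj X) ((toBase A G).obj Y) ((toBase A G).obj Z) := by
  obtain ⟨f, g, hf, hfg, hg⟩ := h.exists_linearMap
  exact IsSES.of_linearMap (X := (toBase A G).obj X) (Y := (toBase A G).obj Y)
    (Z := (toBase A G).obj Z) (f.restrictScalars A) (g.restrictScalars A) hf hfg hg

lemma projective_toBase (P : ModuleCat.{u} (MonoidAlgebra A G)) (hP : Projective P) :
    Projective ((toBase A G).obj P) :=
  (IsProjective.iff_projective _).1 (projective_base P hP)

lemma injective_toBase (I : ModuleCat.{u} (MonoidAlgebra A G)) (hI : Injective I) :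
    Injective ((toBase A G).obj I) :=
  (Module.injective_iff_injective_object _ _).1 (injective_base I hI)

/-- Over a commutative ring, the character module of Mathlib is the one for the trivial
involution. -/
lemma flat_iff_injective_dual (X : ModuleCat.{u} A) : Module.Flat A X ↔ Injective (dual X) := by
  rw [Module.Flat.iff_characterModule_injective]
  exact Module.injective_iff_injective_object A (CharacterModule X)

/-- Dimension shifting in both variables of a diagonal tensor product: the dimension of `X ⊗ M`
over `AG`, measured by `DH`, is at most that of `X` over `A`, measured by `DA`, plus that of `M`
over `AG`. -/
theorem dimension_diag {DA DH : ℕ → ModuleCat.{u} (MonoidAlgebra A G) → Prop}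
    (hA : ∀ n X X', DA (n + 1) X → Link Projective X' X → DA n X')
    (hH : ∀ n X X', DH (n + 1) X → Link Projective X' X → DH n X')
    (hses : ∀ n X Y Z, IsSES X Y Z → DH n X → DH (n + 1) Y → DH (n + 1) Z)
    (hmono : ∀ n m X, n ≤ m → DH n X → DH m X)
    (hprojA : ∀ P, Projective P → DA 0 P) (hprojH : ∀ P, Projective P → DH 0 P)
    (hbase : ∀ X M, DA 0 X → DH 0 M → Module.Flat A M → DH 0 (diag X M)) (n k : ℕ)
    {X M : ModuleCat.{u} (MonoidAlgebra A G)} (hX : DA n X) (hM : DH k M)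
    (hflat : Module.Flat A M) : DH (n + k) (diag X M) := by
  have left : ∀ n X M, DA n X → DH 0 M → Module.Flat A M → DH n (diag X M) := fun n => by
    induction n with
    | zero => exact hbase
    | succ n ih =>
      intro X M hX hM hflat
      obtain ⟨X', hX'⟩ := exists_link_projective X
      have h := hA n X X' hX hX'
      obtain ⟨P, hP, hs⟩ := hX'
      exact hses n _ _ _ (diag_isSES_left hs M) (ih X' M h hM hflat)
        (hmono 0 _ _ (Nat.zero_le _) (hbase P M (hprojA P hP) hM hflat))
  induction k generalizing M with
  | zero => exact left n X M hX hM hflat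
  | succ k ih =>
    obtain ⟨M', hM'⟩ := exists_link_projective M
    have h := hH k M M' hM hM'
    obtain ⟨F, hF, hs⟩ := hM'
    have := projective_base F hF
    exact hses (n + k) _ _ _ (diag_isSES_right hs X) (ih h (flat_of_isSES hs))
      (hmono n _ _ (by omega) (left n X F hX (hprojH F hF) inferInstance))

/-- An invariant element of `N` that generates a pure copy of `A` embeds `X` into `X ⊗ N`. -/
lemma exists_diag_embedding {N : ModuleCat.{u} (MonoidAlgebra A G)} (ι : trivialModule A G ⟶ N)
    (hι : IsPureMono ((toBase A G).map ι)) (X : ModuleCat.{u} (MonoidAlgebra A G)) :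
    ∃ f : X ⟶ diag X N, Mono f := by
  let T : ModuleCat A := (toBase A G).obj (trivialModule A G)
  let one : trivialModule A G := (1 : A)
  have hone : ∀ g : G, MonoidAlgebra.of A G g • one = one := fun g => by
    change (MonoidAlgebra.lift A A G (1 : G →* A)) (MonoidAlgebra.of A G g) * (1 : A) = (1 : A)
    rw [MonoidAlgebra.lift_of, MonoidHom.one_apply, one_mul]
  let f : X →ₗ[MonoidAlgebra A G] diag X N := equivariant
    (AddMonoidHom.mk' (fun x => diagTmul x (ι one)) fun x y => add_diagTmul x y _)
    (fun a x => (algebraMap_smul_diagTmul a x (ι one)).symm)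
    (fun g x => by
      change diagTmul _ _ = MonoidAlgebra.of A G g • diagTmul x (ι one)
      rw [of_smul_diagTmul]
      refine congrArg (diagTmul _) ?_
      refine Eq.trans ?_ (map_smul ι.hom _ _)
      rw [hone])
  refine ⟨ModuleCat.ofHom f, (ModuleCat.mono_iff_injective _).2 ?_⟩
  let u : T →ₗ[A] A :=
    { toFun := fun t => t
      map_add' := fun _ _ => rfl
      map_smul' := fun a t => by
        change (MonoidAlgebra.lift A A G (1 : G →* A)).toRingHom
          (algebraMap A (MonoidAlgebra A G) a) * (show A from t) = a * (show A from t)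
        exact congrArg (· * (show A from t))
          (AlgHom.commutes (MonoidAlgebra.lift A A G (1 : G →* A)) a) }
  let one' : T := (1 : A)
  have h1 : Function.Injective fun x : (toBase A G).obj X => x ⊗ₜ[A] one' :=
    Function.LeftInverse.injective (f := fun x : (toBase A G).obj X => x ⊗ₜ[A] one')
      (g := fun t => TensorProduct.rid A ((toBase A G).obj X) (u.lTensor _ t)) fun x => by
        change TensorProduct.rid A ((toBase A G).obj X) (x ⊗ₜ[A] (1 : A)) = x
        rw [TensorProduct.rid_tmul, one_smul]
  exact (hι ((toBase A G).obj X)).comp h1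

lemma exists_retract_diag {N : ModuleCat.{u} (MonoidAlgebra A G)} (ι : trivialModule A G ⟶ N)
    (hι : IsPureMono ((toBase A G).map ι)) (I : ModuleCat.{u} (MonoidAlgebra A G))
    (hI : Injective I) : Nonempty (Retract I (diag I N)) := by
  obtain ⟨f, hf⟩ := exists_diag_embedding ι hι I
  exact ⟨⟨f, Injective.factorThru (𝟙 I) f, Injective.comp_factorThru _ _⟩⟩

lemma isPureMono_of_isSplitMono {X Y : ModuleCat.{u} A} (f : X ⟶ Y) (hf : IsSplitMono f) :
    IsPureMono f := fun L => by
  have h : (retraction f).hom ∘ₗ f.hom = LinearMap.id :=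
    congrArg ModuleCat.Hom.hom (IsSplitMono.id f)
  refine Function.LeftInverse.injective (g := (retraction f).hom.lTensor L) fun x => ?_
  rw [← LinearMap.comp_apply, ← LinearMap.lTensor_comp, h, LinearMap.lTensor_id,
    LinearMap.id_apply]

lemma exists_nat_of_lt_top {s : WithBot ℕ∞} (h : s < ⊤) : ∃ n : ℕ, s ≤ n := by
  induction s with
  | bot => exact ⟨0, bot_le⟩
  | coe e =>
    obtain ⟨n, rfl⟩ := ENat.ne_top_iff_exists.1 (WithBot.coe_lt_coe.1 h).ne
    exact ⟨n, le_rfl⟩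

lemma exists_of_resolutionDim_le {R : Type u} [Ring R] {𝓟 : ModuleCat.{u} R → Prop}
    {M : ModuleCat.{u} R} {n : ℕ} (h : resolutionDim 𝓟 M ≤ n) : ∃ m ≤ n, HasResolution 𝓟 m M := by
  by_contra! H
  have h1 : ((n + 1 : ℕ) : ℕ∞) ≤ resolutionDim 𝓟 M := le_iInf₂ fun m hm => by
    by_contra! hlt
    exact H m (Nat.lt_succ_iff.1 (Nat.cast_lt.1 hlt)) hm
  exact absurd (Nat.cast_le.1 (h1.trans h)) (by omega)

/-- Over a group with a characteristic module, finiteness of `spli` passes to the group algebra. -/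
theorem HasCharacteristicModule.exists_spliLE (h : HasCharacteristicModule A G) (hA : spli A < ⊤) :
    ∃ m, SpliLE (MonoidAlgebra A G) m := by
  obtain ⟨N, ι, hfree, hN, -, hι⟩ := h
  obtain ⟨n, hn⟩ : ∃ n : ℕ, ∀ I : ModuleCat.{u} A, Injective I →
      HasProjectiveDimensionLT I (n + 1) := by
    obtain ⟨n, hn⟩ := exists_nat_of_lt_top hA
    exact ⟨n, fun I hI => (projectiveDimension_le_iff I n).1 ((le_iSup₂ I hI).trans hn)⟩
  obtain ⟨k, hk⟩ : ∃ k : ℕ, HasProjectiveDimensionLT N (k + 1) :=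
    (projectiveDimension_ne_top_iff N).1 hN.ne
  have hflat : Module.Flat A N := by
    have : Module.Free A N := hfree
    infer_instance
  refine ⟨n + k, fun I hI => ?_⟩
  obtain ⟨r⟩ := exists_retract_diag ι (isPureMono_of_isSplitMono _ hι) I hI
  have h := dimension_diag (A := A) (G := G)
    (DA := fun n X => HasProjectiveDimensionLT ((toBase A G).obj X) (n + 1))
    (DH := fun n X => HasProjectiveDimensionLT X (n + 1))
    (fun n X X' hX ⟨P, hP, hs⟩ => by
      obtain ⟨i, p, w, hs⟩ := hs.restrict
      exact (hs.hasProjectiveDimensionLT_X₃_iff n (projective_toBase P hP)).1 hX)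
    (fun n X X' hX ⟨P, hP, i, p, w, hs⟩ => (hs.hasProjectiveDimensionLT_X₃_iff n hP).1 hX)
    (fun n X Y Z ⟨i, p, w, hs⟩ hX hY => hs.hasProjectiveDimensionLT_X₃ _ hX hY)
    (fun n m X h hX => hasProjectiveDimensionLT_of_ge X (n + 1) (m + 1) (by omega))
    (fun P hP => by
      have := projective_toBase P hP
      exact inferInstanceAs (HasProjectiveDimensionLT ((toBase A G).obj P) 1))
    (fun P hP => inferInstanceAs (HasProjectiveDimensionLT P 1))
    (fun X M hX hM _ => by
      have : Projective ((toBase A G).obj X) := projective_iff_hasProjectiveDimensionLT_one.2 hX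
      have : Module.Projective A X := projective_module ((toBase A G).obj X)
      have := projective_diag X M (projective_iff_hasProjectiveDimensionLT_one.2 hM)
      exact inferInstanceAs (HasProjectiveDimensionLT (diag X M) 1))
    n k (hn _ (injective_toBase I hI)) hk hflat
  exact r.hasProjectiveDimensionLT (n + k + 1)

/-- Rotating trilinear forms reduces the extension of linear maps into `(X ⊗ M)^∨` to that of
linear maps into `M^∨`. -/
lemma injective_dual_diag {X M : ModuleCat.{u} (MonoidAlgebra A G)} (hX : Module.Flat A X)
    (hM : Injective (dual M)) : Injective (dual (diag X M)) := by
  refine ⟨fun {Y Y'} g f hf => ?_⟩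
  have hM' : Module.Injective (MonoidAlgebra A G) (StarDual M) := injective_module (dual M)
  obtain ⟨ψ, hψ⟩ := hM'.out (diagMap f.hom (LinearMap.id : X →ₗ[MonoidAlgebra A G] X))
    (diagMap_injective (M := X) f.hom ((ModuleCat.mono_iff_injective f).1 hf))
    (rot (X := Y) (rot (X := M) (StarDual.swap g.hom)))
  refine ⟨ModuleCat.ofHom (StarDual.swap (rot ψ)), ?_⟩
  refine ModuleCat.hom_ext (LinearMap.ext fun y => StarDual.ext fun t => ?_)
  change rot ψ t (f y) = g y t
  induction t using diag_induction with
  | zero => rw [map_zero, map_zero]; rfl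
  | tmul x m =>
    rw [rot_apply]
    exact DFunLike.congr_fun (hψ (diagTmul y x)) m
  | add s t hs ht => rw [map_add, map_add, StarDual.add_apply, hs, ht]

/-- Over a group with a weak characteristic module, finiteness of `sfli` passes to the group
algebra. -/
theorem HasWeakCharacteristicModule.exists_sfliLE (h : HasWeakCharacteristicModule A G)
    (hA : sfli A < ⊤) : ∃ m, SfliLE (MonoidAlgebra A G) m := by
  obtain ⟨N, ι, hflat, hN, -, hι⟩ := h
  obtain ⟨n, hn⟩ : ∃ n : ℕ, SfliLE A n := by
    obtain ⟨n, hn⟩ := ENat.ne_top_iff_exists.1 hA.ne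
    refine ⟨n, fun I hI => ?_⟩
    obtain ⟨m, hm, h⟩ := exists_of_resolutionDim_le
      ((le_iSup₂ (f := fun (I : ModuleCat.{u} A) (_ : Injective I) => flatDim A I) I hI).trans hn.ge)
    have := h.hasInjectiveDimensionLT_dual
    exact hasInjectiveDimensionLT_of_ge (dual I) (m + 1) (n + 1) (by omega)
  obtain ⟨k, hk⟩ : ∃ k : ℕ, HasInjectiveDimensionLT (dual N) (k + 1) := by
    obtain ⟨k, hk⟩ := exists_of_resolutionDim_lt hN
    exact ⟨k, hk.hasInjectiveDimensionLT_dual⟩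
  refine ⟨n + k, fun I hI => ?_⟩
  obtain ⟨r⟩ := exists_retract_diag ι hι I hI
  have h := dimension_diag (A := A) (G := G)
    (DA := fun n X => HasInjectiveDimensionLT (dual ((toBase A G).obj X)) (n + 1))
    (DH := fun n X => HasInjectiveDimensionLT (dual X) (n + 1))
    (fun n X X' hX ⟨P, hP, hs⟩ => by
      obtain ⟨i, p, w, hs⟩ := hs.restrict.dual
      exact (hs.hasInjectiveDimensionLT_X₃_iff n ((isFlat_iff_injective_dual _).1
        (isFlat_of_projective _ (projective_toBase P hP)))).2 hX)
    (fun n X X' hX ⟨P, hP, hs⟩ => by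
      obtain ⟨i, p, w, hs⟩ := hs.dual
      exact (hs.hasInjectiveDimensionLT_X₃_iff n ((isFlat_iff_injective_dual _).1
        (isFlat_of_projective _ hP))).2 hX)
    (fun n X Y Z hs hX hY => by
      obtain ⟨i, p, w, hs⟩ := hs.dual
      exact hs.hasInjectiveDimensionLT_X₁ _ hX hY)
    (fun n m X h hX => hasInjectiveDimensionLT_of_ge (dual X) (n + 1) (m + 1) (by omega))
    (fun P hP => by
      have := (isFlat_iff_injective_dual _).1 (isFlat_of_projective _ (projective_toBase P hP))
      exact injective_iff_hasInjectiveDimensionLT_one.1 this)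
    (fun P hP => by
      have := (isFlat_iff_injective_dual _).1 (isFlat_of_projective _ hP)
      exact injective_iff_hasInjectiveDimensionLT_one.1 this)
    (fun X M hX hM _ => by
      exact injective_iff_hasInjectiveDimensionLT_one.1 (injective_dual_diag
        ((flat_iff_injective_dual ((toBase A G).obj X)).2
          (injective_iff_hasInjectiveDimensionLT_one.2 hX))
        (injective_iff_hasInjectiveDimensionLT_one.2 hM)))
    n k (hn _ (injective_toBase I hI)) hk hflat
  exact (dualRetract r).hasInjectiveDimensionLT (n + k + 1)

end Diagonal

/-! ### Groups of type `Φ` -/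

section Phi

variable {A : Type u} [CommRing A] {G : Type u} [Group G]

attribute [local instance] groupStar

/-- If `dim` is finite on the modules over the subgroups in `𝒳`, then `κ` is the supremum of `dim`
over all `AG`-modules, and being of type `Φ` means that `dim` is finite on all `AG`-modules. -/
lemma kappa_lt_top_iff {dim : (R : Type u) → [Ring R] → ModuleCat.{u} R → ℕ∞} {𝒳 : Set GrpCat.{u}}
    (hH : ∀ H : Subgroup G, GrpCat.of H ∈ 𝒳 →
      ∀ N : ModuleCat.{u} (MonoidAlgebra A H), dim (MonoidAlgebra A H) N < ⊤)
    (hG : (∀ M : ModuleCat.{u} (MonoidAlgebra A G), dim (MonoidAlgebra A G) M < ⊤) →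
      ∃ n : ℕ, ∀ M : ModuleCat.{u} (MonoidAlgebra A G), dim (MonoidAlgebra A G) M ≤ n) :
    kappa dim A G 𝒳 < ⊤ ↔ IsOfTypePhi dim A G 𝒳 := by
  have h : ∀ (M : ModuleCat.{u} (MonoidAlgebra A G)) (H : Subgroup G), GrpCat.of H ∈ 𝒳 →
      dim (MonoidAlgebra A H) (resSubgroup A H M) < ⊤ := fun M H hH' => hH H hH' _
  constructor
  · intro hκ M
    exact iff_of_true (lt_of_le_of_lt (le_iSup₂ (f := fun (M : ModuleCat.{u} (MonoidAlgebra A G))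
      (_ : ∀ H : Subgroup G, GrpCat.of H ∈ 𝒳 →
        dim (MonoidAlgebra A H) (resSubgroup A H M) < ⊤) => dim (MonoidAlgebra A G) M) M (h M)) hκ)
      (h M)
  · intro hΦ
    obtain ⟨n, hn⟩ := hG fun M => (hΦ M).2 (h M)
    exact lt_of_le_of_lt (iSup₂_le fun M _ => hn M) (ENat.natCast_lt_top n)

theorem kappa_Gpd_lt_top_iff {𝒳 : Set GrpCat.{u}} (hA : spli A < ⊤) (h𝒳 : 𝒳 ⊆ classChar A) :
    kappa Gpd A G 𝒳 < ⊤ ↔ IsOfTypePhi Gpd A G 𝒳 := by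
  refine kappa_lt_top_iff (fun H hH N => ?_) fun h => ?_
  · obtain ⟨m, hm⟩ := HasCharacteristicModule.exists_spliLE (A := A) (G := H) (h𝒳 hH) hA
    exact (Gpd_le hm N).trans_lt (ENat.natCast_lt_top m)
  · obtain ⟨m, hm⟩ := exists_spliLE_of_Gpd h
    exact ⟨m, Gpd_le hm⟩

theorem kappa_Gid_lt_top_iff {𝒳 : Set GrpCat.{u}} (hA : spli A < ⊤) (h𝒳 : 𝒳 ⊆ classChar A) :
    kappa Gid A G 𝒳 < ⊤ ↔ IsOfTypePhi Gid A G 𝒳 := by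
  refine kappa_lt_top_iff (fun H hH N => ?_) fun h => ?_
  · obtain ⟨m, hm⟩ := HasCharacteristicModule.exists_spliLE (A := A) (G := H) (h𝒳 hH) hA
    exact (Gid_le hm N).trans_lt (ENat.natCast_lt_top m)
  · obtain ⟨m, hm⟩ := exists_spliLE_of_Gid h
    exact ⟨m, Gid_le hm⟩

theorem kappa_Gfd_lt_top_iff {𝒳 : Set GrpCat.{u}} (hA : sfli A < ⊤) (h𝒳 : 𝒳 ⊆ classWChar A) :
    kappa Gfd A G 𝒳 < ⊤ ↔ IsOfTypePhi Gfd A G 𝒳 := by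
  refine kappa_lt_top_iff (fun H hH N => ?_) fun h => ?_
  · obtain ⟨m, hm⟩ := HasWeakCharacteristicModule.exists_sfliLE (A := A) (G := H) (h𝒳 hH) hA
    exact (Gfd_le hm N).trans_lt (ENat.natCast_lt_top m)
  · obtain ⟨m, hm⟩ := exists_sfliLE_of_Gfd h
    exact ⟨m, Gfd_le hm⟩

end Phi

end PhiGorenstein

end

theorem proposition3p3 (A : Type u) [CommRing A] (G : Type u) [Group G] (𝒳 : Set GrpCat.{u}) :
    (spli A < ⊤ → 𝒳 ⊆ classChar A →
      (kappa Gpd A G 𝒳 < ⊤ ↔ IsOfTypePhi Gpd A G 𝒳) ∧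
      (kappa Gid A G 𝒳 < ⊤ ↔ IsOfTypePhi Gid A G 𝒳)) ∧
    (sfli A < ⊤ → 𝒳 ⊆ classWChar A →
      (kappa Gfd A G 𝒳 < ⊤ ↔ IsOfTypePhi Gfd A G 𝒳)) :=
  ⟨fun hA h𝒳 => ⟨kappa_Gpd_lt_top_iff hA h𝒳, kappa_Gid_lt_top_iff hA h𝒳⟩,
    fun hA h𝒳 => kappa_Gfd_lt_top_iff hA h𝒳⟩
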